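/- Let $k$ be an algebraically closed field of characteristic $0$ and let $\mathcal E$ be a symmetric fusion category over $k$, with braiding $r$. **Definitions.** A *multifusion category over $\mathcal E$* is a multifusion category $\mathcal A$ (a finite semisimple $k$-linear rigid monoidal category) with a $k$-linear braided monoidal functor $T_{\mathcal A}:\mathcal E\to Z(\mathcal A)$ to the Drinfeld center, $e\mapsto (T_{\mathcal A}(e), z_{e,-}:T_{\mathcal A}(e)\otimes - \cong -\otimes T_{\mathcal A}(e))$. For example, $\mathcal E$ is a multifusion category over itself by $e\mapsto (e, r_{e,-})$. Let $\mathcal C,\mathcal D$ be multifusion categories over $\mathcal E$. The 2-category $\mathrm{BMod}_{\mathcal C|\mathcal D}(\mathrm{Cat}^{fs}_{\mathcal E})$ is as follows. * An object is a finite semisimple $k$-linear category $\mathcal M$ with the structure of a ($k$-bilinear) left $\mathcal E$-module and of a $\mathcal C$-$\mathcal D$ bimodule, with a left $\mathcal E$-module structure $e\odot(c\odot m\odot d)\cong c\odot(e\odot m)\odot d$ on each functor $c\odot-\odot d$, and with monoidal natural isomorphisms $u_e:T_{\mathcal C}(e)\odot-\cong e\odot-$ and $\bar u_e:-\odot T_{\mathcal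 D}(e)\cong e\odot-$ of left $\mathcal E$-module functors ($e\odot -$ being a left $\mathcal E$-module functor through the symmetry of $\mathcal E$), such that for all $e,c,d$ and $m \in \mathcal M$: the composites $(T_{\mathcal C}(e)\otimes c)\odot m\odot d\cong T_{\mathcal C}(e)\odot (c\odot m\odot d)\xrightarrow{u_e} e\odot(c\odot m\odot d)\cong c\odot(e\odot m)\odot d$ and $(T_{\mathcal C}(e)\otimes c)\odot m\odot d\xrightarrow{z_{e,c}}(c\otimes T_{\mathcal C}(e))\odot m\odot d\cong c\odot(T_{\mathcal C}(e)\odot m)\odot d\xrightarrow{u_e}c\odot(e\odot m)\odot d$ are equal, and the composites $c\odot m\odot(d\otimes T_{\mathcal D}(e))\cong (c\odot m\odot d)\odot T_{\mathcal D}(e)\xrightarrow{\bar u_e}e\odot(c\odot m\odot d)\cong c\odot(e\odot m)\odot d$ and $c\odot m\odot(d\otimes T_{\mathcal D}(e))\xrightarrow{z_{e,d}^{-1}}c\odot m\odot(T_{\mathcal D}(e)\otimes d)\cong c\odot(m\odot T_{\mathcal D}(e))\odot d\xrightarrow{\bar u_e}c\odot(e\odot m)\odot d$ are equal. * A 1-morphism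 $F:\mathcal M\to\mathcal N$ is a $k$-linear functor with the structures of a $\mathcal C$-$\mathcal D$ bimodule functor and of a left $\mathcal E$-module functor such that $F(T_{\mathcal C}(e)\odot m)\xrightarrow{u_e}F(e\odot m)\cong e\odot F(m)$ equals $F(T_{\mathcal C}(e)\odot m)\cong T_{\mathcal C}(e)\odot F(m)\xrightarrow{u_e}e\odot F(m)$, and $F(m\odot T_{\mathcal D}(e))\xrightarrow{\bar u_e}F(e\odot m)\cong e\odot F(m)$ equals $F(m\odot T_{\mathcal D}(e))\cong F(m)\odot T_{\mathcal D}(e)\xrightarrow{\bar u_e}e\odot F(m)$. * A 2-morphism is a $\mathcal C$-$\mathcal D$ bimodule natural transformation. Denote by $\mathrm{Fun}_{\mathcal C\boxtimes_{\mathcal E}\mathcal D^{rev}}(\mathcal M,\mathcal N)$ the category of 1-morphisms $\mathcal M\to\mathcal N$ and 2-morphisms in $\mathrm{BMod}_{\mathcal C|\mathcal D}(\mathrm{Cat}^{fs}_{\mathcal E})$. Put $\mathrm{Fun}_{\mathcal D^{rev}}:=\mathrm{Fun}_{\mathcal E\boxtimes_{\mathcal E}\mathcal D^{rev}}$ (an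 object of $\mathrm{BMod}_{\mathcal C|\mathcal D}(\mathrm{Cat}^{fs}_{\mathcal E})$ being regarded as an $\mathcal E$-$\mathcal D$ bimodule through its left $\mathcal E$-module structure) and $\mathrm{Fun}_{\mathcal C}:=\mathrm{Fun}_{\mathcal C\boxtimes_{\mathcal E}\mathcal E^{rev}}$; let $\mathrm{Fun}_{\mathcal E}(\mathcal M,\mathcal N)$ be the category of $k$-linear left $\mathcal E$-module functors and left $\mathcal E$-module natural transformations. **Bimodule structures.** In the following, a $\mathcal C$-$\mathcal C$ bimodule $\mathcal N$ with monoidal natural isomorphisms $v_e:T_{\mathcal C}(e)\odot-\cong-\odot T_{\mathcal C}(e)$ is regarded as a $\mathcal C$-$\mathcal C$ bimodule over $\mathcal E$ through $e\odot n:=T_{\mathcal C}(e)\odot n$, $u_e=\mathrm{id}$, $\bar u_e=v_e^{-1}$. The category $\mathcal C$ is a $\mathcal C$-$\mathcal C$ bimodule over $\mathcal E$ by its tensor product and $v_e=z_{e,-}$. Each of the categories $\mathrm{Fun}_{\mathcal D^{rev}}(\mathcal M,\mathcal M')$ and $\mathrm{Fun}_{\mathcal E}(\mathcal M,\mathcal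 M')$ is a $\mathcal C$-$\mathcal C$ bimodule over $\mathcal E$ by $c\odot g\odot c':=c\odot g(c'\odot-)$ and $$(v_e)_g: T_{\mathcal C}(e)\odot g(-)\xrightarrow{u_e}e\odot g(-)\cong g(e\odot-)\xrightarrow{u_e^{-1}}g(T_{\mathcal C}(e)\odot-).$$ **Statement.** Let $\mathcal C$ and $\mathcal D$ be multifusion categories over $\mathcal E$ and let $\mathcal M,\mathcal M'\in\mathrm{BMod}_{\mathcal C|\mathcal D}(\mathrm{Cat}^{fs}_{\mathcal E})$. There is a $k$-linear equivalence of categories $$\mathrm{Fun}_{\mathcal C\boxtimes_{\mathcal E}\mathcal C^{rev}}\bigl(\mathcal C,\mathrm{Fun}_{\mathcal D^{rev}}(\mathcal M,\mathcal M')\bigr)\simeq\mathrm{Fun}_{\mathcal C\boxtimes_{\mathcal E}\mathcal D^{rev}}(\mathcal M,\mathcal M').$$ If $\mathcal D=\mathcal E$, there is moreover a $k$-linear equivalence of categories $$\mathrm{Fun}_{\mathcal C\boxtimes_{\mathcal E}\mathcal C^{rev}}\bigl(\mathcal C,\mathrm{Fun}_{\mathcal E}(\mathcal M,\mathcal M')\bigr)\simeq\mathrm{Fun}_{\mathcal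 C}(\mathcal M,\mathcal M').$$ -/

import Mathlib

open CategoryTheory MonoidalCategory
open scoped MonoidalLeftAction MonoidalRightAction
open Functor.LaxLeftLinear Functor.OplaxLeftLinear Functor.LaxRightLinear Functor.OplaxRightLinear

set_option linter.unusedVariables false
set_option linter.checkUnivs false
set_option linter.unusedSimpArgs false
set_option linter.unusedSectionVars false

noncomputable section

namespace OverSymm

universe v u vE uE vC uC vD uD vM uM

/-! ### Finite semisimple categories, multifusion and symmetric fusion categories -/

/-- A `k`-linear category is finite semisimple if it is abelian, its morphism spaces are finite
dimensional, it has finitely many simple objects up to isomorphism, and every object is a finite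
direct sum of simple objects. -/
structure IsFiniteSemisimple (k : Type*) [Field k] (A : Type u) [Category.{v} A] [Preadditive A]
    [Linear k A] : Prop where
  abelian : ∃ a : Abelian A, a.toPreadditive = (inferInstance : Preadditive A)
  finite_hom : ∀ X Y : A, FiniteDimensional k (X ⟶ Y)
  finite_simple : ∃ (n : ℕ) (S : Fin n → A), ∀ X : A, Simple X → ∃ i, Nonempty (X ≅ S i)
  semisimple : ∀ X : A, ∃ (n : ℕ) (S : Fin n → A), (∀ i, Simple (S i)) ∧
    ∃ b : Limits.Bicone S, Nonempty b.IsBilimit ∧ Nonempty (X ≅ b.pt)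

/-- A multifusion category: a finite semisimple `k`-linear rigid monoidal category with
`k`-bilinear tensor product. -/
class IsMultifusion (k : Type*) [Field k] (A : Type u) [Category.{v} A] [Preadditive A]
    [Linear k A] [MonoidalCategory A] : Prop extends MonoidalPreadditive A, MonoidalLinear k A where
  finiteSemisimple : IsFiniteSemisimple k A
  rigid : Nonempty (RigidCategory A)

/-- A fusion category: a multifusion category with simple tensor unit. -/
class IsFusion (k : Type*) [Field k] (A : Type u) [Category.{v} A] [Preadditive A]
    [Linear k A] [MonoidalCategory A] : Prop extends IsMultifusion k A where
  simple_unit : Simple (𝟙_ A)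

/-! ### Monoidal categories over a symmetric monoidal category -/

/-- The structure of a monoidal category over `E` on `A`: a braided monoidal functor
`T : E ⥤ Z(A)` to the Drinfeld centre. -/
class CentralStructure (E : Type uE) [Category.{vE} E] [MonoidalCategory E] [SymmetricCategory E]
    (A : Type u) [Category.{v} A] [MonoidalCategory A] where
  functor : E ⥤ Center A
  braided : functor.Braided

attribute [reducible, instance] CentralStructure.braided

/-- `T : E ⥤ Z(A)` is `k`-linear. (The linear structure of `Z(A)` is that of `A`.) -/
class CentralStructure.IsLinear (k : Type*) [Field k]
    (E : Type uE) [Category.{vE} E] [Preadditive E] [Linear k E]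
    [MonoidalCategory E] [SymmetricCategory E]
    (A : Type u) [Category.{v} A] [Preadditive A] [Linear k A] [MonoidalCategory A]
    [CentralStructure E A] : Prop where
  map_add : ∀ {e e' : E} (f g : e ⟶ e'), ((CentralStructure.functor (A := A)).map (f + g)).f =
    ((CentralStructure.functor (A := A)).map f).f + ((CentralStructure.functor (A := A)).map g).f
  map_smul : ∀ {e e' : E} (r : k) (f : e ⟶ e'), ((CentralStructure.functor (A := A)).map (r • f)).f =
    r • ((CentralStructure.functor (A := A)).map f).f

lemma comp_assoc₆ {A : Type u} [Category.{v} A] {a b c d e f g : A} (x₁ : a ⟶ b) (x₂ : b ⟶ c) (x₃ : c ⟶ d) (x₄ : d ⟶ e)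
    (x₅ : e ⟶ f) (x₆ : f ⟶ g) :
    (x₁ ≫ x₂ ≫ x₃ ≫ x₄ ≫ x₅) ≫ x₆ = x₁ ≫ x₂ ≫ x₃ ≫ x₄ ≫ x₅ ≫ x₆ := by
  simp only [Category.assoc]

section Central

variable {E : Type uE} [Category.{vE} E] [MonoidalCategory E] [SymmetricCategory E]
    (A : Type u) [Category.{v} A] [MonoidalCategory A] [CentralStructure E A]

/-- The object of `A` underlying `T(e)`. -/
def T (e : E) : A := ((CentralStructure.functor (A := A)).obj e).1

/-- The morphism of `A` underlying `T(f)`. -/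
def Tmap {e e' : E} (f : e ⟶ e') : T A e ⟶ T A e' :=
  ((CentralStructure.functor (A := A)).map f).f

/-- The half braiding `z_{e,a} : T(e) ⊗ a ≅ a ⊗ T(e)` of `T(e) ∈ Z(A)`. -/
def z (e : E) (a : A) : T A e ⊗ a ≅ a ⊗ T A e :=
  ((CentralStructure.functor (A := A)).obj e).2.β a

/-- The monoidal structure `T(e) ⊗ T(e') ⟶ T(e ⊗ e')` of `T`. -/
def Tμ (e e' : E) : T A e ⊗ T A e' ⟶ T A (e ⊗ e') :=
  (Functor.LaxMonoidal.μ (CentralStructure.functor (A := A)) e e').f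

/-- The unit of the monoidal structure of `T`. -/
def Tε : 𝟙_ A ⟶ T A (𝟙_ E) :=
  (Functor.LaxMonoidal.ε (CentralStructure.functor (E := E) (A := A))).f


lemma z_natural_left {e e' : E} (f : e ⟶ e') (a : A) :
    Tmap A f ▷ a ≫ (z A e' a).hom = (z A e a).hom ≫ a ◁ Tmap A f :=
  ((CentralStructure.functor (A := A)).map f).comm a

lemma z_natural (e : E) {a b : A} (f : a ⟶ b) :
    T A e ◁ f ≫ (z A e b).hom = (z A e a).hom ≫ f ▷ T A e :=
  ((CentralStructure.functor (A := A)).obj e).2.naturality f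

lemma z_tensor (e : E) (a b : A) : (z A e (a ⊗ b)).hom =
    (α_ _ _ _).inv ≫ (z A e a).hom ▷ b ≫ (α_ _ _ _).hom ≫ a ◁ (z A e b).hom ≫ (α_ _ _ _).inv :=
  ((CentralStructure.functor (A := A)).obj e).2.monoidal a b

lemma Tμ_z (e e' : E) (a : A) : Tμ A e e' ▷ a ≫ (z A (e ⊗ e') a).hom =
    (α_ _ _ _).hom ≫ T A e ◁ (z A e' a).hom ≫ (α_ _ _ _).inv ≫ (z A e a).hom ▷ T A e' ≫
      (α_ _ _ _).hom ≫ a ◁ Tμ A e e' := by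
  have h := (Functor.LaxMonoidal.μ (CentralStructure.functor (A := A)) e e').comm a
  rw [Center.tensor_β] at h
  simp only [Iso.trans_hom, whiskerLeftIso_hom, whiskerRightIso_hom, Iso.symm_hom] at h
  exact h.trans (comp_assoc₆ _ _ _ _ _ _)

lemma Tε_z (a : A) : Tε (E := E) A ▷ a ≫ (z A (𝟙_ E) a).hom =
    (λ_ a).hom ≫ (ρ_ a).inv ≫ a ◁ Tε A := by
  have h := (Functor.LaxMonoidal.ε (CentralStructure.functor (E := E) (A := A))).comm a
  rw [Center.tensorUnit_β] at h
  exact h.trans (Category.assoc _ _ _)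

lemma Tμ_braiding (e e' : E) : Tμ A e e' ≫ Tmap A (β_ e e').hom =
    (z A e (T A e')).hom ≫ Tμ A e' e :=
  congrArg Center.Hom.f
    (Functor.LaxBraided.braided (F := CentralStructure.functor (E := E) (A := A)) e e')

@[simp]
lemma Tmap_id (e : E) : Tmap A (𝟙 e) = 𝟙 (T A e) :=
  (congrArg Center.Hom.f
    (CategoryTheory.Functor.map_id (CentralStructure.functor (A := A)) e) :)

@[simp]
lemma Tmap_comp {e e' e'' : E} (f : e ⟶ e') (g : e' ⟶ e'') :
    Tmap A (f ≫ g) = Tmap A f ≫ Tmap A g :=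
  (congrArg Center.Hom.f
    (CategoryTheory.Functor.map_comp (CentralStructure.functor (A := A)) f g) :)

lemma Tμ_natural_left {e e' : E} (f : e ⟶ e') (x : E) :
    Tmap A f ▷ T A x ≫ Tμ A e' x = Tμ A e x ≫ Tmap A (f ▷ x) :=
  congrArg Center.Hom.f
    (Functor.LaxMonoidal.μ_natural_left (CentralStructure.functor (E := E) (A := A)) f x)

lemma Tμ_natural_right (x : E) {e e' : E} (f : e ⟶ e') :
    T A x ◁ Tmap A f ≫ Tμ A x e' = Tμ A x e ≫ Tmap A (x ◁ f) :=
  congrArg Center.Hom.f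
    (Functor.LaxMonoidal.μ_natural_right (CentralStructure.functor (E := E) (A := A)) x f)

lemma Tμ_assoc (x y w : E) :
    Tμ A x y ▷ T A w ≫ Tμ A (x ⊗ y) w ≫ Tmap A (α_ x y w).hom =
      (α_ _ _ _).hom ≫ T A x ◁ Tμ A y w ≫ Tμ A x (y ⊗ w) :=
  congrArg Center.Hom.f
    (Functor.LaxMonoidal.associativity (CentralStructure.functor (E := E) (A := A)) x y w)

lemma Tμ_unit_left (x : E) :
    (λ_ (T A x)).hom = Tε A ▷ T A x ≫ Tμ A (𝟙_ E) x ≫ Tmap A (λ_ x).hom :=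
  congrArg Center.Hom.f
    (Functor.LaxMonoidal.left_unitality (CentralStructure.functor (E := E) (A := A)) x)

lemma Tμ_unit_right (x : E) :
    (ρ_ (T A x)).hom = T A x ◁ Tε A ≫ Tμ A x (𝟙_ E) ≫ Tmap A (ρ_ x).hom :=
  congrArg Center.Hom.f
    (Functor.LaxMonoidal.right_unitality (CentralStructure.functor (E := E) (A := A)) x)

/-- `T(e) ⊗ T(e') ≅ T(e ⊗ e')`. -/
@[simps! hom]
def TμIso (e e' : E) : T A e ⊗ T A e' ≅ T A (e ⊗ e') where
  hom := Tμ A e e'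
  inv := (Functor.OplaxMonoidal.δ (CentralStructure.functor (A := A)) e e').f
  hom_inv_id := congrArg Center.Hom.f
    (Functor.Monoidal.μ_δ (CentralStructure.functor (E := E) (A := A)) e e')
  inv_hom_id := congrArg Center.Hom.f
    (Functor.Monoidal.δ_μ (CentralStructure.functor (E := E) (A := A)) e e')

/-- `𝟙 ≅ T(𝟙)`. -/
@[simps! hom]
def TεIso : 𝟙_ A ≅ T A (𝟙_ E) where
  hom := Tε A
  inv := (Functor.OplaxMonoidal.η (CentralStructure.functor (A := A))).f
  hom_inv_id := congrArg Center.Hom.f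
    (Functor.Monoidal.ε_η (CentralStructure.functor (E := E) (A := A)))
  inv_hom_id := congrArg Center.Hom.f
    (Functor.Monoidal.η_ε (CentralStructure.functor (E := E) (A := A)))

lemma z_unit (e : E) : (z A e (𝟙_ A)).hom = (ρ_ (T A e)).hom ≫ (λ_ (T A e)).inv := by
  have h := z_tensor A e (𝟙_ A) (𝟙_ A)
  have h2 := z_natural A e (λ_ (𝟙_ A)).hom
  rw [h] at h2
  have h3 : (z A e (𝟙_ A)).hom ▷ 𝟙_ A ≫ ((α_ _ _ _).hom ≫ 𝟙_ A ◁ (z A e (𝟙_ A)).hom ≫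
      (α_ _ _ _).inv ≫ (λ_ (𝟙_ A)).hom ▷ T A e) =
      (z A e (𝟙_ A)).hom ▷ 𝟙_ A ≫ (ρ_ _).hom := by
    rw [rightUnitor_naturality, ← cancel_epi (α_ _ _ _).inv]
    simp only [Category.assoc] at h2
    rw [← h2]
    monoidal
  rw [cancel_epi] at h3
  have h4 : (α_ (𝟙_ A) (T A e) (𝟙_ A)).hom ≫ 𝟙_ A ◁ (z A e (𝟙_ A)).hom ≫
      (α_ _ _ _).inv ≫ (λ_ (𝟙_ A)).hom ▷ T A e = (ρ_ (𝟙_ A ⊗ T A e)).hom ≫ (λ_ _).hom ≫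
        (ρ_ _).inv ≫ (z A e (𝟙_ A)).hom := by
    have : 𝟙_ A ◁ (z A e (𝟙_ A)).hom = (λ_ _).hom ≫ (z A e (𝟙_ A)).hom ≫ (λ_ _).inv := by simp
    rw [this]
    monoidal
  rw [h4] at h3
  have h5 : (z A e (𝟙_ A)).hom = (ρ_ _).hom ≫ (λ_ _).inv ≫ (ρ_ _).inv ≫ (ρ_ _).hom := by
    rw [← h3]; simp
  simpa using h5

end Central

/-- `E` is a monoidal category over itself, by `e ↦ (e, r_{e,-})` with `r` the braiding of `E`. -/
instance centralSelf (E : Type uE) [Category.{vE} E] [MonoidalCategory E] [SymmetricCategory E] :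
    CentralStructure E E where
  functor := Center.ofBraided E
  braided :=
    { toMonoidal := inferInstance
      braided := fun X Y => by
        ext
        exact (Category.id_comp _).trans (Category.comp_id _).symm }

/-! ### Bilinear actions -/

/-- The left action `A × M ⥤ M` is `k`-bilinear. -/
class LinearLeftAction (k : Type*) [Field k] (A : Type u) [Category.{v} A] [Preadditive A]
    [Linear k A] [MonoidalCategory A] (M : Type uM) [Category.{vM} M] [Preadditive M] [Linear k M]
    [MonoidalLeftAction A M] : Prop where
  right_add : ∀ (a : A) {m n : M} (f g : m ⟶ n), a ⊴ₗ (f + g) = a ⊴ₗ f + a ⊴ₗ g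
  right_smul : ∀ (a : A) {m n : M} (r : k) (f : m ⟶ n), a ⊴ₗ (r • f) = r • (a ⊴ₗ f)
  left_add : ∀ {a b : A} (f g : a ⟶ b) (m : M), (f + g) ⊵ₗ m = f ⊵ₗ m + g ⊵ₗ m
  left_smul : ∀ {a b : A} (r : k) (f : a ⟶ b) (m : M), (r • f) ⊵ₗ m = r • (f ⊵ₗ m)

/-- The right action `M × A ⥤ M` is `k`-bilinear. -/
class LinearRightAction (k : Type*) [Field k] (A : Type u) [Category.{v} A] [Preadditive A]
    [Linear k A] [MonoidalCategory A] (M : Type uM) [Category.{vM} M] [Preadditive M] [Linear k M]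
    [MonoidalRightAction A M] : Prop where
  left_add : ∀ {m n : M} (f g : m ⟶ n) (a : A), (f + g) ⊵ᵣ a = f ⊵ᵣ a + g ⊵ᵣ a
  left_smul : ∀ {m n : M} (r : k) (f : m ⟶ n) (a : A), (r • f) ⊵ᵣ a = r • (f ⊵ᵣ a)
  right_add : ∀ (m : M) {a b : A} (f g : a ⟶ b), m ⊴ᵣ (f + g) = m ⊴ᵣ f + m ⊴ᵣ g
  right_smul : ∀ (m : M) {a b : A} (r : k) (f : a ⟶ b), m ⊴ᵣ (r • f) = r • (m ⊴ᵣ f)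

/-! ### Bimodules over `E` -/

/-- The isomorphism `e ⊙ (e' ⊙ m) ≅ e' ⊙ (e ⊙ m)` given by the symmetry of `E`. -/
def swap {E : Type uE} [Category.{vE} E] [MonoidalCategory E] [SymmetricCategory E]
    {M : Type uM} [Category.{vM} M] [MonoidalLeftAction E M] (e e' : E) (m : M) :
    e ⊙ₗ e' ⊙ₗ m ⟶ e' ⊙ₗ e ⊙ₗ m :=
  (αₗ e e' m).inv ≫ (β_ e e').hom ⊵ₗ m ≫ (αₗ e' e m).hom

/-- The functor `m ↦ (c ⊙ m) ⊙ d`. -/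
@[simps]
abbrev both {C : Type uC} [Category.{vC} C] [MonoidalCategory C]
    {D : Type uD} [Category.{vD} D] [MonoidalCategory D]
    {M : Type uM} [Category.{vM} M] [MonoidalLeftAction C M] [MonoidalRightAction D M]
    (c : C) (d : D) : M ⥤ M where
  obj m := (c ⊙ₗ m) ⊙ᵣ d
  map f := (c ⊴ₗ f) ⊵ᵣ d

section Main

variable (k : Type*) [Field k]
  (E : Type uE) [Category.{vE} E] [Preadditive E] [Linear k E]
  [MonoidalCategory E] [SymmetricCategory E]
  (C : Type uC) [Category.{vC} C] [Preadditive C] [Linear k C]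
  [MonoidalCategory C] [CentralStructure E C]
  (D : Type uD) [Category.{vD} D] [Preadditive D] [Linear k D]
  [MonoidalCategory D] [CentralStructure E D]

/-- A `C`-`D` bimodule over `E`: a `k`-linear category with `k`-bilinear actions of `E` (on the
left), `C` (on the left) and `D` (on the right), a bimodule constraint `mid` between the actions
of `C` and `D`, monoidal natural isomorphisms `uC_e : T_C(e) ⊙ - ≅ e ⊙ -` and
`uD_e : - ⊙ T_D(e) ≅ e ⊙ -` of `E`-module functors, and `E`-module structures on all functors
`c ⊙ - ⊙ d`, compatible with the half braidings of `T_C(e)` and `T_D(e)`. The category is not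
required to be finite semisimple here, this is a separate hypothesis where needed. -/
structure BMod where
  carrier : Type uM
  [category : Category.{vM} carrier]
  [preadditive : Preadditive carrier]
  [linear : Linear k carrier]
  [actE : MonoidalLeftAction E carrier]
  [actC : MonoidalLeftAction C carrier]
  [actD : MonoidalRightAction D carrier]
  [linE : LinearLeftAction k E carrier]
  [linC : LinearLeftAction k C carrier]
  [linD : LinearRightAction k D carrier]
  /-- the bimodule constraint -/
  mid (c : C) (m : carrier) (d : D) : (c ⊙ₗ m) ⊙ᵣ d ≅ c ⊙ₗ (m ⊙ᵣ d)
  mid_natural_left {c c' : C} (f : c ⟶ c') (m : carrier) (d : D) :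
    (f ⊵ₗ m) ⊵ᵣ d ≫ (mid c' m d).hom = (mid c m d).hom ≫ f ⊵ₗ (m ⊙ᵣ d)
  mid_natural (c : C) {m m' : carrier} (f : m ⟶ m') (d : D) :
    (c ⊴ₗ f) ⊵ᵣ d ≫ (mid c m' d).hom = (mid c m d).hom ≫ c ⊴ₗ (f ⊵ᵣ d)
  mid_natural_right (c : C) (m : carrier) {d d' : D} (f : d ⟶ d') :
    (c ⊙ₗ m) ⊴ᵣ f ≫ (mid c m d').hom = (mid c m d).hom ≫ c ⊴ₗ (m ⊴ᵣ f)
  mid_tensor_left (c c' : C) (m : carrier) (d : D) :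
    (mid (c ⊗ c') m d).hom ≫ (αₗ c c' (m ⊙ᵣ d)).hom =
      (αₗ c c' m).hom ⊵ᵣ d ≫ (mid c (c' ⊙ₗ m) d).hom ≫ c ⊴ₗ (mid c' m d).hom
  mid_tensor_right (c : C) (m : carrier) (d d' : D) :
    (mid c m (d ⊗ d')).hom ≫ c ⊴ₗ (αᵣ m d d').hom =
      (αᵣ (c ⊙ₗ m) d d').hom ≫ (mid c m d).hom ⊵ᵣ d' ≫ (mid c (m ⊙ᵣ d) d').hom
  mid_unit_left (m : carrier) (d : D) :
    (mid (𝟙_ C) m d).hom ≫ (λₗ (m ⊙ᵣ d)).hom = (λₗ m).hom ⊵ᵣ d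
  mid_unit_right (c : C) (m : carrier) :
    (mid c m (𝟙_ D)).hom ≫ c ⊴ₗ (ρᵣ m).hom = (ρᵣ (c ⊙ₗ m)).hom
  /-- the isomorphism `T_C(e) ⊙ m ≅ e ⊙ m` -/
  uC (e : E) (m : carrier) : T C e ⊙ₗ m ≅ e ⊙ₗ m
  uC_natural_left {e e' : E} (f : e ⟶ e') (m : carrier) :
    Tmap C f ⊵ₗ m ≫ (uC e' m).hom = (uC e m).hom ≫ f ⊵ₗ m
  uC_natural (e : E) {m m' : carrier} (f : m ⟶ m') :
    T C e ⊴ₗ f ≫ (uC e m').hom = (uC e m).hom ≫ e ⊴ₗ f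
  uC_tensor (e e' : E) (m : carrier) :
    Tμ C e e' ⊵ₗ m ≫ (uC (e ⊗ e') m).hom ≫ (αₗ e e' m).hom =
      (αₗ (T C e) (T C e') m).hom ≫ T C e ⊴ₗ (uC e' m).hom ≫ (uC e (e' ⊙ₗ m)).hom
  uC_unit (m : carrier) :
    Tε C ⊵ₗ m ≫ (uC (𝟙_ E) m).hom ≫ (λₗ m).hom = (λₗ m).hom
  /-- the isomorphism `m ⊙ T_D(e) ≅ e ⊙ m` -/
  uD (e : E) (m : carrier) : m ⊙ᵣ T D e ≅ e ⊙ₗ m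
  uD_natural_left {e e' : E} (f : e ⟶ e') (m : carrier) :
    m ⊴ᵣ Tmap D f ≫ (uD e' m).hom = (uD e m).hom ≫ f ⊵ₗ m
  uD_natural (e : E) {m m' : carrier} (f : m ⟶ m') :
    f ⊵ᵣ T D e ≫ (uD e m').hom = (uD e m).hom ≫ e ⊴ₗ f
  uD_tensor (e e' : E) (m : carrier) :
    m ⊴ᵣ Tμ D e e' ≫ (uD (e ⊗ e') m).hom ≫ (β_ e e').hom ⊵ₗ m ≫ (αₗ e' e m).hom =
      (αᵣ m (T D e) (T D e')).hom ≫ (uD e m).hom ⊵ᵣ T D e' ≫ (uD e' (e ⊙ₗ m)).hom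
  uD_unit (m : carrier) :
    m ⊴ᵣ Tε D ≫ (uD (𝟙_ E) m).hom ≫ (λₗ m).hom = (ρᵣ m).hom
  /-- the `E`-module structure `e ⊙ (c ⊙ m ⊙ d) ≅ c ⊙ (e ⊙ m) ⊙ d` of `c ⊙ - ⊙ d` -/
  sE (c : C) (d : D) : (both c d : carrier ⥤ carrier).LeftLinear E
  uC_sE (e : E) (c : C) (m : carrier) (d : D) :
    (αₗ (T C e) c m).hom ⊵ᵣ d ≫ (mid (T C e) (c ⊙ₗ m) d).hom ≫
        (uC e ((c ⊙ₗ m) ⊙ᵣ d)).hom ≫ (sE c d).μₗ e m =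
      ((z C e c).hom ⊵ₗ m) ⊵ᵣ d ≫ (αₗ c (T C e) m).hom ⊵ᵣ d ≫ (c ⊴ₗ (uC e m).hom) ⊵ᵣ d
  uD_sE (e : E) (c : C) (m : carrier) (d : D) :
    (αᵣ (c ⊙ₗ m) d (T D e)).hom ≫ (uD e ((c ⊙ₗ m) ⊙ᵣ d)).hom ≫ (sE c d).μₗ e m =
      (c ⊙ₗ m) ⊴ᵣ (z D e d).inv ≫ (αᵣ (c ⊙ₗ m) (T D e) d).hom ≫
        (mid c m (T D e)).hom ⊵ᵣ d ≫ (c ⊴ₗ (uD e m).hom) ⊵ᵣ d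
  /-- `uC_e` is a morphism of `E`-module functors -/
  uC_linear (e e' : E) (m : carrier) :
    (sE (T C e) (𝟙_ D)).μₗ e' m ≫ (ρᵣ (T C e ⊙ₗ (e' ⊙ₗ m))).hom ≫ (uC e (e' ⊙ₗ m)).hom =
      e' ⊴ₗ ((ρᵣ (T C e ⊙ₗ m)).hom ≫ (uC e m).hom) ≫ swap e' e m
  /-- `uD_e` is a morphism of `E`-module functors -/
  uD_linear (e e' : E) (m : carrier) :
    (sE (𝟙_ C) (T D e)).μₗ e' m ≫ (λₗ (e' ⊙ₗ m)).hom ⊵ᵣ T D e ≫ (uD e (e' ⊙ₗ m)).hom =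
      e' ⊴ₗ ((λₗ m).hom ⊵ᵣ T D e ≫ (uD e m).hom) ≫ swap e' e m

end Main

/-! ### Categories of functors with extra structure -/

/-- A notion of structured functor `M ⥤ M'`: for each functor a type of structures on it, and for
two structured functors the `k`-linear space of compatible natural transformations. -/
structure FunctorSystem (k : Type*) [Field k] (M : Type u) [Category.{v} M]
    (M' : Type uM) [Category.{vM} M'] [Preadditive M'] [Linear k M'] where
  /-- the structures on a functor -/
  Str : (M ⥤ M') → Type*
  /-- the compatible natural transformations -/
  hom {F G : M ⥤ M'} (p : Str F) (q : Str G) : Submodule k (F ⟶ G)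
  id_mem {F : M ⥤ M'} (p : Str F) : 𝟙 F ∈ hom p p
  comp_mem {F G H : M ⥤ M'} {p : Str F} {q : Str G} {r : Str H} {f : F ⟶ G} {g : G ⟶ H} :
    f ∈ hom p q → g ∈ hom q r → f ≫ g ∈ hom p r

namespace FunctorSystem

variable {k : Type*} [Field k] {M : Type u} [Category.{v} M]
  {M' : Type uM} [Category.{vM} M'] [Preadditive M'] [Linear k M'] (S : FunctorSystem k M M')

/-- A structured functor. -/
structure Obj where
  functor : M ⥤ M'
  str : S.Str functor

variable {S}

/-- A morphism of structured functors: a compatible natural transformation. -/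
@[ext]
structure Hom (X Y : S.Obj) where
  natTrans : X.functor ⟶ Y.functor
  mem : natTrans ∈ S.hom X.str Y.str

/-- Morphisms of structured functors form a subspace of the natural transformations. -/
def Hom.equiv (X Y : S.Obj) : Hom X Y ≃ S.hom X.str Y.str where
  toFun f := ⟨f.natTrans, f.mem⟩
  invFun f := ⟨f.1, f.2⟩
  left_inv _ := rfl
  right_inv _ := rfl

instance : Category S.Obj where
  Hom X Y := Hom X Y
  id X := ⟨𝟙 X.functor, S.id_mem X.str⟩
  comp f g := ⟨f.natTrans ≫ g.natTrans, S.comp_mem f.mem g.mem⟩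
  id_comp _ := Hom.ext (Category.id_comp _)
  comp_id _ := Hom.ext (Category.comp_id _)
  assoc _ _ _ := Hom.ext (Category.assoc _ _ _)

@[ext]
lemma hom_ext {X Y : S.Obj} {f g : X ⟶ Y} (h : ∀ m, f.natTrans.app m = g.natTrans.app m) : f = g :=
  Hom.ext (NatTrans.ext (funext h))

@[simp]
lemma id_app (X : S.Obj) (m : M) : (Hom.natTrans (𝟙 X)).app m = 𝟙 (X.functor.obj m) := rfl

@[simp]
lemma comp_app {X Y W : S.Obj} (f : X ⟶ Y) (g : Y ⟶ W) (m : M) :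
    (f ≫ g).natTrans.app m = f.natTrans.app m ≫ g.natTrans.app m := rfl

instance (X Y : S.Obj) : AddCommGroup (X ⟶ Y) := (Hom.equiv X Y).addCommGroup

instance (X Y : S.Obj) : Module k (X ⟶ Y) := (Hom.equiv X Y).module k

@[simp]
lemma add_app {X Y : S.Obj} (f g : X ⟶ Y) (m : M) :
    (f + g).natTrans.app m = f.natTrans.app m + g.natTrans.app m := rfl

@[simp]
lemma smul_app {X Y : S.Obj} (r : k) (f : X ⟶ Y) (m : M) :
    (r • f).natTrans.app m = r • f.natTrans.app m := rfl

instance : Preadditive S.Obj where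
  homGroup X Y := inferInstance
  add_comp _ _ _ f f' g := hom_ext fun m => Preadditive.add_comp _ _ _ _ _ _
  comp_add _ _ _ f g g' := hom_ext fun m => Preadditive.comp_add _ _ _ _ _ _

instance : Linear k S.Obj where
  homModule X Y := inferInstance
  smul_comp _ _ _ r f g := hom_ext fun m => Linear.smul_comp _ _ _ _ _ _
  comp_smul _ _ _ f r g := hom_ext fun m => Linear.comp_smul _ _ _ _ _ _

/-- An isomorphism of structured functors from a natural isomorphism. -/
@[simps]
def isoMk {X Y : S.Obj} (f : X.functor ≅ Y.functor) (h : f.hom ∈ S.hom X.str Y.str)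
    (h' : f.inv ∈ S.hom Y.str X.str) : X ≅ Y where
  hom := ⟨f.hom, h⟩
  inv := ⟨f.inv, h'⟩
  hom_inv_id := Hom.ext f.hom_inv_id
  inv_hom_id := Hom.ext f.inv_hom_id

end FunctorSystem

/-- The natural transformations compatible with given `A`-module structures on functors between
left `A`-module categories. -/
def leftNat (k : Type*) [Field k] {A : Type u} [Category.{v} A] [Preadditive A]
    [Linear k A] [MonoidalCategory A]
    {M : Type uC} [Category.{vC} M] [MonoidalLeftAction A M]
    {M' : Type uM} [Category.{vM} M'] [Preadditive M'] [Linear k M'] [MonoidalLeftAction A M']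
    [LinearLeftAction k A M'] {F G : M ⥤ M'} (p : F.LeftLinear A) (q : G.LeftLinear A) :
    Submodule k (F ⟶ G) where
  carrier := {f | ∀ (a : A) (m : M), a ⊴ₗ f.app m ≫ q.μₗ a m = p.μₗ a m ≫ f.app (a ⊙ₗ m)}
  add_mem' {f g} hf hg a m := by
    simp only [NatTrans.app_add, LinearLeftAction.right_add (k := k), Preadditive.add_comp,
      Preadditive.comp_add, hf a m, hg a m]
  zero_mem' a m := by
    have : a ⊴ₗ (0 : F.obj m ⟶ G.obj m) = 0 := by
      have := LinearLeftAction.right_smul (k := k) a (0 : k) (0 : F.obj m ⟶ G.obj m)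
      simpa using this
    simp [this]
  smul_mem' r f hf a m := by
    simp only [NatTrans.app_smul, LinearLeftAction.right_smul (k := k), Linear.smul_comp,
      Linear.comp_smul, hf a m]

/-- The natural transformations compatible with given `A`-module structures on functors between
right `A`-module categories. -/
def rightNat (k : Type*) [Field k] {A : Type u} [Category.{v} A] [Preadditive A]
    [Linear k A] [MonoidalCategory A]
    {M : Type uC} [Category.{vC} M] [MonoidalRightAction A M]
    {M' : Type uM} [Category.{vM} M'] [Preadditive M'] [Linear k M'] [MonoidalRightAction A M']
    [LinearRightAction k A M'] {F G : M ⥤ M'} (p : F.RightLinear A) (q : G.RightLinear A) :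
    Submodule k (F ⟶ G) where
  carrier := {f | ∀ (m : M) (a : A), f.app m ⊵ᵣ a ≫ q.μᵣ m a = p.μᵣ m a ≫ f.app (m ⊙ᵣ a)}
  add_mem' {f g} hf hg m a := by
    simp only [NatTrans.app_add, LinearRightAction.left_add (k := k), Preadditive.add_comp,
      Preadditive.comp_add, hf m a, hg m a]
  zero_mem' m a := by
    have : (0 : F.obj m ⟶ G.obj m) ⊵ᵣ a = 0 := by
      have := LinearRightAction.left_smul (k := k) (0 : k) (0 : F.obj m ⟶ G.obj m) a
      simpa using this
    simp [this]
  smul_mem' r f hf m a := by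
    simp only [NatTrans.app_smul, LinearRightAction.left_smul (k := k), Linear.smul_comp,
      Linear.comp_smul, hf m a]

section LeftNat

variable (k : Type*) [Field k] {A : Type u} [Category.{v} A] [Preadditive A]
    [Linear k A] [MonoidalCategory A]
    {M : Type uC} [Category.{vC} M]
    {M' : Type uM} [Category.{vM} M'] [Preadditive M'] [Linear k M']
    {F G H : M ⥤ M'}

lemma leftNat_id [MonoidalLeftAction A M] [MonoidalLeftAction A M'] [LinearLeftAction k A M']
    (p : F.LeftLinear A) : 𝟙 F ∈ leftNat k p p := fun a m => by simp

lemma leftNat_comp [MonoidalLeftAction A M] [MonoidalLeftAction A M'] [LinearLeftAction k A M']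
    {p : F.LeftLinear A} {q : G.LeftLinear A} {r : H.LeftLinear A}
    {f : F ⟶ G} {g : G ⟶ H} (hf : f ∈ leftNat k p q) (hg : g ∈ leftNat k q r) :
    f ≫ g ∈ leftNat k p r := fun a m => by
  rw [NatTrans.comp_app, MonoidalLeftAction.actionHomRight_comp, Category.assoc, hg a m, ← Category.assoc, hf a m,
    Category.assoc, NatTrans.comp_app]

lemma leftNat_inv [MonoidalLeftAction A M] [MonoidalLeftAction A M'] [LinearLeftAction k A M']
    {p : F.LeftLinear A} {q : G.LeftLinear A} (f : F ≅ G) (hf : f.hom ∈ leftNat k p q) :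
    f.inv ∈ leftNat k q p := fun a m => by
  have h := hf a m
  rw [← cancel_epi (a ⊴ₗ f.hom.app m), ← Category.assoc, ← MonoidalLeftAction.actionHomRight_comp,
    Iso.hom_inv_id_app, ← Category.assoc, h]
  simp

lemma rightNat_id [MonoidalRightAction A M] [MonoidalRightAction A M'] [LinearRightAction k A M']
    (p : F.RightLinear A) : 𝟙 F ∈ rightNat k p p := fun a m => by simp

lemma rightNat_comp [MonoidalRightAction A M] [MonoidalRightAction A M'] [LinearRightAction k A M']
    {p : F.RightLinear A} {q : G.RightLinear A} {r : H.RightLinear A}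
    {f : F ⟶ G} {g : G ⟶ H} (hf : f ∈ rightNat k p q) (hg : g ∈ rightNat k q r) :
    f ≫ g ∈ rightNat k p r := fun m a => by
  rw [NatTrans.comp_app, MonoidalRightAction.comp_actionHomLeft, Category.assoc, hg m a, ← Category.assoc, hf m a,
    Category.assoc, NatTrans.comp_app]

lemma rightNat_inv [MonoidalRightAction A M] [MonoidalRightAction A M'] [LinearRightAction k A M']
    {p : F.RightLinear A} {q : G.RightLinear A} (f : F ≅ G) (hf : f.hom ∈ rightNat k p q) :
    f.inv ∈ rightNat k q p := fun m a => by
  have h := hf m a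
  rw [← cancel_epi (f.hom.app m ⊵ᵣ a), ← Category.assoc, ← MonoidalRightAction.comp_actionHomLeft,
    Iso.hom_inv_id_app, ← Category.assoc, h]
  simp

end LeftNat

/-! ### Module functors -/

/-- The structure of a left `E`-module functor on a functor `F`: `F` is `k`-linear and carries
natural isomorphisms `e ⊙ F(m) ≅ F(e ⊙ m)` compatible with the associativity and unit
isomorphisms. -/
structure EStr (k : Type*) [Field k]
    (E : Type uE) [Category.{vE} E] [MonoidalCategory E]
    {M : Type u} [Category.{v} M] [Preadditive M] [Linear k M] [MonoidalLeftAction E M]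
    {M' : Type uM} [Category.{vM} M'] [Preadditive M'] [Linear k M'] [MonoidalLeftAction E M']
    (F : M ⥤ M') where
  additive : F.Additive
  linear : F.Linear k
  sE : F.LeftLinear E

/-- Left `E`-module functors, with left `E`-module natural transformations. -/
def EFunSystem (k : Type*) [Field k]
    (E : Type uE) [Category.{vE} E] [Preadditive E] [Linear k E] [MonoidalCategory E]
    (M : Type u) [Category.{v} M] [Preadditive M] [Linear k M] [MonoidalLeftAction E M]
    (M' : Type uM) [Category.{vM} M'] [Preadditive M'] [Linear k M'] [MonoidalLeftAction E M']
    [LinearLeftAction k E M'] : FunctorSystem k M M' where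
  Str F := EStr k E F
  hom p q := leftNat k p.sE q.sE
  id_mem p := leftNat_id k p.sE
  comp_mem hf hg := leftNat_comp k hf hg

/-- `Fun_E(M, M')`: the category of left `E`-module functors and left `E`-module natural
transformations. -/
abbrev EFun (k : Type*) [Field k]
    (E : Type uE) [Category.{vE} E] [Preadditive E] [Linear k E] [MonoidalCategory E]
    (M : Type u) [Category.{v} M] [Preadditive M] [Linear k M] [MonoidalLeftAction E M]
    (M' : Type uM) [Category.{vM} M'] [Preadditive M'] [Linear k M'] [MonoidalLeftAction E M']
    [LinearLeftAction k E M'] := (EFunSystem k E M M').Obj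

namespace BMod

attribute [instance] category preadditive linear actE actC actD linE linC linD

section Fun

variable {k : Type*} [Field k]
  {E : Type uE} [Category.{vE} E] [Preadditive E] [Linear k E]
  [MonoidalCategory E] [SymmetricCategory E]
  {C : Type uC} [Category.{vC} C] [Preadditive C] [Linear k C]
  [MonoidalCategory C] [CentralStructure E C]
  {D : Type uD} [Category.{vD} D] [Preadditive D] [Linear k D]
  [MonoidalCategory D] [CentralStructure E D]

/-- The bimodule constraint `(e ⊙ m) ⊙ d ≅ e ⊙ (m ⊙ d)` between the actions of `E` and `D`, given
by the `E`-module structure of the functor `- ⊙ d = 𝟙 ⊙ - ⊙ d`. -/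
def midE (M : BMod k E C D) (e : E) (m : M.carrier) (d : D) :
    (e ⊙ₗ m) ⊙ᵣ d ⟶ e ⊙ₗ (m ⊙ᵣ d) :=
  (λₗ[C] (e ⊙ₗ m)).inv ⊵ᵣ d ≫ (M.sE (𝟙_ C) d).δₗ e m ≫ e ⊴ₗ ((λₗ[C] m).hom ⊵ᵣ d)

/-- The structure of a 1-morphism of `C`-`D` bimodules over `E` on a functor: a `k`-linear `C`-`D`
bimodule functor which is a left `E`-module functor, compatibly with `uC` and `uD`. -/
structure Str (M : BMod k E C D) (M' : BMod k E C D)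
    (F : M.carrier ⥤ M'.carrier) where
  additive : F.Additive
  linear : F.Linear k
  sC : F.LeftLinear C
  tD : F.RightLinear D
  sE : F.LeftLinear E
  bimodule (c : C) (m : M.carrier) (d : D) :
    sC.μₗ c m ⊵ᵣ d ≫ tD.μᵣ (c ⊙ₗ m) d ≫ F.map (M.mid c m d).hom =
      (M'.mid c (F.obj m) d).hom ≫ c ⊴ₗ tD.μᵣ m d ≫ sC.μₗ c (m ⊙ᵣ d)
  uC_comp (e : E) (m : M.carrier) :
    sC.μₗ (T C e) m ≫ F.map (M.uC e m).hom = (M'.uC e (F.obj m)).hom ≫ sE.μₗ e m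
  uD_comp (e : E) (m : M.carrier) :
    tD.μᵣ m (T D e) ≫ F.map (M.uD e m).hom = (M'.uD e (F.obj m)).hom ≫ sE.μₗ e m

/-- 1-morphisms of `C`-`D` bimodules over `E`, with `C`-`D` bimodule natural transformations. -/
def funSystem (M : BMod k E C D) (M' : BMod k E C D) :
    FunctorSystem k M.carrier M'.carrier where
  Str F := Str M M' F
  hom p q := leftNat k p.sC q.sC ⊓ rightNat k p.tD q.tD
  id_mem p := ⟨leftNat_id k p.sC, rightNat_id k p.tD⟩
  comp_mem hf hg := ⟨leftNat_comp k hf.1 hg.1, rightNat_comp k hf.2 hg.2⟩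

/-- The category `Fun_{C ⊠_E D^rev}(M, M')` of 1-morphisms `M ⟶ M'` and 2-morphisms in the
2-category of `C`-`D` bimodules over `E`. -/
abbrev Fun (M : BMod k E C D) (M' : BMod k E C D) := (funSystem M M').Obj

/-- The structure of a 1-morphism of right `D`-modules over `E` (that is, of `E`-`D` bimodules
over `E`, where `E` acts in the given way and `uE = id`) on a functor: a `k`-linear `E`-`D`
bimodule functor compatible with `uD`. -/
structure RStr (M : BMod k E C D) (M' : BMod k E C D)
    (F : M.carrier ⥤ M'.carrier) extends EStr k E F where
  tD : F.RightLinear D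
  bimodule (e : E) (m : M.carrier) (d : D) :
    sE.μₗ e m ⊵ᵣ d ≫ tD.μᵣ (e ⊙ₗ m) d ≫ F.map (M.midE e m d) =
      M'.midE e (F.obj m) d ≫ e ⊴ₗ tD.μᵣ m d ≫ sE.μₗ e (m ⊙ᵣ d)
  uD_comp (e : E) (m : M.carrier) :
    tD.μᵣ m (T D e) ≫ F.map (M.uD e m).hom = (M'.uD e (F.obj m)).hom ≫ sE.μₗ e m

/-- 1-morphisms of right `D`-modules over `E`, with `E`-`D` bimodule natural transformations. -/
def rightFunSystem (M : BMod k E C D) (M' : BMod k E C D) :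
    FunctorSystem k M.carrier M'.carrier where
  Str F := RStr M M' F
  hom p q := leftNat k p.sE q.sE ⊓ rightNat k p.tD q.tD
  id_mem p := ⟨leftNat_id k p.sE, rightNat_id k p.tD⟩
  comp_mem hf hg := ⟨leftNat_comp k hf.1 hg.1, rightNat_comp k hf.2 hg.2⟩

/-- The category `Fun_{D^rev}(M, M') = Fun_{E ⊠_E D^rev}(M, M')` of 1-morphisms `M ⟶ M'` and
2-morphisms in the 2-category of right `D`-modules over `E`. -/
abbrev RightFun (M : BMod k E C D) (M' : BMod k E C D) :=
  (rightFunSystem M M').Obj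

end Fun

end BMod

/-! ### Auxiliary constructions of module structures on functors -/

section Aux

variable {A : Type u} [Category.{v} A] [MonoidalCategory A]
  {M : Type uC} [Category.{vC} M] {M' : Type uM} [Category.{vM} M']
  {M'' : Type uD} [Category.{vD} M'']

/-- A left module structure on a functor from its isomorphisms `a ⊙ F(m) ≅ F(a ⊙ m)`. -/
@[reducible]
def leftLinearMk [MonoidalLeftAction A M] [MonoidalLeftAction A M'] {F : M ⥤ M'}
    (i : ∀ (a : A) (m : M), a ⊙ₗ F.obj m ≅ F.obj (a ⊙ₗ m))
    (nat_left : ∀ {a a' : A} (f : a ⟶ a') (m : M),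
      f ⊵ₗ F.obj m ≫ (i a' m).hom = (i a m).hom ≫ F.map (f ⊵ₗ m))
    (nat_right : ∀ (a : A) {m m' : M} (f : m ⟶ m'),
      a ⊴ₗ F.map f ≫ (i a m').hom = (i a m).hom ≫ F.map (a ⊴ₗ f))
    (assoc : ∀ (a a' : A) (m : M), (i (a ⊗ a') m).hom ≫ F.map (αₗ a a' m).hom =
      (αₗ a a' (F.obj m)).hom ≫ a ⊴ₗ (i a' m).hom ≫ (i a (a' ⊙ₗ m)).hom)
    (unit : ∀ m : M, (λₗ[A] (F.obj m)).hom = (i (𝟙_ A) m).hom ≫ F.map (λₗ m).hom) :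
    F.LeftLinear A where
  μₗ a m := (i a m).hom
  μₗ_naturality_left := nat_left
  μₗ_naturality_right := nat_right
  μₗ_associativity := assoc
  μₗ_unitality := unit
  δₗ a m := (i a m).inv
  δₗ_naturality_left f m := by
    rw [← cancel_epi (i _ m).hom, ← Category.assoc, ← nat_left]; simp
  δₗ_naturality_right a _ _ f := by
    rw [← cancel_epi (i a _).hom, ← Category.assoc, ← nat_right]; simp
  δₗ_associativity a a' m := by
    rw [← cancel_epi (i _ _).hom, reassoc_of% assoc a a' m]; simp
  δₗ_unitality_inv m := by
    rw [← cancel_epi (λₗ[A] (F.obj m)).hom]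
    nth_rewrite 2 [unit]
    simp [← Functor.map_comp_assoc]
  μₗ_comp_δₗ a m := (i a m).hom_inv_id
  δₗ_comp_μₗ a m := (i a m).inv_hom_id

/-- The composite of two left module functors. -/
@[reducible]
def leftLinearComp [MonoidalLeftAction A M] [MonoidalLeftAction A M'] [MonoidalLeftAction A M'']
    {F : M ⥤ M'} {G : M' ⥤ M''} (p : F.LeftLinear A) (q : G.LeftLinear A) :
    (F ⋙ G).LeftLinear A :=
  leftLinearMk (fun a m => Functor.LeftLinear.μₗIso G a (F.obj m) ≪≫
      G.mapIso (Functor.LeftLinear.μₗIso F a m))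
    (fun f m => by simp [← Functor.map_comp])
    (fun a _ _ f => by simp [← Functor.map_comp])
    (fun a a' m => by
      have h := congrArg G.map (μₗ_associativity F a a' m)
      simp only [Functor.map_comp] at h
      have h2 := μₗ_associativity G a a' (F.obj m)
      have h3 := μₗ_naturality_right G a (μₗ F a' m)
      simp only [Iso.trans_hom, Functor.mapIso_hom, Functor.comp_map, Category.assoc, h,
        reassoc_of% h2, reassoc_of% h3, MonoidalLeftAction.actionHomRight_comp, Functor.comp_obj])
    (fun m => by simp [← Functor.map_comp])

/-- The isomorphism `a ⊙ m ≅ a ⊙ m'` induced by `m ≅ m'`. -/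
@[simps]
def lIso [MonoidalLeftAction A M] (a : A) {m m' : M} (f : m ≅ m') : a ⊙ₗ m ≅ a ⊙ₗ m' where
  hom := a ⊴ₗ f.hom
  inv := a ⊴ₗ f.inv

/-- Transport of a left module structure along an isomorphism of functors. -/
@[reducible]
def leftLinearOfIso [MonoidalLeftAction A M] [MonoidalLeftAction A M']
    {F G : M ⥤ M'} (p : F.LeftLinear A) (i : F ≅ G) : G.LeftLinear A :=
  leftLinearMk (fun a m => lIso a (i.app m).symm ≪≫ Functor.LeftLinear.μₗIso F a m ≪≫
      i.app (a ⊙ₗ m))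
    (fun f m => by
      have h := μₗ_naturality_left F f m
      have h2 := MonoidalLeftAction.action_exchange f (i.inv.app m)
      simp [← reassoc_of% h2, reassoc_of% h])
    (fun a _ _ f => by
      simp only [lIso, Iso.trans_hom, Iso.symm_hom, Iso.app_inv, Iso.app_hom,
        ← MonoidalLeftAction.actionHomRight_comp_assoc, i.inv.naturality, Category.assoc]
      simp)
    (fun a a' m => by
      have h := μₗ_associativity F a a' m
      have h2 := MonoidalLeftAction.actionAssocIso_hom_naturality (𝟙 a) (𝟙 a') (i.inv.app m)
      simp only [MonoidalLeftAction.id_actionHom, id_tensorHom_id] at h2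
      simp only [lIso, Iso.trans_hom, Iso.symm_hom, Iso.app_inv, Iso.app_hom, Category.assoc,
        ← i.hom.naturality, reassoc_of% h, reassoc_of% h2,
        ← MonoidalLeftAction.actionHomRight_comp_assoc, Iso.hom_inv_id_app_assoc,
        Iso.hom_inv_id_app, Category.comp_id])
    (fun m => by
      have h := μₗ_unitality F (C := A) m
      have h2 := MonoidalLeftAction.actionUnitIso_hom_naturality (C := A) (i.inv.app m)
      simp only [lIso, Iso.trans_hom, Iso.symm_hom, Iso.app_inv, Iso.app_hom, Category.assoc,
        ← i.hom.naturality]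
      rw [← reassoc_of% h, ← reassoc_of% h2]
      simp)

/-- A right module structure on a functor from its isomorphisms `F(m) ⊙ a ≅ F(m ⊙ a)`. -/
@[reducible]
def rightLinearMk [MonoidalRightAction A M] [MonoidalRightAction A M'] {F : M ⥤ M'}
    (i : ∀ (m : M) (a : A), F.obj m ⊙ᵣ a ≅ F.obj (m ⊙ᵣ a))
    (nat_right : ∀ (m : M) {a a' : A} (f : a ⟶ a'),
      F.obj m ⊴ᵣ f ≫ (i m a').hom = (i m a).hom ≫ F.map (m ⊴ᵣ f))
    (nat_left : ∀ {m m' : M} (f : m ⟶ m') (a : A),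
      F.map f ⊵ᵣ a ≫ (i m' a).hom = (i m a).hom ≫ F.map (f ⊵ᵣ a))
    (assoc : ∀ (m : M) (a a' : A), (i m (a ⊗ a')).hom ≫ F.map (αᵣ m a a').hom =
      (αᵣ (F.obj m) a a').hom ≫ (i m a).hom ⊵ᵣ a' ≫ (i (m ⊙ᵣ a) a').hom)
    (unit : ∀ m : M, (ρᵣ[A] (F.obj m)).hom = (i m (𝟙_ A)).hom ≫ F.map (ρᵣ m).hom) :
    F.RightLinear A where
  μᵣ m a := (i m a).hom
  μᵣ_naturality_right := nat_right
  μᵣ_naturality_left := nat_left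
  μᵣ_associativity := assoc
  μᵣ_unitality := unit
  δᵣ m a := (i m a).inv
  δᵣ_naturality_right m _ _ f := by
    rw [← cancel_epi (i m _).hom, ← Category.assoc, ← nat_right]; simp
  δᵣ_naturality_left f a := by
    rw [← cancel_epi (i _ a).hom, ← Category.assoc, ← nat_left]; simp
  δᵣ_associativity m a a' := by
    rw [← cancel_epi (i _ _).hom, reassoc_of% assoc m a a']; simp
  δᵣ_unitality_inv m := by
    rw [← cancel_epi (ρᵣ[A] (F.obj m)).hom]
    nth_rewrite 2 [unit]
    simp [← Functor.map_comp_assoc]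
  μᵣ_comp_δᵣ m a := (i m a).hom_inv_id
  δᵣ_comp_μᵣ m a := (i m a).inv_hom_id

/-- The composite of two right module functors. -/
@[reducible]
def rightLinearComp [MonoidalRightAction A M] [MonoidalRightAction A M']
    [MonoidalRightAction A M''] {F : M ⥤ M'} {G : M' ⥤ M''} (p : F.RightLinear A)
    (q : G.RightLinear A) : (F ⋙ G).RightLinear A :=
  rightLinearMk (fun m a => Functor.RightLinear.μᵣIso G (F.obj m) a ≪≫
      G.mapIso (Functor.RightLinear.μᵣIso F m a))
    (fun m _ _ f => by simp [← Functor.map_comp])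
    (fun f a => by simp [← Functor.map_comp])
    (fun m a a' => by
      have h := congrArg G.map (μᵣ_associativity F m a a')
      simp only [Functor.map_comp] at h
      have h2 := μᵣ_associativity G (F.obj m) a a'
      have h3 := μᵣ_naturality_left G (μᵣ F m a) a'
      simp only [Iso.trans_hom, Functor.mapIso_hom, Functor.comp_map, Category.assoc, h,
        reassoc_of% h2, reassoc_of% h3, MonoidalRightAction.comp_actionHomLeft, Functor.comp_obj])
    (fun m => by simp [← Functor.map_comp])

/-- The functor `c ⊙ -`. -/
@[simps]
abbrev actL (M) [Category.{vM} M] [MonoidalLeftAction A M] (c : A) : M ⥤ M where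
  obj m := c ⊙ₗ m
  map f := c ⊴ₗ f

end Aux

namespace BMod

section Lemmas

variable {k : Type*} [Field k]
  {E : Type uE} [Category.{vE} E] [Preadditive E] [Linear k E]
  [MonoidalCategory E] [SymmetricCategory E]
  {C : Type uC} [Category.{vC} C] [Preadditive C] [Linear k C]
  [MonoidalCategory C] [CentralStructure E C]
  {D : Type uD} [Category.{vD} D] [Preadditive D] [Linear k D]
  [MonoidalCategory D] [CentralStructure E D]
  (M : BMod k E C D)

/-- `c ⊙ - ⊙ 𝟙 ≅ c ⊙ -`. -/
@[simps!]
def bothUnitIso (c : C) : (both c (𝟙_ D) : M.carrier ⥤ M.carrier) ≅ actL M.carrier c :=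
  NatIso.ofComponents (fun m => ρᵣ[D] (c ⊙ₗ m))
    (fun f => (MonoidalRightAction.actionUnitIso_hom_naturality (C := D) (c ⊴ₗ f)).symm)

/-- The `E`-module structure of `c ⊙ - = c ⊙ - ⊙ 𝟙`. -/
@[reducible]
def actLE (c : C) : (actL M.carrier c).LeftLinear E :=
  leftLinearOfIso (M.sE c (𝟙_ D)) (M.bothUnitIso c)

lemma actLE_uC (c : C) (e : E) (m : M.carrier) :
    (M.uC e (c ⊙ₗ m)).hom ≫ (M.actLE c).μₗ e m =
      (αₗ (T C e) c m).inv ≫ (z C e c).hom ⊵ₗ m ≫ (αₗ c (T C e) m).hom ≫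
        c ⊴ₗ (M.uC e m).hom := by
  have h := M.uC_sE e c m (𝟙_ D)
  have h2 := M.mid_unit_right (T C e) (c ⊙ₗ m)
  have h3 := M.uC_natural e (ρᵣ[D] (c ⊙ₗ m)).inv
  have h4 : (ρᵣ[D] (T C e ⊙ₗ c ⊙ₗ m)).inv ≫ (M.mid (T C e) (c ⊙ₗ m) (𝟙_ D)).hom =
      T C e ⊴ₗ (ρᵣ[D] (c ⊙ₗ m)).inv := by
    rw [Iso.inv_comp_eq, ← h2, Category.assoc, MonoidalLeftAction.actionHomRight_hom_inv,
      Category.comp_id]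
  change (M.uC e (c ⊙ₗ m)).hom ≫ e ⊴ₗ (ρᵣ[D] (c ⊙ₗ m)).inv ≫ (M.sE c (𝟙_ D)).μₗ e m ≫
    (ρᵣ[D] (c ⊙ₗ e ⊙ₗ m)).hom = _
  rw [← reassoc_of% h3, ← h4]
  simp only [MonoidalRightAction.unit_actionHomRight, Category.assoc, Iso.inv_hom_id_assoc] at h
  rw [Iso.cancel_iso_hom_left] at h
  rw [← cancel_epi (αₗ (T C e) c m).hom]
  simp only [Category.assoc, Iso.hom_inv_id_assoc]
  rw [reassoc_of% h, Iso.inv_hom_id, Category.comp_id]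

lemma actLE_uD (c : C) (e : E) (m : M.carrier) :
    (M.uD e (c ⊙ₗ m)).hom ≫ (M.actLE c).μₗ e m =
      (M.mid c m (T D e)).hom ≫ c ⊴ₗ (M.uD e m).hom := by
  have h := M.uD_sE e c m (𝟙_ D)
  have h3 := M.uD_natural e (ρᵣ[D] (c ⊙ₗ m)).inv
  have hz : (z D e (𝟙_ D)).inv = (λ_ (T D e)).hom ≫ (ρ_ (T D e)).inv := by
    rw [← cancel_epi (z D e (𝟙_ D)).hom, Iso.hom_inv_id, z_unit]; simp
  have h5 : (c ⊙ₗ m) ⊴ᵣ (ρ_ (T D e)).inv =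
      (ρᵣ _).inv ≫ (αᵣ (c ⊙ₗ m) (T D e) (𝟙_ D)).inv := by
    rw [← cancel_epi ((c ⊙ₗ m) ⊴ᵣ (ρ_ (T D e)).hom),
      MonoidalRightAction.actionHomRight_hom_inv, MonoidalRightAction.actionHom_rightUnitor]
    simp
  change (M.uD e (c ⊙ₗ m)).hom ≫ e ⊴ₗ (ρᵣ[D] (c ⊙ₗ m)).inv ≫ (M.sE c (𝟙_ D)).μₗ e m ≫
    (ρᵣ[D] (c ⊙ₗ e ⊙ₗ m)).hom = _
  rw [← reassoc_of% h3]
  rw [hz, MonoidalRightAction.actionHomRight_comp, MonoidalRightAction.actionHom_leftUnitor, h5]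
    at h
  simp only [MonoidalRightAction.unit_actionHomRight, Category.assoc, Iso.inv_hom_id_assoc] at h
  rw [Iso.cancel_iso_hom_left] at h
  rw [← cancel_epi ((ρᵣ[D] (c ⊙ₗ m)).hom ⊵ᵣ T D e),
    MonoidalRightAction.hom_inv_actionHomLeft_assoc, reassoc_of% h]
  simp only [Iso.inv_hom_id, Category.comp_id]

lemma midE_uC (e : E) (m : M.carrier) (d : D) :
    (M.uC e m).hom ⊵ᵣ d ≫ M.midE e m d =
      (M.mid (T C e) m d).hom ≫ (M.uC e (m ⊙ᵣ d)).hom := by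
  have h := M.uC_sE e (𝟙_ C) m d
  have h3 := M.uC_natural e ((λₗ[C] m).hom ⊵ᵣ d)
  have h4 := M.mid_natural (T C e) (λₗ[C] m).hom d
  have hu : (αₗ (𝟙_ C) (T C e) m).hom = (λ_ (T C e)).hom ⊵ₗ m ≫ (λₗ _).inv := by
    rw [MonoidalLeftAction.leftUnitor_actionHom]; simp
  have hr : (αₗ (T C e) (𝟙_ C) m).hom ≫ T C e ⊴ₗ (λₗ m).hom = (ρ_ (T C e)).hom ⊵ₗ m := by
    rw [MonoidalLeftAction.rightUnitor_actionHom]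
  have hd : M.midE e m d = (λₗ[C] (e ⊙ₗ m)).inv ⊵ᵣ d ≫ (M.sE (𝟙_ C) d).δₗ e m ≫
    e ⊴ₗ ((λₗ[C] m).hom ⊵ᵣ d) := rfl
  have hh : (αₗ (T C e) (𝟙_ C) m).hom ⊵ᵣ d ≫ (M.mid (T C e) (𝟙_ C ⊙ₗ m) d).hom ≫
      (M.uC e ((𝟙_ C ⊙ₗ m) ⊙ᵣ d)).hom = ((z C e (𝟙_ C)).hom ⊵ₗ m) ⊵ᵣ d ≫
        (αₗ (𝟙_ C) (T C e) m).hom ⊵ᵣ d ≫ ((𝟙_ C) ⊴ₗ (M.uC e m).hom) ⊵ᵣ d ≫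
          (M.sE (𝟙_ C) d).δₗ e m := by
    have := congrArg (· ≫ (M.sE (𝟙_ C) d).δₗ e m) h
    simpa only [Category.assoc, Functor.LeftLinear.μₗ_comp_δₗ, Category.comp_id] using this
  have hfin := congrArg (· ≫ e ⊴ₗ ((λₗ[C] m).hom ⊵ᵣ d)) hh
  simp only [Category.assoc] at hfin
  rw [← h3, ← reassoc_of% h4, ← MonoidalRightAction.comp_actionHomLeft_assoc, hr, z_unit, hu]
    at hfin
  rw [hd]
  simp only [← MonoidalRightAction.comp_actionHomLeft_assoc, Category.assoc,
    MonoidalLeftAction.unit_actionHomRight, MonoidalLeftAction.comp_actionHomLeft,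
    Iso.inv_hom_id_assoc, MonoidalLeftAction.inv_hom_actionHomLeft_assoc] at hfin
  rw [← cancel_epi (((ρ_ (T C e)).hom ⊵ₗ m) ⊵ᵣ d), hfin]
  simp only [← MonoidalRightAction.comp_actionHomLeft_assoc, Category.assoc]

lemma midE_uD (e : E) (m : M.carrier) (d : D) :
    (M.uD e m).hom ⊵ᵣ d ≫ M.midE e m d =
      (αᵣ m (T D e) d).inv ≫ m ⊴ᵣ (z D e d).hom ≫ (αᵣ m d (T D e)).hom ≫
        (M.uD e (m ⊙ᵣ d)).hom := by
  have h := M.uD_sE e (𝟙_ C) m d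
  have h3 := M.uD_natural e ((λₗ[C] m).hom ⊵ᵣ d)
  have hd : M.midE e m d = (λₗ[C] (e ⊙ₗ m)).inv ⊵ᵣ d ≫ (M.sE (𝟙_ C) d).δₗ e m ≫
    e ⊴ₗ ((λₗ[C] m).hom ⊵ᵣ d) := rfl
  have hl := M.mid_unit_left m (T D e)
  have hl' : (M.mid (𝟙_ C) m (T D e)).hom = (λₗ m).hom ⊵ᵣ T D e ≫ (λₗ _).inv := by
    rw [← hl]; simp
  have hh : (αᵣ (𝟙_ C ⊙ₗ m) d (T D e)).hom ≫ (M.uD e ((𝟙_ C ⊙ₗ m) ⊙ᵣ d)).hom =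
      (𝟙_ C ⊙ₗ m) ⊴ᵣ (z D e d).inv ≫ (αᵣ (𝟙_ C ⊙ₗ m) (T D e) d).hom ≫
        (M.mid (𝟙_ C) m (T D e)).hom ⊵ᵣ d ≫ ((𝟙_ C) ⊴ₗ (M.uD e m).hom) ⊵ᵣ d ≫
          (M.sE (𝟙_ C) d).δₗ e m := by
    have := congrArg (· ≫ (M.sE (𝟙_ C) d).δₗ e m) h
    simpa only [Category.assoc, Functor.LeftLinear.μₗ_comp_δₗ, Category.comp_id] using this
  have hfin := congrArg (· ≫ e ⊴ₗ ((λₗ[C] m).hom ⊵ᵣ d)) hh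
  simp only [Category.assoc] at hfin
  have n1 := MonoidalRightAction.actionAssocIso_hom_naturality (λₗ[C] m).hom (𝟙 d) (𝟙 (T D e))
  have n2 := MonoidalRightAction.actionAssocIso_hom_naturality (λₗ[C] m).hom (𝟙 (T D e)) (𝟙 d)
  simp only [id_tensorHom_id, MonoidalRightAction.actionHom_id] at n1 n2
  have n3 := MonoidalRightAction.action_exchange (λₗ[C] m).hom (z D e d).inv
  rw [← h3, ← reassoc_of% n1, hl', MonoidalRightAction.comp_actionHomLeft, Category.assoc,
    ← reassoc_of% n2, reassoc_of% n3, cancel_epi] at hfin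
  rw [hd, ← cancel_epi (αᵣ m (T D e) d).hom, ← cancel_epi (m ⊴ᵣ (z D e d).inv)]
  simp only [Iso.hom_inv_id_assoc, MonoidalRightAction.actionHomRight_inv_hom_assoc]
  rw [hfin]
  simp only [← MonoidalRightAction.comp_actionHomLeft_assoc, Category.assoc,
    MonoidalLeftAction.unit_actionHomRight, Iso.inv_hom_id_assoc]

end Lemmas

end BMod

/-! ### Bimodules over `E` from central bimodules -/

section Restrict

variable {E : Type uE} [Category.{vE} E] [MonoidalCategory E] [SymmetricCategory E]

lemma z_symm (A : Type u) [Category.{v} A] [MonoidalCategory A] [CentralStructure E A] (e e' : E) :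
    (z A e (T A e')).hom ≫ (z A e' (T A e)).hom = 𝟙 _ := by
  have h := Tμ_braiding A e e'
  have h' := Tμ_braiding A e' e
  rw [← cancel_mono (TμIso A e e').hom, TμIso_hom, Category.assoc, ← h', ← reassoc_of% h,
    ← Tmap_comp, SymmetricCategory.symmetry, Tmap_id, Category.comp_id, Category.id_comp]

variable (E) (C : Type uC) [Category.{vC} C] [MonoidalCategory C] [CentralStructure E C]
  (N : Type uM) [Category.{vM} N] [MonoidalLeftAction C N]

variable {C} in
/-- The isomorphism `c ⊙ m ≅ c' ⊙ m` induced by `c ≅ c'`. -/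
@[simps]
def rIso {c c' : C} (f : c ≅ c') (n : N) : c ⊙ₗ n ≅ c' ⊙ₗ n where
  hom := f.hom ⊵ₗ n
  inv := f.inv ⊵ₗ n

/-- The action `e ⊙ n := T(e) ⊙ n` of `E` on a left `C`-module. -/
@[reducible]
def restrictAction : MonoidalLeftAction E N where
  actionObj e n := T C e ⊙ₗ n
  actionHomLeft f n := Tmap C f ⊵ₗ n
  actionHomRight e _ _ g := T C e ⊴ₗ g
  actionAssocIso e e' n := (rIso N (TμIso C e e') n).symm ≪≫ αₗ (T C e) (T C e') n
  actionUnitIso n := (rIso N (TεIso (E := E) C) n).symm ≪≫ λₗ n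
  actionHom_def _ _ := rfl
  actionHomRight_id e n := MonoidalLeftAction.actionHomRight_id _ _
  id_actionHomLeft e n := by rw [Tmap_id, MonoidalLeftAction.id_actionHomLeft]
  actionHom_comp f₁ f₂ g₁ g₂ := by
    have h := MonoidalLeftAction.action_exchange (Tmap C f₂) g₁
    simp only [Tmap_comp, MonoidalLeftAction.comp_actionHomLeft,
      MonoidalLeftAction.actionHomRight_comp, Category.assoc, reassoc_of% h]
  actionAssocIso_hom_naturality {e₁ e₂ e₃ e₄ n₁ n₂} f g h := by
    have h1 := MonoidalLeftAction.actionAssocIso_hom_naturality (Tmap C f) (Tmap C g) h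
    have h2 : Tmap C (f ⊗ₘ g) = (TμIso C e₁ e₃).inv ≫ (Tmap C f ⊗ₘ Tmap C g) ≫ Tμ C e₂ e₄ := by
      rw [Iso.eq_inv_comp, MonoidalCategory.tensorHom_def, Tmap_comp, TμIso_hom, MonoidalCategory.tensorHom_def, Category.assoc,
        Tμ_natural_right, reassoc_of% Tμ_natural_left C f e₃]
    have h3 := MonoidalLeftAction.action_exchange (TμIso C e₂ e₄).inv h
    simp only [MonoidalLeftAction.actionHom_def] at h1
    simp only [h2, Iso.trans_hom, Iso.symm_hom, rIso_inv, MonoidalLeftAction.comp_actionHomLeft,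
      Category.assoc, reassoc_of% h3]
    rw [← h1]
    simp only [← MonoidalLeftAction.comp_actionHomLeft_assoc, Category.assoc, ← TμIso_hom,
      Iso.hom_inv_id, Category.comp_id]
  actionUnitIso_hom_naturality {n n'} g := by
    have h := MonoidalLeftAction.actionUnitIso_hom_naturality (C := C) g
    have h3 := MonoidalLeftAction.action_exchange (TεIso (E := E) C).inv g
    simp only [Iso.trans_hom, Iso.symm_hom, rIso_inv, Category.assoc, h, reassoc_of% h3]
  whiskerLeft_actionHomLeft e e' e'' f n := by
    have h := MonoidalLeftAction.whiskerLeft_actionHomLeft (T C e) (Tmap C f) n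
    have h2 : Tmap C (e ◁ f) = (TμIso C e e').inv ≫ T C e ◁ Tmap C f ≫ Tμ C e e'' := by
      rw [Iso.eq_inv_comp, TμIso_hom, Tμ_natural_right]
    simp only [h2, MonoidalLeftAction.comp_actionHomLeft, h, Iso.trans_hom, Iso.trans_inv,
      Iso.symm_hom, Iso.symm_inv, rIso_hom, rIso_inv, Category.assoc, TμIso_hom]
  whiskerRight_actionHomLeft {e e'} e'' f n := by
    have h := MonoidalLeftAction.whiskerRight_actionHomLeft (T C e'') (Tmap C f) n
    have h2 : Tmap C (f ▷ e'') = (TμIso C e e'').inv ≫ Tmap C f ▷ T C e'' ≫ Tμ C e' e'' := by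
      rw [Iso.eq_inv_comp, TμIso_hom, Tμ_natural_left]
    simp only [h2, MonoidalLeftAction.comp_actionHomLeft, h, Iso.trans_hom, Iso.trans_inv,
      Iso.symm_hom, Iso.symm_inv, rIso_hom, rIso_inv, Category.assoc, TμIso_hom]
  associator_actionHom e₁ e₂ e₃ n := by
    have h := MonoidalLeftAction.associator_actionHom (T C e₁) (T C e₂) (T C e₃) n
    have h2 : Tmap C (α_ e₁ e₂ e₃).hom = (TμIso C (e₁ ⊗ e₂) e₃).inv ≫
        (TμIso C e₁ e₂).inv ▷ T C e₃ ≫ (α_ _ _ _).hom ≫ T C e₁ ◁ (TμIso C e₂ e₃).hom ≫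
          (TμIso C e₁ (e₂ ⊗ e₃)).hom := by
      rw [Iso.eq_inv_comp, ← cancel_epi ((TμIso C e₁ e₂).hom ▷ T C e₃)]
      simp only [hom_inv_whiskerRight_assoc]
      exact Tμ_assoc C e₁ e₂ e₃
    have h3 := MonoidalLeftAction.whiskerLeft_actionHomLeft (T C e₁) (TμIso C e₂ e₃).hom n
    have h4 := MonoidalLeftAction.whiskerRight_actionHomLeft (T C e₃) (TμIso C e₁ e₂).inv n
    simp only [h2, MonoidalLeftAction.comp_actionHomLeft, h3, h4, Iso.trans_hom, Iso.symm_hom,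
      rIso_inv, Category.assoc, MonoidalLeftAction.actionHomRight_comp]
    have h5 : T C e₁ ⊴ₗ (TμIso C e₂ e₃).hom ⊵ₗ n ≫ T C e₁ ⊴ₗ (TμIso C e₂ e₃).inv ⊵ₗ n = 𝟙 _ := by
      rw [← MonoidalLeftAction.actionHomRight_comp, MonoidalLeftAction.hom_inv_actionHomLeft,
        MonoidalLeftAction.actionHomRight_id]
    simp only [MonoidalLeftAction.hom_inv_actionHomLeft_assoc, Iso.inv_hom_id_assoc,
      reassoc_of% h5, h]
  leftUnitor_actionHom e n := by
    have h := MonoidalLeftAction.leftUnitor_actionHom (T C e) n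
    have h2 : Tmap C (λ_ e).hom = (TμIso C (𝟙_ E) e).inv ≫ (TεIso C).inv ▷ T C e ≫
        (λ_ (T C e)).hom := by
      rw [Iso.eq_inv_comp, ← cancel_epi ((TεIso C).hom ▷ T C e), hom_inv_whiskerRight_assoc]
      exact (Tμ_unit_left C e).symm
    have h4 := MonoidalLeftAction.whiskerRight_actionHomLeft (T C e) (TεIso (E := E) C).inv n
    simp only [h2, MonoidalLeftAction.comp_actionHomLeft, h, h4, Iso.trans_hom, Iso.symm_hom,
      rIso_inv, Category.assoc, Iso.inv_hom_id_assoc]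
  rightUnitor_actionHom e n := by
    have h := MonoidalLeftAction.rightUnitor_actionHom (T C e) n
    have h2 : Tmap C (ρ_ e).hom = (TμIso C e (𝟙_ E)).inv ≫ T C e ◁ (TεIso C).inv ≫
        (ρ_ (T C e)).hom := by
      rw [Iso.eq_inv_comp, ← cancel_epi (T C e ◁ (TεIso C).hom), whiskerLeft_hom_inv_assoc]
      exact (Tμ_unit_right C e).symm
    have h4 := MonoidalLeftAction.whiskerLeft_actionHomLeft (T C e) (TεIso (E := E) C).inv n
    simp only [h2, MonoidalLeftAction.comp_actionHomLeft, h, h4, Iso.trans_hom, Iso.symm_hom,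
      rIso_inv, Category.assoc, Iso.inv_hom_id_assoc, MonoidalLeftAction.actionHomRight_comp]

end Restrict

section OfCentral

variable (E : Type uE) [Category.{vE} E] [MonoidalCategory E] [SymmetricCategory E]
  (C : Type uC) [Category.{vC} C] [MonoidalCategory C] [CentralStructure E C]
  (D : Type uD) [Category.{vD} D] [MonoidalCategory D] [CentralStructure E D]
  (N : Type uM) [Category.{vM} N] [MonoidalLeftAction C N] [MonoidalRightAction D N]

/-- The structure of a `C`-`D` bimodule over `E` in which `e ⊙ - = T_C(e) ⊙ -`: a `C`-`D` bimodule
with monoidal natural isomorphisms `v_e : T_C(e) ⊙ - ≅ - ⊙ T_D(e)` compatible with the half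
braidings of `T_C(e)` and `T_D(e)`. -/
structure CentralBimodule where
  mid (c : C) (n : N) (d : D) : (c ⊙ₗ n) ⊙ᵣ d ≅ c ⊙ₗ (n ⊙ᵣ d)
  mid_natural_left {c c' : C} (f : c ⟶ c') (n : N) (d : D) :
    (f ⊵ₗ n) ⊵ᵣ d ≫ (mid c' n d).hom = (mid c n d).hom ≫ f ⊵ₗ (n ⊙ᵣ d)
  mid_natural (c : C) {n n' : N} (f : n ⟶ n') (d : D) :
    (c ⊴ₗ f) ⊵ᵣ d ≫ (mid c n' d).hom = (mid c n d).hom ≫ c ⊴ₗ (f ⊵ᵣ d)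
  mid_natural_right (c : C) (n : N) {d d' : D} (f : d ⟶ d') :
    (c ⊙ₗ n) ⊴ᵣ f ≫ (mid c n d').hom = (mid c n d).hom ≫ c ⊴ₗ (n ⊴ᵣ f)
  mid_tensor_left (c c' : C) (n : N) (d : D) :
    (mid (c ⊗ c') n d).hom ≫ (αₗ c c' (n ⊙ᵣ d)).hom =
      (αₗ c c' n).hom ⊵ᵣ d ≫ (mid c (c' ⊙ₗ n) d).hom ≫ c ⊴ₗ (mid c' n d).hom
  mid_tensor_right (c : C) (n : N) (d d' : D) :
    (mid c n (d ⊗ d')).hom ≫ c ⊴ₗ (αᵣ n d d').hom =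
      (αᵣ (c ⊙ₗ n) d d').hom ≫ (mid c n d).hom ⊵ᵣ d' ≫ (mid c (n ⊙ᵣ d) d').hom
  mid_unit_left (n : N) (d : D) :
    (mid (𝟙_ C) n d).hom ≫ (λₗ (n ⊙ᵣ d)).hom = (λₗ n).hom ⊵ᵣ d
  mid_unit_right (c : C) (n : N) :
    (mid c n (𝟙_ D)).hom ≫ c ⊴ₗ (ρᵣ n).hom = (ρᵣ (c ⊙ₗ n)).hom
  v (e : E) (n : N) : T C e ⊙ₗ n ≅ n ⊙ᵣ T D e
  v_natural_left {e e' : E} (f : e ⟶ e') (n : N) :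
    Tmap C f ⊵ₗ n ≫ (v e' n).hom = (v e n).hom ≫ n ⊴ᵣ Tmap D f
  v_natural (e : E) {n n' : N} (f : n ⟶ n') :
    T C e ⊴ₗ f ≫ (v e n').hom = (v e n).hom ≫ f ⊵ᵣ T D e
  v_tensor (e e' : E) (n : N) :
    Tμ C e e' ⊵ₗ n ≫ (v (e ⊗ e') n).hom =
      (αₗ (T C e) (T C e') n).hom ≫ T C e ⊴ₗ (v e' n).hom ≫ (mid (T C e) n (T D e')).inv ≫
        (v e n).hom ⊵ᵣ T D e' ≫ (αᵣ n (T D e) (T D e')).inv ≫ n ⊴ᵣ Tμ D e e'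
  v_unit (n : N) :
    Tε C ⊵ₗ n ≫ (v (𝟙_ E) n).hom = (λₗ n).hom ≫ (ρᵣ n).inv ≫ n ⊴ᵣ Tε D
  v_left (e : E) (c : C) (n : N) :
    (z C e c).hom ⊵ₗ n ≫ (αₗ c (T C e) n).hom ≫ c ⊴ₗ (v e n).hom =
      (αₗ (T C e) c n).hom ≫ (v e (c ⊙ₗ n)).hom ≫ (mid c n (T D e)).hom
  v_right (e : E) (n : N) (d : D) :
    (mid (T C e) n d).hom ≫ (v e (n ⊙ᵣ d)).hom =
      (v e n).hom ⊵ᵣ d ≫ (αᵣ n (T D e) d).inv ≫ n ⊴ᵣ (z D e d).hom ≫ (αᵣ n d (T D e)).hom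

variable {D} in
/-- The functor `- ⊙ d`. -/
@[simps]
abbrev actR (d : D) : N ⥤ N where
  obj n := n ⊙ᵣ d
  map f := f ⊵ᵣ d

variable {E C D N}

lemma assoc_action (a b c : C) (n : N) : (α_ a b c).hom ⊵ₗ n ≫ (αₗ a (b ⊗ c) n).hom =
    (αₗ (a ⊗ b) c n).hom ≫ (αₗ a b (c ⊙ₗ n)).hom ≫ a ⊴ₗ (αₗ b c n).inv := by
  have h := MonoidalLeftAction.associator_actionHom a b c n
  rw [← reassoc_of% h, MonoidalLeftAction.actionHomRight_hom_inv, Category.comp_id]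

lemma assoc_action_inv (a b c : C) (n : N) :
    (αₗ a (b ⊗ c) n).inv ≫ (α_ a b c).inv ⊵ₗ n ≫ (αₗ (a ⊗ b) c n).hom =
    a ⊴ₗ (αₗ b c n).hom ≫ (αₗ a b (c ⊙ₗ n)).inv := by
  have h := MonoidalLeftAction.associator_actionHom a b c n
  rw [Iso.inv_comp_eq, ← cancel_epi ((α_ a b c).hom ⊵ₗ n), reassoc_of% h]
  simp

/-- The `E`-module structure of `c ⊙ -` given by the half braidings. -/
@[reducible]
def restrictL (c : C) :
    letI := restrictAction E C N
    (actL N c).LeftLinear E :=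
  letI := restrictAction E C N
  leftLinearMk (fun e n => (αₗ (T C e) c n).symm ≪≫ rIso N (z C e c) n ≪≫ αₗ c (T C e) n)
    (fun {e e'} f n => by
      have h := congrArg (· ⊵ₗ n) (z_natural_left C f c)
      have h2 := MonoidalLeftAction.whiskerRight_actionHomLeft c (Tmap C f) n
      have h3 := MonoidalLeftAction.whiskerLeft_actionHomLeft c (Tmap C f) n
      simp only [MonoidalLeftAction.comp_actionHomLeft, h2, h3, Category.assoc] at h
      change Tmap C f ⊵ₗ (c ⊙ₗ n) ≫ (αₗ (T C e') c n).inv ≫ (z C e' c).hom ⊵ₗ n ≫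
        (αₗ c (T C e') n).hom = ((αₗ (T C e) c n).inv ≫ (z C e c).hom ⊵ₗ n ≫
        (αₗ c (T C e) n).hom) ≫ c ⊴ₗ (Tmap C f ⊵ₗ n)
      rw [← cancel_epi (αₗ (T C e) c n).hom, reassoc_of% h]
      simp)
    (fun e {n n'} f => by
      have h := MonoidalLeftAction.action_exchange (z C e c).hom f
      have h2 := MonoidalLeftAction.tensor_actionHomRight (T C e) c f
      have h3 := MonoidalLeftAction.tensor_actionHomRight c (T C e) f
      rw [h2, h3] at h
      change T C e ⊴ₗ c ⊴ₗ f ≫ (αₗ (T C e) c n').inv ≫ (z C e c).hom ⊵ₗ n' ≫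
        (αₗ c (T C e) n').hom = ((αₗ (T C e) c n).inv ≫ (z C e c).hom ⊵ₗ n ≫
        (αₗ c (T C e) n).hom) ≫ c ⊴ₗ T C e ⊴ₗ f
      rw [← cancel_epi (αₗ (T C e) c n).hom]
      simp only [Category.assoc] at h
      rw [reassoc_of% h]
      simp)
    (fun e e' n => by
      have h := congrArg (· ⊵ₗ n) (Tμ_z C e e' c)
      change ((αₗ (T C (e ⊗ e')) c n).inv ≫ (z C (e ⊗ e') c).hom ⊵ₗ n ≫
        (αₗ c (T C (e ⊗ e')) n).hom) ≫ c ⊴ₗ ((TμIso C e e').inv ⊵ₗ n ≫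
          (αₗ (T C e) (T C e') n).hom) =
        ((TμIso C e e').inv ⊵ₗ (c ⊙ₗ n) ≫ (αₗ (T C e) (T C e') (c ⊙ₗ n)).hom) ≫
          T C e ⊴ₗ ((αₗ (T C e') c n).inv ≫ (z C e' c).hom ⊵ₗ n ≫ (αₗ c (T C e') n).hom) ≫
            (αₗ (T C e) c (T C e' ⊙ₗ n)).inv ≫ (z C e c).hom ⊵ₗ (T C e' ⊙ₗ n) ≫
              (αₗ c (T C e) (T C e' ⊙ₗ n)).hom
      have h3 := MonoidalLeftAction.whiskerLeft_actionHomLeft c (Tμ C e e') n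
      have h4 := MonoidalLeftAction.whiskerRight_actionHomLeft c (Tμ C e e') n
      have h5 := MonoidalLeftAction.whiskerLeft_actionHomLeft (T C e) (z C e' c).hom n
      have h6 := MonoidalLeftAction.whiskerRight_actionHomLeft (T C e') (z C e c).hom n
      simp only [MonoidalLeftAction.comp_actionHomLeft, h3, h4, h5, h6, Category.assoc] at h
      have ha := assoc_action (T C e) (T C e') c n
      have hb := assoc_action_inv (T C e) c (T C e') n
      have hc := assoc_action c (T C e) (T C e') n
      rw [reassoc_of% ha, reassoc_of% hb, reassoc_of% hc] at h
      simp only [Iso.inv_hom_id_assoc, Iso.cancel_iso_hom_left] at h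
      rw [← cancel_epi ((TμIso C e e').hom ⊵ₗ (c ⊙ₗ n))]
      simp only [MonoidalLeftAction.hom_inv_actionHomLeft_assoc, Category.assoc, TμIso_hom]
      rw [reassoc_of% h]
      have h7 : c ⊴ₗ Tμ C e e' ⊵ₗ n ≫ c ⊴ₗ (TμIso C e e').inv ⊵ₗ n = 𝟙 _ := by
        rw [← MonoidalLeftAction.actionHomRight_comp, ← TμIso_hom,
          MonoidalLeftAction.hom_inv_actionHomLeft, MonoidalLeftAction.actionHomRight_id]
      have h8 : Tμ C e e' ⊵ₗ (c ⊙ₗ n) ≫ (TμIso C e e').inv ⊵ₗ (c ⊙ₗ n) = 𝟙 _ := by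
        rw [← TμIso_hom, MonoidalLeftAction.hom_inv_actionHomLeft]
      simp only [MonoidalLeftAction.actionHomRight_comp, Category.assoc, Iso.inv_hom_id_assoc,
        reassoc_of% h7, reassoc_of% h8, MonoidalLeftAction.actionHomRight_inv_hom,
        Category.comp_id])
    (fun n => by
      have h := congrArg (· ⊵ₗ n) (Tε_z (E := E) C c)
      change (TεIso (E := E) C).inv ⊵ₗ (c ⊙ₗ n) ≫ (λₗ (c ⊙ₗ n)).hom =
        ((αₗ (T C (𝟙_ E)) c n).inv ≫ (z C (𝟙_ E) c).hom ⊵ₗ n ≫ (αₗ c (T C (𝟙_ E)) n).hom) ≫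
          c ⊴ₗ ((TεIso (E := E) C).inv ⊵ₗ n ≫ (λₗ n).hom)
      have h3 := MonoidalLeftAction.whiskerLeft_actionHomLeft c (Tε (E := E) C) n
      have h4 := MonoidalLeftAction.whiskerRight_actionHomLeft c (Tε (E := E) C) n
      have h5 : (ρ_ c).inv ⊵ₗ n = c ⊴ₗ (λₗ n).inv ≫ (αₗ c (𝟙_ C) n).inv := by
        rw [← cancel_epi ((ρ_ c).hom ⊵ₗ n), MonoidalLeftAction.hom_inv_actionHomLeft,
          MonoidalLeftAction.rightUnitor_actionHom]
        simp
      simp only [MonoidalLeftAction.comp_actionHomLeft, h3, h4, h5, Category.assoc,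
        MonoidalLeftAction.leftUnitor_actionHom, Iso.inv_hom_id_assoc,
        Iso.cancel_iso_hom_left] at h
      have h7 : c ⊴ₗ Tε (E := E) C ⊵ₗ n ≫ c ⊴ₗ (TεIso (E := E) C).inv ⊵ₗ n = 𝟙 _ := by
        rw [← MonoidalLeftAction.actionHomRight_comp, ← TεIso_hom,
          MonoidalLeftAction.hom_inv_actionHomLeft, MonoidalLeftAction.actionHomRight_id]
      have h8 : Tε (E := E) C ⊵ₗ (c ⊙ₗ n) ≫ (TεIso (E := E) C).inv ⊵ₗ (c ⊙ₗ n) = 𝟙 _ := by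
        rw [← TεIso_hom, MonoidalLeftAction.hom_inv_actionHomLeft]
      rw [← cancel_epi ((TεIso (E := E) C).hom ⊵ₗ (c ⊙ₗ n))]
      simp only [TεIso_hom, Category.assoc, reassoc_of% h8, reassoc_of% h,
        Iso.inv_hom_id_assoc, MonoidalLeftAction.actionHomRight_comp, reassoc_of% h7,
        MonoidalLeftAction.actionHomRight_inv_hom, Category.comp_id])

/-- The `E`-module structure of `- ⊙ d` given by the bimodule constraint. -/
@[reducible]
def CentralBimodule.restrictR (B : CentralBimodule E C D N) (d : D) :
    letI := restrictAction E C N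
    (actR N d).LeftLinear E :=
  letI := restrictAction E C N
  leftLinearMk (fun e n => (B.mid (T C e) n d).symm)
    (fun {e e'} f n => by
      have h := B.mid_natural_left (Tmap C f) n d
      change Tmap C f ⊵ₗ (n ⊙ᵣ d) ≫ (B.mid (T C e') n d).inv =
        (B.mid (T C e) n d).inv ≫ (Tmap C f ⊵ₗ n) ⊵ᵣ d
      rw [Iso.eq_inv_comp, ← reassoc_of% h]; simp)
    (fun e {n n'} f => by
      have h := B.mid_natural (T C e) f d
      change T C e ⊴ₗ (f ⊵ᵣ d) ≫ (B.mid (T C e) n' d).inv =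
        (B.mid (T C e) n d).inv ≫ (T C e ⊴ₗ f) ⊵ᵣ d
      rw [Iso.eq_inv_comp, ← reassoc_of% h]; simp)
    (fun e e' n => by
      have h := B.mid_tensor_left (T C e) (T C e') n d
      have h2 := B.mid_natural_left (TμIso C e e').inv n d
      change (B.mid (T C (e ⊗ e')) n d).inv ≫ ((TμIso C e e').inv ⊵ₗ n ≫
          (αₗ (T C e) (T C e') n).hom) ⊵ᵣ d =
        ((TμIso C e e').inv ⊵ₗ (n ⊙ᵣ d) ≫ (αₗ (T C e) (T C e') (n ⊙ᵣ d)).hom) ≫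
          T C e ⊴ₗ (B.mid (T C e') n d).inv ≫ (B.mid (T C e) (T C e' ⊙ₗ n) d).inv
      rw [Iso.inv_comp_eq, Category.assoc, ← reassoc_of% h2, reassoc_of% h,
        MonoidalRightAction.comp_actionHomLeft, MonoidalLeftAction.actionHomRight_hom_inv_assoc]
      simp)
    (fun n => by
      have h := B.mid_unit_left n d
      have h2 := B.mid_natural_left (TεIso (E := E) C).inv n d
      change (TεIso (E := E) C).inv ⊵ₗ (n ⊙ᵣ d) ≫ (λₗ (n ⊙ᵣ d)).hom =
        (B.mid (T C (𝟙_ E)) n d).inv ≫ ((TεIso (E := E) C).inv ⊵ₗ n ≫ (λₗ n).hom) ⊵ᵣ d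
      rw [Iso.eq_inv_comp, ← reassoc_of% h2, h, MonoidalRightAction.comp_actionHomLeft])

lemma CentralBimodule.v_left_inv (B : CentralBimodule E C D N) (e e' : E) (n : N) :
    (B.mid (T C e') n (T D e)).inv ≫ (B.v e (T C e' ⊙ₗ n)).inv =
      T C e' ⊴ₗ (B.v e n).inv ≫ (αₗ (T C e') (T C e) n).inv ≫ (z C e' (T C e)).hom ⊵ₗ n ≫
        (αₗ (T C e) (T C e') n).hom := by
  have h := B.v_left e (T C e') n
  have h2 := congrArg (· ⊵ₗ n) (z_symm C e e')
  simp only [MonoidalLeftAction.comp_actionHomLeft, MonoidalLeftAction.id_actionHomLeft] at h2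
  rw [Iso.inv_comp_eq, ← cancel_epi (B.v e (T C e' ⊙ₗ n)).hom, Iso.hom_inv_id,
    ← cancel_epi (αₗ (T C e) (T C e') n).hom,
    ← reassoc_of% h, MonoidalLeftAction.actionHomRight_hom_inv_assoc, Iso.hom_inv_id_assoc,
    reassoc_of% h2, Category.comp_id]

lemma swap_restrict (e e' : E) (n : N) :
    letI := restrictAction E C N
    swap e e' n = (αₗ (T C e) (T C e') n).inv ≫ (z C e (T C e')).hom ⊵ₗ n ≫
      (αₗ (T C e') (T C e) n).hom := by
  have h := congrArg (· ⊵ₗ n) (Tμ_braiding C e e')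
  simp only [MonoidalLeftAction.comp_actionHomLeft] at h
  change ((αₗ (T C e) (T C e') n).inv ≫ Tμ C e e' ⊵ₗ n) ≫ Tmap C (β_ e e').hom ⊵ₗ n ≫
    (TμIso C e' e).inv ⊵ₗ n ≫ (αₗ (T C e') (T C e) n).hom = _
  rw [Category.assoc, reassoc_of% h, ← TμIso_hom,
    MonoidalLeftAction.hom_inv_actionHomLeft_assoc]

variable (k : Type*) [Field k] [Preadditive E] [Linear k E] [Preadditive C] [Linear k C]
  [Preadditive D] [Linear k D] [Preadditive N] [Linear k N]

variable (E C N) in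
lemma restrictAction_linear [CentralStructure.IsLinear k E C] [LinearLeftAction k C N] :
    letI := restrictAction E C N
    LinearLeftAction k E N :=
  letI := restrictAction E C N
  { right_add := fun a _ _ f g => LinearLeftAction.right_add (k := k) (T C a) f g
    right_smul := fun a _ _ r f => LinearLeftAction.right_smul (k := k) (T C a) r f
    left_add := fun {e e'} f g n => by
      have h : Tmap C (f + g) = Tmap C f + Tmap C g := CentralStructure.IsLinear.map_add k f g
      change Tmap C (f + g) ⊵ₗ n = Tmap C f ⊵ₗ n + Tmap C g ⊵ₗ n
      rw [h, LinearLeftAction.left_add (k := k)]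
    left_smul := fun {e e'} r f n => by
      have h : Tmap C (r • f) = r • Tmap C f := CentralStructure.IsLinear.map_smul r f
      change Tmap C (r • f) ⊵ₗ n = r • (Tmap C f ⊵ₗ n)
      rw [h, LinearLeftAction.left_smul (k := k)] }

/-- The bimodule over `E` given by a central bimodule, with `e ⊙ - = T_C(e) ⊙ -`, `uC = id` and
`uD = v⁻¹`. -/
@[reducible]
def CentralBimodule.toBMod (B : CentralBimodule E C D N)
    [CentralStructure.IsLinear k E C] [LinearLeftAction k C N] [LinearRightAction k D N] :
    BMod k E C D :=
  letI := restrictAction E C N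
  { carrier := N
    linE := restrictAction_linear E C N k
    mid := B.mid
    mid_natural_left := B.mid_natural_left
    mid_natural := B.mid_natural
    mid_natural_right := B.mid_natural_right
    mid_tensor_left := B.mid_tensor_left
    mid_tensor_right := B.mid_tensor_right
    mid_unit_left := B.mid_unit_left
    mid_unit_right := B.mid_unit_right
    uC := fun e n => Iso.refl _
    uC_natural_left := fun f n => (Category.comp_id _).trans (Category.id_comp _).symm
    uC_natural := fun e _ _ f => (Category.comp_id _).trans (Category.id_comp _).symm
    uC_tensor := fun e e' n => by
      change Tμ C e e' ⊵ₗ n ≫ 𝟙 _ ≫ (TμIso C e e').inv ⊵ₗ n ≫ (αₗ (T C e) (T C e') n).hom =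
        (αₗ (T C e) (T C e') n).hom ≫ T C e ⊴ₗ 𝟙 _ ≫ 𝟙 _
      rw [Category.id_comp, ← TμIso_hom, MonoidalLeftAction.hom_inv_actionHomLeft_assoc]
      simp
    uC_unit := fun n => by
      change Tε C ⊵ₗ n ≫ 𝟙 _ ≫ (TεIso (E := E) C).inv ⊵ₗ n ≫ (λₗ n).hom = (λₗ n).hom
      rw [Category.id_comp, ← TεIso_hom, MonoidalLeftAction.hom_inv_actionHomLeft_assoc]
    uD := fun e n => (B.v e n).symm
    uD_natural_left := fun {e e'} f n => by
      change n ⊴ᵣ Tmap D f ≫ (B.v e' n).inv = (B.v e n).inv ≫ Tmap C f ⊵ₗ n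
      rw [Iso.eq_inv_comp, ← reassoc_of% (B.v_natural_left f n), Iso.hom_inv_id, Category.comp_id]
    uD_natural := fun e n n' f => by
      change f ⊵ᵣ T D e ≫ (B.v e n').inv = (B.v e n).inv ≫ T C e ⊴ₗ f
      rw [Iso.eq_inv_comp, ← reassoc_of% (B.v_natural e f), Iso.hom_inv_id, Category.comp_id]
    uD_tensor := fun e e' n => by
      have h := congrArg (· ⊵ₗ n) (Tμ_braiding C e e')
      simp only [MonoidalLeftAction.comp_actionHomLeft] at h
      have h2 := B.v_tensor e e' n
      have h3 := B.v_left_inv e' e n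
      change n ⊴ᵣ Tμ D e e' ≫ (B.v (e ⊗ e') n).inv ≫ Tmap C (β_ e e').hom ⊵ₗ n ≫
        (TμIso C e' e).inv ⊵ₗ n ≫ (αₗ (T C e') (T C e) n).hom =
        (αᵣ n (T D e) (T D e')).hom ≫ (B.v e n).inv ⊵ᵣ T D e' ≫ (B.v e' (T C e ⊙ₗ n)).inv
      rw [Iso.inv_comp_eq] at h3
      have h4 : n ⊴ᵣ Tμ D e e' = (αᵣ n (T D e) (T D e')).hom ≫ (B.v e n).inv ⊵ᵣ T D e' ≫
          (B.mid (T C e) n (T D e')).hom ≫ T C e ⊴ₗ (B.v e' n).inv ≫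
            (αₗ (T C e) (T C e') n).inv ≫ Tμ C e e' ⊵ₗ n ≫ (B.v (e ⊗ e') n).hom := by
        rw [h2]; simp
      rw [h3, h4]
      simp only [Category.assoc, Iso.hom_inv_id_assoc]
      rw [reassoc_of% h, ← TμIso_hom, MonoidalLeftAction.hom_inv_actionHomLeft_assoc]
    uD_unit := fun n => by
      have h2 := B.v_unit n
      change n ⊴ᵣ Tε D ≫ (B.v (𝟙_ E) n).inv ≫ (TεIso (E := E) C).inv ⊵ₗ n ≫ (λₗ n).hom =
        (ρᵣ n).hom
      rw [← TεIso_hom] at h2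
      have h3 : n ⊴ᵣ Tε (E := E) D = (ρᵣ n).hom ≫ (λₗ n).inv ≫ (TεIso (E := E) C).hom ⊵ₗ n ≫
          (B.v (𝟙_ E) n).hom := by
        rw [h2]; simp
      rw [h3]
      simp only [Category.assoc, Iso.hom_inv_id_assoc,
        MonoidalLeftAction.hom_inv_actionHomLeft_assoc, Iso.inv_hom_id, Category.comp_id]
    sE := fun c d => leftLinearComp (F := actL N c) (G := actR N d) (restrictL c) (B.restrictR d)
    uC_sE := fun e c n d => by
      change (αₗ (T C e) c n).hom ⊵ᵣ d ≫ (B.mid (T C e) (c ⊙ₗ n) d).hom ≫ 𝟙 _ ≫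
        (B.mid (T C e) (c ⊙ₗ n) d).inv ≫ ((αₗ (T C e) c n).inv ≫ (z C e c).hom ⊵ₗ n ≫
          (αₗ c (T C e) n).hom) ⊵ᵣ d =
        ((z C e c).hom ⊵ₗ n) ⊵ᵣ d ≫ (αₗ c (T C e) n).hom ⊵ᵣ d ≫ (c ⊴ₗ 𝟙 _) ⊵ᵣ d
      rw [Category.id_comp, Iso.hom_inv_id_assoc, ← MonoidalRightAction.comp_actionHomLeft,
        Iso.hom_inv_id_assoc]
      simp
    uD_sE := fun e c n d => by
      have h := B.v_right e (c ⊙ₗ n) d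
      have h2 := B.v_left e c n
      change (αᵣ (c ⊙ₗ n) d (T D e)).hom ≫ (B.v e ((c ⊙ₗ n) ⊙ᵣ d)).inv ≫
        (B.mid (T C e) (c ⊙ₗ n) d).inv ≫ ((αₗ (T C e) c n).inv ≫ (z C e c).hom ⊵ₗ n ≫
          (αₗ c (T C e) n).hom) ⊵ᵣ d =
        (c ⊙ₗ n) ⊴ᵣ (z D e d).inv ≫ (αᵣ (c ⊙ₗ n) (T D e) d).hom ≫
          (B.mid c n (T D e)).hom ⊵ᵣ d ≫ (c ⊴ₗ (B.v e n).inv) ⊵ᵣ d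
      have h3 : ((αₗ (T C e) c n).inv ≫ (z C e c).hom ⊵ₗ n ≫ (αₗ c (T C e) n).hom) =
          (B.v e (c ⊙ₗ n)).hom ≫ (B.mid c n (T D e)).hom ≫ c ⊴ₗ (B.v e n).inv := by
        rw [Iso.inv_comp_eq, ← reassoc_of% h2, MonoidalLeftAction.actionHomRight_hom_inv,
          Category.comp_id]
      have h4 : (αᵣ (c ⊙ₗ n) d (T D e)).hom ≫ (B.v e ((c ⊙ₗ n) ⊙ᵣ d)).inv ≫
        (B.mid (T C e) (c ⊙ₗ n) d).inv ≫ (B.v e (c ⊙ₗ n)).hom ⊵ᵣ d =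
          (c ⊙ₗ n) ⊴ᵣ (z D e d).inv ≫ (αᵣ (c ⊙ₗ n) (T D e) d).hom := by
        rw [← cancel_epi ((c ⊙ₗ n) ⊴ᵣ (z D e d).hom),
          MonoidalRightAction.actionHomRight_hom_inv_assoc,
          ← cancel_epi (αᵣ (c ⊙ₗ n) (T D e) d).inv, Iso.inv_hom_id,
          ← cancel_epi ((B.v e (c ⊙ₗ n)).hom ⊵ᵣ d), ← reassoc_of% h]
        simp
      rw [h3, MonoidalRightAction.comp_actionHomLeft, MonoidalRightAction.comp_actionHomLeft,
        reassoc_of% h4]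
    uC_linear := fun e e' n => by
      rw [swap_restrict]
      have h := B.mid_unit_right (T C e') (T C e ⊙ₗ n)
      change ((B.mid (T C e') (T C e ⊙ₗ n) (𝟙_ D)).inv ≫ ((αₗ (T C e') (T C e) n).inv ≫
        (z C e' (T C e)).hom ⊵ₗ n ≫ (αₗ (T C e) (T C e') n).hom) ⊵ᵣ 𝟙_ D) ≫
          (ρᵣ (T C e ⊙ₗ T C e' ⊙ₗ n)).hom ≫ 𝟙 _ =
        T C e' ⊴ₗ ((ρᵣ (T C e ⊙ₗ n)).hom ≫ 𝟙 _) ≫ (αₗ (T C e') (T C e) n).inv ≫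
        (z C e' (T C e)).hom ⊵ₗ n ≫ (αₗ (T C e) (T C e') n).hom
      rw [Category.assoc, Iso.inv_comp_eq, Category.comp_id, Category.comp_id, reassoc_of% h,
        MonoidalRightAction.actionUnitIso_hom_naturality]
    uD_linear := fun e e' n => by
      rw [swap_restrict]
      have h := B.v_left_inv e e' n
      change ((B.mid (T C e') (𝟙_ C ⊙ₗ n) (T D e)).inv ≫ ((αₗ (T C e') (𝟙_ C) n).inv ≫
        (z C e' (𝟙_ C)).hom ⊵ₗ n ≫ (αₗ (𝟙_ C) (T C e') n).hom) ⊵ᵣ T D e) ≫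
          (λₗ (T C e' ⊙ₗ n)).hom ⊵ᵣ T D e ≫ (B.v e (T C e' ⊙ₗ n)).inv =
        T C e' ⊴ₗ ((λₗ n).hom ⊵ᵣ T D e ≫ (B.v e n).inv) ≫ (αₗ (T C e') (T C e) n).inv ≫
        (z C e' (T C e)).hom ⊵ₗ n ≫ (αₗ (T C e) (T C e') n).hom
      have h2 := B.mid_natural (T C e') (λₗ[C] n).hom (T D e)
      have h3 : ((αₗ (T C e') (𝟙_ C) n).inv ≫ (z C e' (𝟙_ C)).hom ⊵ₗ n ≫
          (αₗ (𝟙_ C) (T C e') n).hom) ≫ (λₗ (T C e' ⊙ₗ n)).hom = T C e' ⊴ₗ (λₗ n).hom := by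
        rw [z_unit, MonoidalLeftAction.comp_actionHomLeft, MonoidalLeftAction.rightUnitor_actionHom,
          Category.assoc, Category.assoc]
        simp only [Category.assoc, Iso.inv_hom_id_assoc]
        rw [← MonoidalLeftAction.leftUnitor_actionHom, MonoidalLeftAction.inv_hom_actionHomLeft,
          Category.comp_id]
      rw [Category.assoc, ← MonoidalRightAction.comp_actionHomLeft_assoc, h3,
        MonoidalLeftAction.actionHomRight_comp, Category.assoc, ← h, Iso.inv_comp_eq,
        ← reassoc_of% h2, Iso.hom_inv_id_assoc] }

end OfCentral
/-- `C` as a `C`-`C` bimodule over `E`, with `v_e = z_{e,-} : T(e) ⊗ - ≅ - ⊗ T(e)`. -/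
@[reducible]
def regularCentral (E : Type uE) [Category.{vE} E] [MonoidalCategory E] [SymmetricCategory E]
    (C : Type uC) [Category.{vC} C] [MonoidalCategory C] [CentralStructure E C] :
    CentralBimodule E C C C where
  mid c n d := α_ c n d
  mid_natural_left f n d := associator_naturality_left f n d
  mid_natural c _ _ f d := associator_naturality_middle c f d
  mid_natural_right c n _ _ f := associator_naturality_right c n f
  mid_tensor_left c c' n d := by simp
  mid_tensor_right c n d d' := by simp
  mid_unit_left n d := by simp
  mid_unit_right c n := by simp
  v e n := z C e n
  v_natural_left f n := z_natural_left C f n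
  v_natural e _ _ f := z_natural C e f
  v_tensor e e' n := by
    have h := Tμ_z C e e' n
    simpa using h
  v_unit n := by
    have h := Tε_z (E := E) C n
    simpa using h
  v_left e c n := by
    have h := z_tensor C e c n
    simp [h]
  v_right e n d := by
    have h := z_tensor C e n d
    simp [h]

section Regular

variable (k : Type*) [Field k]
  (A : Type u) [Category.{v} A] [Preadditive A] [Linear k A] [MonoidalCategory A]
  [MonoidalPreadditive A] [MonoidalLinear k A]

instance : LinearLeftAction k A A where
  right_add a _ _ f g := by simp
  right_smul a _ _ r f := by simp
  left_add f g m := by simp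
  left_smul r f m := by simp

instance : LinearRightAction k A A where
  right_add a _ _ f g := by simp
  right_smul a _ _ r f := by simp
  left_add f g m := by simp
  left_smul r f m := by simp

end Regular

/-- `C` as a `C`-`C` bimodule over `E`. -/
abbrev regular (k : Type*) [Field k]
    (E : Type uE) [Category.{vE} E] [Preadditive E] [Linear k E]
    [MonoidalCategory E] [SymmetricCategory E]
    (C : Type uC) [Category.{vC} C] [Preadditive C] [Linear k C] [MonoidalCategory C]
    [MonoidalPreadditive C] [MonoidalLinear k C]
    [CentralStructure E C] [CentralStructure.IsLinear k E C] : BMod k E C C :=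
  (regularCentral E C).toBMod k

/-! ### The `C`-`C` bimodule structure on categories of module functors -/

/-- The transformation `c ⊙ - ⟶ c' ⊙ -` given by `c ⟶ c'`. -/
@[simps]
def actLMap {A : Type u} [Category.{v} A] [MonoidalCategory A] (M : Type uM) [Category.{vM} M]
    [MonoidalLeftAction A M] {c c' : A} (f : c ⟶ c') : actL M c ⟶ actL M c' where
  app m := f ⊵ₗ m
  naturality _ _ g := MonoidalLeftAction.action_exchange f g

/-- `(c ⊗ c') ⊙ - ≅ c ⊙ (c' ⊙ -)`. -/
@[simps!]
def actLAssoc {A : Type u} [Category.{v} A] [MonoidalCategory A] (M : Type uM) [Category.{vM} M]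
    [MonoidalLeftAction A M] (c c' : A) : actL M (c ⊗ c') ≅ actL M c' ⋙ actL M c :=
  NatIso.ofComponents (fun m => αₗ c c' m) (fun f => by simp)

/-- `𝟙 ⊙ - ≅ 𝟭`. -/
@[simps!]
def actLUnit (A : Type u) [Category.{v} A] [MonoidalCategory A] (M : Type uM) [Category.{vM} M]
    [MonoidalLeftAction A M] : actL M (𝟙_ A) ≅ 𝟭 M :=
  NatIso.ofComponents (fun m => λₗ m) (fun f => by simp)

lemma actL_additive (k : Type*) [Field k] (A : Type u) [Category.{v} A] [Preadditive A]
    [Linear k A] [MonoidalCategory A] {M : Type uM} [Category.{vM} M] [Preadditive M] [Linear k M]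
    [MonoidalLeftAction A M] [LinearLeftAction k A M] (c : A) : (actL M c).Additive :=
  ⟨fun {_ _} f g => LinearLeftAction.right_add (k := k) c f g⟩

lemma actL_linear (k : Type*) [Field k] (A : Type u) [Category.{v} A] [Preadditive A]
    [Linear k A] [MonoidalCategory A] {M : Type uM} [Category.{vM} M] [Preadditive M] [Linear k M]
    [MonoidalLeftAction A M] [LinearLeftAction k A M] (c : A) : (actL M c).Linear k :=
  ⟨fun f r => LinearLeftAction.right_smul c r f⟩

lemma leftLinear_swap {E : Type uE} [Category.{vE} E] [MonoidalCategory E] [SymmetricCategory E]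
    {M : Type u} [Category.{v} M] [MonoidalLeftAction E M]
    {M' : Type uM} [Category.{vM} M'] [MonoidalLeftAction E M'] {F : M ⥤ M'}
    (p : F.LeftLinear E) (e e' : E) (m : M) :
    e ⊴ₗ p.μₗ e' m ≫ p.μₗ e (e' ⊙ₗ m) ≫ F.map (swap e e' m) =
      swap e e' (F.obj m) ≫ e' ⊴ₗ p.μₗ e m ≫ p.μₗ e' (e ⊙ₗ m) := by
  have h := p.μₗ_associativity e e' m
  have h' := p.μₗ_associativity e' e m
  have h2 := p.μₗ_naturality_left (β_ e e').hom m
  have h3 : e ⊴ₗ p.μₗ e' m ≫ p.μₗ e (e' ⊙ₗ m) =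
      (αₗ e e' (F.obj m)).inv ≫ p.μₗ (e ⊗ e') m ≫ F.map (αₗ e e' m).hom := by
    rw [h, Iso.inv_hom_id_assoc]
  have h4 : F.map (swap e e' m) = F.map (αₗ e e' m).inv ≫ F.map ((β_ e e').hom ⊵ₗ m) ≫
      F.map (αₗ e' e m).hom := by
    rw [swap, Functor.map_comp, Functor.map_comp]
  rw [h4, ← Category.assoc, h3, swap]
  simp only [Category.assoc]
  rw [← F.map_comp_assoc, Iso.hom_inv_id, F.map_id, Category.id_comp, ← reassoc_of% h2, h']

namespace BMod

section FunLemmas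

variable {k : Type*} [Field k]
  {E : Type uE} [Category.{vE} E] [Preadditive E] [Linear k E]
  [MonoidalCategory E] [SymmetricCategory E]
  {C : Type uC} [Category.{vC} C] [Preadditive C] [Linear k C]
  [MonoidalCategory C] [CentralStructure E C]
  {D : Type uD} [Category.{vD} D] [Preadditive D] [Linear k D]
  [MonoidalCategory D] [CentralStructure E D]

section One

variable (M : BMod k E C D)

lemma actLE_eq (c : C) (e : E) (m : M.carrier) :
    (M.actLE c).μₗ e m = (M.uC e (c ⊙ₗ m)).inv ≫
      (αₗ (T C e) c m).inv ≫ (z C e c).hom ⊵ₗ m ≫ (αₗ c (T C e) m).hom ≫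
        c ⊴ₗ (M.uC e m).hom := by
  rw [Iso.eq_inv_comp, actLE_uC]

lemma actLE_natural {c c' : C} (f : c ⟶ c') :
    actLMap M.carrier f ∈ leftNat k (M.actLE c) (M.actLE c') := fun e m => by
  have h := M.uC_natural e (f ⊵ₗ m)
  have h2 := congrArg (· ⊵ₗ m) (z_natural C e f)
  have h3 := MonoidalLeftAction.whiskerLeft_actionHomLeft (T C e) f m
  have h4 := MonoidalLeftAction.whiskerRight_actionHomLeft (T C e) f m
  have h5 := MonoidalLeftAction.action_exchange f (M.uC e m).hom
  simp only [MonoidalLeftAction.comp_actionHomLeft, h3, h4, Category.assoc] at h2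
  change e ⊴ₗ f ⊵ₗ m ≫ (M.actLE c').μₗ e m = (M.actLE c).μₗ e m ≫ f ⊵ₗ (e ⊙ₗ m)
  rw [← cancel_epi (M.uC e (c ⊙ₗ m)).hom, ← reassoc_of% h, actLE_uC, reassoc_of% (M.actLE_uC),
    h5, ← cancel_epi (αₗ (T C e) c m).hom]
  rw [reassoc_of% h2]
  simp only [Iso.hom_inv_id_assoc, Iso.inv_hom_id_assoc]

lemma actLE_assoc (c c' : C) : (actLAssoc M.carrier c c').hom ∈
    leftNat k (M.actLE (c ⊗ c')) (leftLinearComp (M.actLE c') (M.actLE c)) := fun e m => by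
  have h := M.uC_natural e (αₗ c c' m).hom
  change e ⊴ₗ (αₗ c c' m).hom ≫ (M.actLE c).μₗ e (c' ⊙ₗ m) ≫ c ⊴ₗ (M.actLE c').μₗ e m =
    (M.actLE (c ⊗ c')).μₗ e m ≫ (αₗ c c' (e ⊙ₗ m)).hom
  rw [← cancel_epi (M.uC e ((c ⊗ c') ⊙ₗ m)).hom, ← reassoc_of% h, reassoc_of% (M.actLE_uC),
    reassoc_of% (M.actLE_uC), ← MonoidalLeftAction.actionHomRight_comp, actLE_uC, z_tensor]
  simp only [MonoidalLeftAction.comp_actionHomLeft, MonoidalLeftAction.whiskerRight_actionHomLeft,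
    MonoidalLeftAction.whiskerLeft_actionHomLeft, MonoidalLeftAction.actionHomRight_comp,
    MonoidalLeftAction.tensor_actionHomRight, Category.assoc]
  have ha := assoc_action c (T C e) c' m
  have hb := assoc_action_inv c c' (T C e) m
  have hc : (αₗ (T C e) (c ⊗ c') m).inv ≫ (α_ (T C e) c c').inv ⊵ₗ m =
      T C e ⊴ₗ (αₗ c c' m).hom ≫ (αₗ (T C e) c (c' ⊙ₗ m)).inv ≫ (αₗ (T C e ⊗ c) c' m).inv := by
    rw [← cancel_mono (αₗ (T C e ⊗ c) c' m).hom, Category.assoc, assoc_action_inv]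
    simp
  rw [reassoc_of% hc, Iso.inv_hom_id_assoc, reassoc_of% ha, Iso.inv_hom_id_assoc, reassoc_of% hb]
  simp only [Iso.inv_hom_id_assoc, Category.assoc, Iso.inv_hom_id, Category.comp_id]

lemma actLE_unit (e : E) (m : M.carrier) :
    e ⊴ₗ (λₗ[C] m).hom = (M.actLE (𝟙_ C)).μₗ e m ≫ (λₗ[C] (e ⊙ₗ m)).hom := by
  have h := M.uC_natural e (λₗ[C] m).hom
  rw [← cancel_epi (M.uC e (𝟙_ C ⊙ₗ m)).hom, ← h, reassoc_of% (M.actLE_uC), z_unit]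
  have h2 := MonoidalLeftAction.leftUnitor_actionHom (T C e) m
  have h3 := MonoidalLeftAction.rightUnitor_actionHom (T C e) m
  rw [MonoidalLeftAction.comp_actionHomLeft, h3, MonoidalLeftAction.unit_actionHomRight]
  simp only [Category.assoc, Iso.inv_hom_id_assoc, Iso.inv_hom_id, Category.comp_id]
  rw [← reassoc_of% h2, MonoidalLeftAction.inv_hom_actionHomLeft_assoc]

lemma actLE_uC_linear (e e' : E) (m : M.carrier) :
    (M.actLE (T C e)).μₗ e' m ≫ (M.uC e (e' ⊙ₗ m)).hom =
      e' ⊴ₗ (M.uC e m).hom ≫ swap e' e m := by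
  have h := M.uC_linear e e' m
  change (e' ⊴ₗ (ρᵣ[D] (T C e ⊙ₗ m)).inv ≫ (M.sE (T C e) (𝟙_ D)).μₗ e' m ≫
    (ρᵣ[D] (T C e ⊙ₗ e' ⊙ₗ m)).hom) ≫ (M.uC e (e' ⊙ₗ m)).hom = _
  simp only [Category.assoc]
  rw [h, ← MonoidalLeftAction.actionHomRight_comp_assoc, Iso.inv_hom_id_assoc]

/-- The right `D`-module structure of `c ⊙ -` given by the bimodule constraint. -/
@[reducible]
def actLD (c : C) : (actL M.carrier c).RightLinear D :=
  rightLinearMk (fun m d => M.mid c m d)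
    (fun m _ _ f => M.mid_natural_right c m f)
    (fun f d => M.mid_natural c f d)
    (fun m d d' => M.mid_tensor_right c m d d')
    (fun m => (M.mid_unit_right c m).symm)

lemma actLD_natural {c c' : C} (f : c ⟶ c') :
    actLMap M.carrier f ∈ rightNat k (M.actLD c) (M.actLD c') := fun m d => by
  exact M.mid_natural_left f m d

lemma actLD_assoc (c c' : C) : (actLAssoc M.carrier c c').hom ∈
    rightNat k (M.actLD (c ⊗ c')) (rightLinearComp (M.actLD c') (M.actLD c)) := fun m d =>
  (M.mid_tensor_left c c' m d).symm

lemma actLD_unit (m : M.carrier) (d : D) :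
    (λₗ[C] m).hom ⊵ᵣ d = (M.actLD (𝟙_ C)).μᵣ m d ≫ (λₗ[C] (m ⊙ᵣ d)).hom :=
  (M.mid_unit_left m d).symm

end One

variable {M M' : BMod k E C D} {F : M.carrier ⥤ M'.carrier}

/-- Compatibility with `uD` implies compatibility with the bimodule constraints of the actions
of `E` and `D`. -/
lemma bimodule_of_uD (p : F.LeftLinear E) (q : F.RightLinear D)
    (h : ∀ (e : E) (m : M.carrier),
      q.μᵣ m (T D e) ≫ F.map (M.uD e m).hom = (M'.uD e (F.obj m)).hom ≫ p.μₗ e m)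
    (e : E) (m : M.carrier) (d : D) :
    p.μₗ e m ⊵ᵣ d ≫ q.μᵣ (e ⊙ₗ m) d ≫ F.map (M.midE e m d) =
      M'.midE e (F.obj m) d ≫ e ⊴ₗ q.μᵣ m d ≫ p.μₗ e (m ⊙ᵣ d) := by
  have h1 := congrArg (· ⊵ᵣ d) (h e m)
  have h2 := q.μᵣ_naturality_left (M.uD e m).hom d
  have h3 := congrArg F.map (M.midE_uD e m d)
  have h4 := M'.midE_uD e (F.obj m) d
  have h5 := M'.uD_natural e (q.μᵣ m d)
  have h6 := q.μᵣ_associativity m (T D e) d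
  have h7 := q.μᵣ_associativity m d (T D e)
  have h8 := q.μᵣ_naturality_right m (z D e d).hom
  simp only [MonoidalRightAction.comp_actionHomLeft] at h1
  simp only [Functor.map_comp] at h3
  rw [← cancel_epi ((M'.uD e (F.obj m)).hom ⊵ᵣ d), ← reassoc_of% h1, reassoc_of% h2, h3,
    reassoc_of% h4, ← reassoc_of% h5, ← h, ← cancel_epi (αᵣ (F.obj m) (T D e) d).hom,
    ← reassoc_of% h6, ← F.map_comp_assoc, Iso.hom_inv_id, F.map_id, Category.id_comp,
    ← reassoc_of% h8, reassoc_of% h7, Iso.hom_inv_id_assoc]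

/-- The transformation `T(e) ⊙ F(m) ≅ e ⊙ F(m) ≅ F(e ⊙ m) ≅ F(T(e) ⊙ m)`. -/
@[simps!]
def vIso (p : F.LeftLinear E) (e : E) :
    F ⋙ actL M'.carrier (T C e) ≅ actL M.carrier (T C e) ⋙ F :=
  NatIso.ofComponents
    (fun m => M'.uC e (F.obj m) ≪≫ Functor.LeftLinear.μₗIso F e m ≪≫ F.mapIso (M.uC e m).symm)
    (fun {m m'} f => by
      have h := M'.uC_natural e (F.map f)
      have h2 := p.μₗ_naturality_right e f
      have h3 := M.uC_natural e f
      have h4 : (M.uC e m).inv ≫ T C e ⊴ₗ f = e ⊴ₗ f ≫ (M.uC e m').inv := by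
        rw [Iso.inv_comp_eq, ← reassoc_of% h3, Iso.hom_inv_id, Category.comp_id]
      change T C e ⊴ₗ F.map f ≫ (M'.uC e (F.obj m')).hom ≫ p.μₗ e m' ≫ F.map (M.uC e m').inv =
        ((M'.uC e (F.obj m)).hom ≫ p.μₗ e m ≫ F.map (M.uC e m).inv) ≫ F.map (T C e ⊴ₗ f)
      rw [reassoc_of% h, reassoc_of% h2, ← F.map_comp, ← h4]
      simp)

lemma vIso_app (p : F.LeftLinear E) (e : E) (m : M.carrier) : (vIso p e).hom.app m =
    (M'.uC e (F.obj m)).hom ≫ p.μₗ e m ≫ F.map (M.uC e m).inv := rfl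

lemma vIso_left (p : F.LeftLinear E) (e : E) : (vIso p e).hom ∈
    leftNat k (leftLinearComp p (M'.actLE (T C e))) (leftLinearComp (M.actLE (T C e)) p) :=
  fun e' m => by
  have h := M'.actLE_uC_linear e e' (F.obj m)
  have h2 := M.actLE_uC_linear e e' m
  have h3 := leftLinear_swap p e' e m
  have h4 := M'.uC_natural e (p.μₗ e' m)
  have h5 := p.μₗ_naturality_right e' (M.uC e m).inv
  have h6 : e' ⊴ₗ (M.uC e m).inv ≫ (M.actLE (T C e)).μₗ e' m =
      swap e' e m ≫ (M.uC e (e' ⊙ₗ m)).inv := by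
    rw [Iso.eq_comp_inv, Category.assoc, h2, ← MonoidalLeftAction.actionHomRight_comp_assoc,
      Iso.inv_hom_id]
    simp
  change e' ⊴ₗ ((M'.uC e (F.obj m)).hom ≫ p.μₗ e m ≫ F.map (M.uC e m).inv) ≫
      p.μₗ e' (T C e ⊙ₗ m) ≫ F.map ((M.actLE (T C e)).μₗ e' m) =
    ((M'.actLE (T C e)).μₗ e' (F.obj m) ≫ T C e ⊴ₗ p.μₗ e' m) ≫
      (M'.uC e (F.obj (e' ⊙ₗ m))).hom ≫ p.μₗ e (e' ⊙ₗ m) ≫ F.map (M.uC e (e' ⊙ₗ m)).inv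
  simp only [MonoidalLeftAction.actionHomRight_comp, Category.assoc]
  rw [reassoc_of% h5, ← F.map_comp, h6, F.map_comp, reassoc_of% h3, reassoc_of% h4, reassoc_of% h]

lemma vIso_right (p : F.LeftLinear E) (q : F.RightLinear D)
    (h : ∀ (e : E) (m : M.carrier),
      q.μᵣ m (T D e) ≫ F.map (M.uD e m).hom = (M'.uD e (F.obj m)).hom ≫ p.μₗ e m)
    (e : E) : (vIso p e).hom ∈
    rightNat k (rightLinearComp q (M'.actLD (T C e))) (rightLinearComp (M.actLD (T C e)) q) :=
  fun m d => by
  have h1 := bimodule_of_uD p q h e m d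
  have h2 := M.midE_uC e m d
  have h3 := M'.midE_uC e (F.obj m) d
  have h4 := q.μᵣ_naturality_left (M.uC e m).inv d
  have h5 := M'.uC_natural e (q.μᵣ m d)
  have h6 : (M.uC e m).inv ⊵ᵣ d ≫ (M.mid (T C e) m d).hom =
      M.midE e m d ≫ (M.uC e (m ⊙ᵣ d)).inv := by
    rw [Iso.eq_comp_inv, Category.assoc, ← h2, ← MonoidalRightAction.comp_actionHomLeft_assoc,
      Iso.inv_hom_id]
    simp
  change ((M'.uC e (F.obj m)).hom ≫ p.μₗ e m ≫ F.map (M.uC e m).inv) ⊵ᵣ d ≫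
      q.μᵣ (T C e ⊙ₗ m) d ≫ F.map (M.mid (T C e) m d).hom =
    ((M'.mid (T C e) (F.obj m) d).hom ≫ T C e ⊴ₗ q.μᵣ m d) ≫
      (M'.uC e (F.obj (m ⊙ᵣ d))).hom ≫ p.μₗ e (m ⊙ᵣ d) ≫ F.map (M.uC e (m ⊙ᵣ d)).inv
  simp only [MonoidalRightAction.comp_actionHomLeft, Category.assoc]
  rw [reassoc_of% h4, ← F.map_comp, h6, F.map_comp, reassoc_of% h1, reassoc_of% h3, reassoc_of% h5]

end FunLemmas

end BMod
section Whisker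

variable (k : Type*) [Field k] {A : Type u} [Category.{v} A] [Preadditive A]
  [Linear k A] [MonoidalCategory A]
  {M : Type uC} [Category.{vC} M]
  {M' : Type uM} [Category.{vM} M'] [Preadditive M'] [Linear k M']
  {M'' : Type uD} [Category.{vD} M''] [Preadditive M''] [Linear k M'']

lemma leftNat_whiskerRight [MonoidalLeftAction A M] [MonoidalLeftAction A M']
    [MonoidalLeftAction A M''] [LinearLeftAction k A M'] [LinearLeftAction k A M'']
    {F G : M ⥤ M'} {H : M' ⥤ M''} {p : F.LeftLinear A} {q : G.LeftLinear A}
    (r : H.LeftLinear A) {f : F ⟶ G} (hf : f ∈ leftNat k p q) :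
    Functor.whiskerRight f H ∈ leftNat k (leftLinearComp p r) (leftLinearComp q r) := fun a m => by
  have h := congrArg H.map (hf a m)
  simp only [Functor.map_comp] at h
  have h2 := r.μₗ_naturality_right a (f.app m)
  change a ⊴ₗ H.map (f.app m) ≫ r.μₗ a (G.obj m) ≫ H.map (q.μₗ a m) =
    (r.μₗ a (F.obj m) ≫ H.map (p.μₗ a m)) ≫ H.map (f.app (a ⊙ₗ m))
  rw [reassoc_of% h2, h, Category.assoc]

lemma leftNat_whiskerLeft [MonoidalLeftAction A M] [MonoidalLeftAction A M']
    [MonoidalLeftAction A M''] [LinearLeftAction k A M'']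
    {F : M ⥤ M'} {H K : M' ⥤ M''} (p : F.LeftLinear A) {q : H.LeftLinear A} {r : K.LeftLinear A}
    {f : H ⟶ K} (hf : f ∈ leftNat k q r) :
    Functor.whiskerLeft F f ∈ leftNat k (leftLinearComp p q) (leftLinearComp p r) := fun a m => by
  have h := hf a (F.obj m)
  have h2 := f.naturality (p.μₗ a m)
  change a ⊴ₗ f.app (F.obj m) ≫ r.μₗ a (F.obj m) ≫ K.map (p.μₗ a m) =
    (q.μₗ a (F.obj m) ≫ H.map (p.μₗ a m)) ≫ f.app (F.obj (a ⊙ₗ m))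
  rw [reassoc_of% h, Category.assoc, h2]

lemma rightNat_whiskerRight [MonoidalRightAction A M] [MonoidalRightAction A M']
    [MonoidalRightAction A M''] [LinearRightAction k A M'] [LinearRightAction k A M'']
    {F G : M ⥤ M'} {H : M' ⥤ M''} {p : F.RightLinear A} {q : G.RightLinear A}
    (r : H.RightLinear A) {f : F ⟶ G} (hf : f ∈ rightNat k p q) :
    Functor.whiskerRight f H ∈ rightNat k (rightLinearComp p r) (rightLinearComp q r) :=
  fun m a => by
  have h := congrArg H.map (hf m a)
  simp only [Functor.map_comp] at h
  have h2 := r.μᵣ_naturality_left (f.app m) a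
  change H.map (f.app m) ⊵ᵣ a ≫ r.μᵣ (G.obj m) a ≫ H.map (q.μᵣ m a) =
    (r.μᵣ (F.obj m) a ≫ H.map (p.μᵣ m a)) ≫ H.map (f.app (m ⊙ᵣ a))
  rw [reassoc_of% h2, h, Category.assoc]

lemma rightNat_whiskerLeft [MonoidalRightAction A M] [MonoidalRightAction A M']
    [MonoidalRightAction A M''] [LinearRightAction k A M'']
    {F : M ⥤ M'} {H K : M' ⥤ M''} (p : F.RightLinear A) {q : H.RightLinear A}
    {r : K.RightLinear A} {f : H ⟶ K} (hf : f ∈ rightNat k q r) :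
    Functor.whiskerLeft F f ∈ rightNat k (rightLinearComp p q) (rightLinearComp p r) :=
  fun m a => by
  have h := hf (F.obj m) a
  have h2 := f.naturality (p.μᵣ m a)
  change f.app (F.obj m) ⊵ᵣ a ≫ r.μᵣ (F.obj m) a ≫ K.map (p.μᵣ m a) =
    (q.μᵣ (F.obj m) a ≫ H.map (p.μᵣ m a)) ≫ f.app (F.obj (m ⊙ᵣ a))
  rw [reassoc_of% h, Category.assoc, h2]

end Whisker

namespace BMod

section Closed

variable {k : Type*} [Field k]
  {E : Type uE} [Category.{vE} E] [Preadditive E] [Linear k E]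
  [MonoidalCategory E] [SymmetricCategory E]
  {C : Type uC} [Category.{vC} C] [Preadditive C] [Linear k C]
  [MonoidalCategory C] [CentralStructure E C]
  {D : Type uD} [Category.{vD} D] [Preadditive D] [Linear k D]
  [MonoidalCategory D] [CentralStructure E D]

/-- Conditions under which `c ⊙ F ⊙ c' := c ⊙ F(c' ⊙ -)` and
`v_e : T(e) ⊙ F(-) ≅ e ⊙ F(-) ≅ F(e ⊙ -) ≅ F(T(e) ⊙ -)` make the category of `S`-structured
functors a `C`-`C` bimodule over `E`. -/
structure Closed (M M' : BMod k E C D) (S : FunctorSystem k M.carrier M'.carrier) where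
  additive {F : M.carrier ⥤ M'.carrier} : S.Str F → F.Additive
  linear {F : M.carrier ⥤ M'.carrier} : S.Str F → F.Linear k
  sE {F : M.carrier ⥤ M'.carrier} : S.Str F → F.LeftLinear E
  hom_le {F G : M.carrier ⥤ M'.carrier} {p : S.Str F} {q : S.Str G} {f : F ⟶ G} :
    f ∈ S.hom p q → f ∈ leftNat k (sE p) (sE q)
  hom_inv {F G : M.carrier ⥤ M'.carrier} {p : S.Str F} {q : S.Str G} (f : F ≅ G) :
    f.hom ∈ S.hom p q → f.inv ∈ S.hom q p
  /-- the structure on `c ⊙ F(-)` -/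
  post (c : C) {F : M.carrier ⥤ M'.carrier} : S.Str F → S.Str (F ⋙ actL M'.carrier c)
  /-- the structure on `F(c ⊙ -)` -/
  pre (c : C) {F : M.carrier ⥤ M'.carrier} : S.Str F → S.Str (actL M.carrier c ⋙ F)
  sE_post (c : C) {F : M.carrier ⥤ M'.carrier} (p : S.Str F) (e : E) (m : M.carrier) :
    (sE (post c p)).μₗ e m = (M'.actLE c).μₗ e (F.obj m) ≫ c ⊴ₗ (sE p).μₗ e m
  sE_pre (c : C) {F : M.carrier ⥤ M'.carrier} (p : S.Str F) (e : E) (m : M.carrier) :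
    (sE (pre c p)).μₗ e m = (sE p).μₗ e (c ⊙ₗ m) ≫ F.map ((M.actLE c).μₗ e m)
  post_map (c : C) {F G : M.carrier ⥤ M'.carrier} {p : S.Str F} {q : S.Str G} {f : F ⟶ G} :
    f ∈ S.hom p q → Functor.whiskerRight f (actL M'.carrier c) ∈ S.hom (post c p) (post c q)
  pre_map (c : C) {F G : M.carrier ⥤ M'.carrier} {p : S.Str F} {q : S.Str G} {f : F ⟶ G} :
    f ∈ S.hom p q → Functor.whiskerLeft (actL M.carrier c) f ∈ S.hom (pre c p) (pre c q)
  post_hom {c c' : C} (f : c ⟶ c') {F : M.carrier ⥤ M'.carrier} (p : S.Str F) :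
    Functor.whiskerLeft F (actLMap M'.carrier f) ∈ S.hom (post c p) (post c' p)
  pre_hom {c c' : C} (f : c ⟶ c') {F : M.carrier ⥤ M'.carrier} (p : S.Str F) :
    Functor.whiskerRight (actLMap M.carrier f) F ∈ S.hom (pre c p) (pre c' p)
  post_assoc (c c' : C) {F : M.carrier ⥤ M'.carrier} (p : S.Str F) :
    (Functor.isoWhiskerLeft F (actLAssoc M'.carrier c c')).hom ∈
      S.hom (post (c ⊗ c') p) (post c (post c' p))
  pre_assoc (c c' : C) {F : M.carrier ⥤ M'.carrier} (p : S.Str F) :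
    (Functor.isoWhiskerRight (actLAssoc M.carrier c c') F).hom ∈
      S.hom (pre (c ⊗ c') p) (pre c' (pre c p))
  post_unit {F : M.carrier ⥤ M'.carrier} (p : S.Str F) :
    (Functor.isoWhiskerLeft F (actLUnit C M'.carrier)).hom ∈ S.hom (post (𝟙_ C) p) p
  pre_unit {F : M.carrier ⥤ M'.carrier} (p : S.Str F) :
    (Functor.isoWhiskerRight (actLUnit C M.carrier) F).hom ∈ S.hom (pre (𝟙_ C) p) p
  mid (c c' : C) {F : M.carrier ⥤ M'.carrier} (p : S.Str F) :
    𝟙 (actL M.carrier c' ⋙ F ⋙ actL M'.carrier c) ∈ S.hom (pre c' (post c p)) (post c (pre c' p))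
  v (e : E) {F : M.carrier ⥤ M'.carrier} (p : S.Str F) :
    (vIso (sE p) e).hom ∈ S.hom (post (T C e) p) (pre (T C e) p)

variable {M M' : BMod k E C D} {S : FunctorSystem k M.carrier M'.carrier}

namespace Closed

variable (K : Closed M M' S)

/-- The left action `c ⊙ F := c ⊙ F(-)`. -/
@[reducible]
def leftAction : MonoidalLeftAction C S.Obj where
  actionObj c F := ⟨F.functor ⋙ actL M'.carrier c, K.post c F.str⟩
  actionHomLeft f F := ⟨Functor.whiskerLeft F.functor (actLMap M'.carrier f), K.post_hom f F.str⟩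
  actionHomRight c _ _ g := ⟨Functor.whiskerRight g.natTrans (actL M'.carrier c), K.post_map c g.mem⟩
  actionAssocIso c c' F := FunctorSystem.isoMk
    (Functor.isoWhiskerLeft F.functor (actLAssoc M'.carrier c c')) (K.post_assoc c c' F.str)
    (K.hom_inv _ (K.post_assoc c c' F.str))
  actionUnitIso F := FunctorSystem.isoMk
    (Functor.isoWhiskerLeft F.functor (actLUnit C M'.carrier)) (K.post_unit F.str)
    (K.hom_inv _ (K.post_unit F.str))
  actionHom_def _ _ := rfl
  actionHomRight_id c F := FunctorSystem.hom_ext fun m =>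
    MonoidalLeftAction.actionHomRight_id c (F.functor.obj m)
  id_actionHomLeft c F := FunctorSystem.hom_ext fun m =>
    MonoidalLeftAction.id_actionHomLeft c (F.functor.obj m)
  actionHom_comp f₁ f₂ g₁ g₂ := FunctorSystem.hom_ext fun m => by
    have h := MonoidalLeftAction.actionHom_comp f₁ f₂ (g₁.natTrans.app m) (g₂.natTrans.app m)
    simp only [MonoidalLeftAction.actionHom_def] at h
    exact h
  actionAssocIso_hom_naturality f g h := FunctorSystem.hom_ext fun m => by
    have h := MonoidalLeftAction.actionAssocIso_hom_naturality f g (h.natTrans.app m)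
    simp only [MonoidalLeftAction.actionHom_def] at h
    exact h
  actionUnitIso_hom_naturality g := FunctorSystem.hom_ext fun m =>
    MonoidalLeftAction.actionUnitIso_hom_naturality (C := C) (g.natTrans.app m)
  whiskerLeft_actionHomLeft c _ _ f F := FunctorSystem.hom_ext fun m =>
    MonoidalLeftAction.whiskerLeft_actionHomLeft c f (F.functor.obj m)
  whiskerRight_actionHomLeft c f F := FunctorSystem.hom_ext fun m =>
    MonoidalLeftAction.whiskerRight_actionHomLeft c f (F.functor.obj m)
  associator_actionHom c₁ c₂ c₃ F := FunctorSystem.hom_ext fun m =>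
    MonoidalLeftAction.associator_actionHom c₁ c₂ c₃ (F.functor.obj m)
  leftUnitor_actionHom c F := FunctorSystem.hom_ext fun m =>
    MonoidalLeftAction.leftUnitor_actionHom c (F.functor.obj m)
  rightUnitor_actionHom c F := FunctorSystem.hom_ext fun m =>
    MonoidalLeftAction.rightUnitor_actionHom c (F.functor.obj m)

/-- The right action `F ⊙ c := F(c ⊙ -)`. -/
@[reducible]
def rightAction : MonoidalRightAction C S.Obj where
  actionObj F c := ⟨actL M.carrier c ⋙ F.functor, K.pre c F.str⟩
  actionHomLeft g c := ⟨Functor.whiskerLeft (actL M.carrier c) g.natTrans, K.pre_map c g.mem⟩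
  actionHomRight F _ _ f := ⟨Functor.whiskerRight (actLMap M.carrier f) F.functor, K.pre_hom f F.str⟩
  actionAssocIso F c c' := FunctorSystem.isoMk
    (Functor.isoWhiskerRight (actLAssoc M.carrier c c') F.functor) (K.pre_assoc c c' F.str)
    (K.hom_inv _ (K.pre_assoc c c' F.str))
  actionUnitIso F := FunctorSystem.isoMk
    (Functor.isoWhiskerRight (actLUnit C M.carrier) F.functor) (K.pre_unit F.str)
    (K.hom_inv _ (K.pre_unit F.str))
  actionHom_def _ _ := rfl
  actionHomRight_id c F := FunctorSystem.hom_ext fun m => by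
    change F.functor.map (𝟙 c ⊵ₗ m) = 𝟙 (F.functor.obj (c ⊙ₗ m))
    simp
  id_actionHomLeft c F := FunctorSystem.hom_ext fun m => rfl
  actionHom_comp {c c' c'' F F' F''} f₁ f₂ g₁ g₂ := FunctorSystem.hom_ext fun m => by
    have h := f₂.natTrans.naturality (g₁ ⊵ₗ m)
    change (f₁.natTrans.app (c ⊙ₗ m) ≫ f₂.natTrans.app (c ⊙ₗ m)) ≫
        F''.functor.map ((g₁ ≫ g₂) ⊵ₗ m) =
      (f₁.natTrans.app (c ⊙ₗ m) ≫ F'.functor.map (g₁ ⊵ₗ m)) ≫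
        f₂.natTrans.app (c' ⊙ₗ m) ≫ F''.functor.map (g₂ ⊵ₗ m)
    simp only [MonoidalLeftAction.comp_actionHomLeft, Functor.map_comp, Category.assoc]
    rw [reassoc_of% h]
  actionAssocIso_hom_naturality {F₁ F₂ c₁ c₂ c₃ c₄} f g h := FunctorSystem.hom_ext fun m => by
    have h1 := congrArg F₂.functor.map
      (MonoidalLeftAction.actionAssocIso_hom_naturality g h (𝟙 m))
    have h2 := f.natTrans.naturality (αₗ c₁ c₃ m).hom
    simp only [MonoidalLeftAction.actionHom_def, Functor.map_comp,
      MonoidalLeftAction.actionHomRight_id, Category.comp_id, Functor.map_id] at h1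
    change (f.natTrans.app ((c₁ ⊗ c₃) ⊙ₗ m) ≫ F₂.functor.map ((g ⊗ₘ h) ⊵ₗ m)) ≫
        F₂.functor.map (αₗ c₂ c₄ m).hom =
      F₁.functor.map (αₗ c₁ c₃ m).hom ≫ (f.natTrans.app (c₁ ⊙ₗ c₃ ⊙ₗ m) ≫
        F₂.functor.map (g ⊵ₗ (c₃ ⊙ₗ m))) ≫ F₂.functor.map (c₂ ⊴ₗ h ⊵ₗ m)
    simp only [Category.assoc]
    rw [reassoc_of% h2, h1]
  actionUnitIso_hom_naturality g := FunctorSystem.hom_ext fun m => by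
    exact g.natTrans.naturality (λₗ[C] m).hom
  actionHomRight_whiskerRight {c' c''} f c F := FunctorSystem.hom_ext fun m => by
    have h := congrArg F.functor.map (MonoidalLeftAction.whiskerRight_actionHomLeft c f m)
    simp only [Functor.map_comp] at h
    exact h
  whiskerRight_actionHomLeft c {c' c''} f F := FunctorSystem.hom_ext fun m => by
    have h := congrArg F.functor.map (MonoidalLeftAction.whiskerLeft_actionHomLeft c f m)
    simp only [Functor.map_comp] at h
    exact h
  actionHom_associator c₁ c₂ c₃ F := FunctorSystem.hom_ext fun m => by
    have h := congrArg F.functor.map (MonoidalLeftAction.associator_actionHom c₁ c₂ c₃ m)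
    simp only [Functor.map_comp] at h
    exact h
  actionHom_leftUnitor c F := FunctorSystem.hom_ext fun m => by
    have h := congrArg F.functor.map (MonoidalLeftAction.leftUnitor_actionHom c m)
    simp only [Functor.map_comp] at h
    exact h
  actionHom_rightUnitor c F := FunctorSystem.hom_ext fun m => by
    have h := congrArg F.functor.map (MonoidalLeftAction.rightUnitor_actionHom c m)
    simp only [Functor.map_comp] at h
    exact h

lemma leftAction_linear :
    letI := K.leftAction
    LinearLeftAction k C S.Obj :=
  letI := K.leftAction
  { right_add := fun c _ _ f g => FunctorSystem.hom_ext fun m =>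
      LinearLeftAction.right_add (k := k) c (f.natTrans.app m) (g.natTrans.app m)
    right_smul := fun c _ _ r f => FunctorSystem.hom_ext fun m =>
      LinearLeftAction.right_smul c r (f.natTrans.app m)
    left_add := fun f g F => FunctorSystem.hom_ext fun m =>
      LinearLeftAction.left_add (k := k) f g (F.functor.obj m)
    left_smul := fun r f F => FunctorSystem.hom_ext fun m =>
      LinearLeftAction.left_smul r f (F.functor.obj m) }

lemma rightAction_linear :
    letI := K.rightAction
    LinearRightAction k C S.Obj :=
  letI := K.rightAction
  { left_add := fun f g c => rfl
    left_smul := fun r f c => rfl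
    right_add := fun F c c' f g => FunctorSystem.hom_ext fun m => by
      have := K.additive F.str
      change F.functor.map ((f + g) ⊵ₗ m) = F.functor.map (f ⊵ₗ m) + F.functor.map (g ⊵ₗ m)
      rw [LinearLeftAction.left_add (k := k), F.functor.map_add]
    right_smul := fun F c c' r f => FunctorSystem.hom_ext fun m => by
      have := K.linear F.str
      change F.functor.map ((r • f) ⊵ₗ m) = r • F.functor.map (f ⊵ₗ m)
      rw [LinearLeftAction.left_smul, F.functor.map_smul] }

/-- The central bimodule structure on the category of structured functors. -/
@[reducible]
def central :
    letI := K.leftAction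
    letI := K.rightAction
    CentralBimodule E C C S.Obj :=
  letI := K.leftAction
  letI := K.rightAction
  { mid := fun c F c' => FunctorSystem.isoMk (Iso.refl _) (K.mid c c' F.str)
      (K.hom_inv (Iso.refl _) (K.mid c c' F.str))
    mid_natural_left := fun f F d => FunctorSystem.hom_ext fun m =>
      (Category.comp_id _).trans (Category.id_comp _).symm
    mid_natural := fun c _ _ f d => FunctorSystem.hom_ext fun m =>
      (Category.comp_id _).trans (Category.id_comp _).symm
    mid_natural_right := fun c F _ _ f => FunctorSystem.hom_ext fun m =>
      (Category.comp_id _).trans (Category.id_comp _).symm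
    mid_tensor_left := fun c c' F d => FunctorSystem.hom_ext fun m => by
      change 𝟙 _ ≫ (αₗ c c' (F.functor.obj (d ⊙ₗ m))).hom =
        (αₗ c c' (F.functor.obj (d ⊙ₗ m))).hom ≫ 𝟙 _ ≫ c ⊴ₗ 𝟙 _
      simp
    mid_tensor_right := fun c F d d' => FunctorSystem.hom_ext fun m => by
      change 𝟙 _ ≫ c ⊴ₗ F.functor.map (αₗ d d' m).hom =
        c ⊴ₗ F.functor.map (αₗ d d' m).hom ≫ 𝟙 _ ≫ 𝟙 _
      simp
    mid_unit_left := fun F d => FunctorSystem.hom_ext fun m => Category.id_comp _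
    mid_unit_right := fun c F => FunctorSystem.hom_ext fun m => Category.id_comp _
    v := fun e F => FunctorSystem.isoMk (vIso (K.sE F.str) e) (K.v e F.str)
      (K.hom_inv _ (K.v e F.str))
    v_natural_left := fun {e e'} f F => FunctorSystem.hom_ext fun m => by
      have h := M'.uC_natural_left f (F.functor.obj m)
      have h2 := (K.sE F.str).μₗ_naturality_left f m
      have h3 := M.uC_natural_left f m
      have h4 : f ⊵ₗ m ≫ (M.uC e' m).inv = (M.uC e m).inv ≫ Tmap C f ⊵ₗ m := by
        rw [Iso.eq_inv_comp, ← reassoc_of% h3, Iso.hom_inv_id, Category.comp_id]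
      change Tmap C f ⊵ₗ F.functor.obj m ≫ (M'.uC e' (F.functor.obj m)).hom ≫
          (K.sE F.str).μₗ e' m ≫ F.functor.map (M.uC e' m).inv =
        ((M'.uC e (F.functor.obj m)).hom ≫ (K.sE F.str).μₗ e m ≫
          F.functor.map (M.uC e m).inv) ≫ F.functor.map (Tmap C f ⊵ₗ m)
      rw [reassoc_of% h, reassoc_of% h2, ← F.functor.map_comp, h4, F.functor.map_comp]
      simp only [Category.assoc]
    v_natural := fun e {F G} f => FunctorSystem.hom_ext fun m => by
      have h := M'.uC_natural e (f.natTrans.app m)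
      have h2 := K.hom_le f.mem e m
      have h3 := f.natTrans.naturality (M.uC e m).inv
      change T C e ⊴ₗ f.natTrans.app m ≫ (M'.uC e (G.functor.obj m)).hom ≫
          (K.sE G.str).μₗ e m ≫ G.functor.map (M.uC e m).inv =
        ((M'.uC e (F.functor.obj m)).hom ≫ (K.sE F.str).μₗ e m ≫
          F.functor.map (M.uC e m).inv) ≫ f.natTrans.app (T C e ⊙ₗ m)
      rw [reassoc_of% h, reassoc_of% h2]
      simp only [Category.assoc, h3]
    v_tensor := fun e e' F => FunctorSystem.hom_ext fun m => by
      change Tμ C e e' ⊵ₗ F.functor.obj m ≫ (M'.uC (e ⊗ e') (F.functor.obj m)).hom ≫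
          (K.sE F.str).μₗ (e ⊗ e') m ≫ F.functor.map (M.uC (e ⊗ e') m).inv =
        (αₗ (T C e) (T C e') (F.functor.obj m)).hom ≫ T C e ⊴ₗ (
          (M'.uC e' (F.functor.obj m)).hom ≫ (K.sE F.str).μₗ e' m ≫
            F.functor.map (M.uC e' m).inv) ≫ 𝟙 _ ≫
          ((M'.uC e (F.functor.obj (T C e' ⊙ₗ m))).hom ≫ (K.sE F.str).μₗ e (T C e' ⊙ₗ m) ≫
            F.functor.map (M.uC e (T C e' ⊙ₗ m)).inv) ≫
          F.functor.map (αₗ (T C e) (T C e') m).inv ≫ F.functor.map (Tμ C e e' ⊵ₗ m)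
      have h := M'.uC_tensor e e' (F.functor.obj m)
      have h2 := (K.sE F.str).μₗ_associativity e e' m
      have h3 := M.uC_tensor e e' m
      have h4 := M'.uC_natural e ((K.sE F.str).μₗ e' m)
      have h5 := M'.uC_natural e (F.functor.map (M.uC e' m).inv)
      have h6 := (K.sE F.str).μₗ_naturality_right e (M.uC e' m).inv
      have h7 : (αₗ e e' m).hom ≫ e ⊴ₗ (M.uC e' m).inv ≫ (M.uC e (T C e' ⊙ₗ m)).inv ≫
          (αₗ (T C e) (T C e') m).inv ≫ Tμ C e e' ⊵ₗ m = (M.uC (e ⊗ e') m).inv := by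
        have h8 := M.uC_natural e (M.uC e' m).inv
        have h9 : e ⊴ₗ (M.uC e' m).inv ≫ (M.uC e (T C e' ⊙ₗ m)).inv =
            (M.uC e (e' ⊙ₗ m)).inv ≫ T C e ⊴ₗ (M.uC e' m).inv := by
          rw [Iso.eq_inv_comp, ← reassoc_of% h8, Iso.hom_inv_id, Category.comp_id]
        have h10 : Tμ C e e' ⊵ₗ m = (αₗ (T C e) (T C e') m).hom ≫ T C e ⊴ₗ (M.uC e' m).hom ≫
            (M.uC e (e' ⊙ₗ m)).hom ≫ (αₗ e e' m).inv ≫ (M.uC (e ⊗ e') m).inv := by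
          rw [← reassoc_of% h3]; simp
        rw [reassoc_of% h9, h10]
        simp
      have h11 := congrArg F.functor.map h7
      simp only [Functor.map_comp] at h11
      rw [← h11, reassoc_of% h2]
      simp only [Category.assoc, Category.id_comp, MonoidalLeftAction.actionHomRight_comp]
      rw [reassoc_of% h5, reassoc_of% h4, reassoc_of% h6, ← reassoc_of% h]
    v_unit := fun F => FunctorSystem.hom_ext fun m => by
      change Tε C ⊵ₗ F.functor.obj m ≫ (M'.uC (𝟙_ E) (F.functor.obj m)).hom ≫
          (K.sE F.str).μₗ (𝟙_ E) m ≫ F.functor.map (M.uC (𝟙_ E) m).inv =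
        (λₗ[C] (F.functor.obj m)).hom ≫ F.functor.map (λₗ[C] m).inv ≫
          F.functor.map (Tε C ⊵ₗ m)
      have h := M'.uC_unit (F.functor.obj m)
      have h2 := (K.sE F.str).μₗ_unitality m
      have h3 := M.uC_unit m
      have h4 : (M.uC (𝟙_ E) m).inv = (λₗ[E] m).hom ≫ (λₗ[C] m).inv ≫ Tε C ⊵ₗ m := by
        have h5 : Tε C ⊵ₗ m = (λₗ[C] m).hom ≫ (λₗ[E] m).inv ≫ (M.uC (𝟙_ E) m).inv := by
          rw [← reassoc_of% h3]; simp
        rw [h5]; simp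
      rw [h4, F.functor.map_comp, ← reassoc_of% h2, reassoc_of% h, F.functor.map_comp]
    v_left := fun e c F => FunctorSystem.hom_ext fun m => by
      have h := M'.actLE_uC c e (F.functor.obj m)
      change (z C e c).hom ⊵ₗ F.functor.obj m ≫ (αₗ c (T C e) (F.functor.obj m)).hom ≫
          c ⊴ₗ ((M'.uC e (F.functor.obj m)).hom ≫ (K.sE F.str).μₗ e m ≫
            F.functor.map (M.uC e m).inv) =
        (αₗ (T C e) c (F.functor.obj m)).hom ≫ ((M'.uC e (c ⊙ₗ F.functor.obj m)).hom ≫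
          (K.sE (K.post c F.str)).μₗ e m ≫ c ⊴ₗ F.functor.map (M.uC e m).inv) ≫ 𝟙 _
      rw [K.sE_post]
      simp only [Category.assoc, Category.comp_id, MonoidalLeftAction.actionHomRight_comp]
      rw [reassoc_of% h, Iso.hom_inv_id_assoc]
    v_right := fun e F d => FunctorSystem.hom_ext fun m => by
      have h := congrArg F.functor.map (M.actLE_uC d e m)
      change 𝟙 _ ≫ (M'.uC e (F.functor.obj (d ⊙ₗ m))).hom ≫
          (K.sE (K.pre d F.str)).μₗ e m ≫ F.functor.map (d ⊴ₗ (M.uC e m).inv) =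
        ((M'.uC e (F.functor.obj (d ⊙ₗ m))).hom ≫ (K.sE F.str).μₗ e (d ⊙ₗ m) ≫
          F.functor.map (M.uC e (d ⊙ₗ m)).inv) ≫ F.functor.map (αₗ (T C e) d m).inv ≫
          F.functor.map ((z C e d).hom ⊵ₗ m) ≫ F.functor.map (αₗ d (T C e) m).hom
      rw [K.sE_pre, actLE_eq]
      simp only [Category.assoc, Category.id_comp, Functor.map_comp]
      rw [← F.functor.map_comp, ← MonoidalLeftAction.actionHomRight_comp]
      simp }

/-- The category of structured functors as a `C`-`C` bimodule over `E`. -/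
abbrev toBMod [CentralStructure.IsLinear k E C] : BMod k E C C :=
  letI := K.leftAction
  letI := K.rightAction
  letI := K.leftAction_linear
  letI := K.rightAction_linear
  K.central.toBMod k

end Closed

end Closed

end BMod
namespace BMod

section Instances

variable {k : Type*} [Field k]
  {E : Type uE} [Category.{vE} E] [Preadditive E] [Linear k E]
  [MonoidalCategory E] [SymmetricCategory E]
  {C : Type uC} [Category.{vC} C] [Preadditive C] [Linear k C]
  [MonoidalCategory C] [CentralStructure E C]
  {D : Type uD} [Category.{vD} D] [Preadditive D] [Linear k D]
  [MonoidalCategory D] [CentralStructure E D]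

/-- The left `E`-module structure on `c ⊙ F(-)`. -/
@[reducible]
def postE (M M' : BMod k E C D) (c : C) {F : M.carrier ⥤ M'.carrier} (p : EStr k E F) :
    EStr k E (F ⋙ actL M'.carrier c) where
  additive := by
    have := p.additive
    have := actL_additive k C (M := M'.carrier) c
    infer_instance
  linear := by
    have := p.additive
    have := actL_additive k C (M := M'.carrier) c
    have := p.linear
    have := actL_linear k C (M := M'.carrier) c
    infer_instance
  sE := leftLinearComp p.sE (M'.actLE c)

/-- The left `E`-module structure on `F(c ⊙ -)`. -/
@[reducible]
def preE (M M' : BMod k E C D) (c : C) {F : M.carrier ⥤ M'.carrier} (p : EStr k E F) :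
    EStr k E (actL M.carrier c ⋙ F) where
  additive := by
    have := p.additive
    have := actL_additive k C (M := M.carrier) c
    infer_instance
  linear := by
    have := p.additive
    have := actL_additive k C (M := M.carrier) c
    have := p.linear
    have := actL_linear k C (M := M.carrier) c
    infer_instance
  sE := leftLinearComp (M.actLE c) p.sE

/-- `Fun_E(M, M')` satisfies the conditions for being a bimodule. -/
@[reducible]
def closedE (M M' : BMod k E C D) : Closed M M' (EFunSystem k E M.carrier M'.carrier) where
  additive p := p.additive
  linear p := p.linear
  sE p := p.sE
  hom_le h := h
  hom_inv f h := leftNat_inv k f h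
  post c _ p := postE M M' c p
  pre c _ p := preE M M' c p
  sE_post c _ p e m := rfl
  sE_pre c _ p e m := rfl
  post_map c _ _ _ _ _ h := leftNat_whiskerRight k (M'.actLE c) h
  pre_map c _ _ _ _ _ h := leftNat_whiskerLeft k (M.actLE c) h
  post_hom f _ p := leftNat_whiskerLeft k p.sE (M'.actLE_natural f)
  pre_hom f _ p := leftNat_whiskerRight k p.sE (M.actLE_natural f)
  post_assoc c c' F p := fun e m => by
    have h := M'.actLE_assoc c c' e (F.obj m)
    change e ⊴ₗ (αₗ c c' (F.obj m)).hom ≫ (M'.actLE c).μₗ e (c' ⊙ₗ F.obj m) ≫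
        c ⊴ₗ (M'.actLE c').μₗ e (F.obj m) =
      (M'.actLE (c ⊗ c')).μₗ e (F.obj m) ≫ (αₗ c c' (e ⊙ₗ F.obj m)).hom at h
    change e ⊴ₗ (αₗ c c' (F.obj m)).hom ≫ (M'.actLE c).μₗ e (c' ⊙ₗ F.obj m) ≫
        c ⊴ₗ ((M'.actLE c').μₗ e (F.obj m) ≫ c' ⊴ₗ p.sE.μₗ e m) =
      ((M'.actLE (c ⊗ c')).μₗ e (F.obj m) ≫ (c ⊗ c') ⊴ₗ p.sE.μₗ e m) ≫
        (αₗ c c' (F.obj (e ⊙ₗ m))).hom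
    simp only [MonoidalLeftAction.actionHomRight_comp, MonoidalLeftAction.tensor_actionHomRight,
      Category.assoc, Iso.inv_hom_id, Category.comp_id]
    rw [reassoc_of% h]
  pre_assoc c c' F p := fun e m => by
    have h := M.actLE_assoc c c' e m
    change e ⊴ₗ (αₗ c c' m).hom ≫ (M.actLE c).μₗ e (c' ⊙ₗ m) ≫ c ⊴ₗ (M.actLE c').μₗ e m =
      (M.actLE (c ⊗ c')).μₗ e m ≫ (αₗ c c' (e ⊙ₗ m)).hom at h
    have h1 := congrArg F.map h
    have h2 := p.sE.μₗ_naturality_right e (αₗ c c' m).hom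
    simp only [Functor.map_comp] at h1
    change e ⊴ₗ F.map (αₗ c c' m).hom ≫ (p.sE.μₗ e (c ⊙ₗ c' ⊙ₗ m) ≫
        F.map ((M.actLE c).μₗ e (c' ⊙ₗ m))) ≫ F.map (c ⊴ₗ (M.actLE c').μₗ e m) =
      (p.sE.μₗ e ((c ⊗ c') ⊙ₗ m) ≫ F.map ((M.actLE (c ⊗ c')).μₗ e m)) ≫
        F.map (αₗ c c' (e ⊙ₗ m)).hom
    simp only [Category.assoc]
    rw [reassoc_of% h2, h1]
  post_unit {F} p := fun e m => by
    have h := M'.actLE_unit e (F.obj m)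
    change e ⊴ₗ (λₗ[C] (F.obj m)).hom ≫ p.sE.μₗ e m =
      ((M'.actLE (𝟙_ C)).μₗ e (F.obj m) ≫ 𝟙_ C ⊴ₗ p.sE.μₗ e m) ≫ (λₗ[C] (F.obj (e ⊙ₗ m))).hom
    simp only [MonoidalLeftAction.unit_actionHomRight, Category.assoc, Iso.inv_hom_id,
      Category.comp_id]
    rw [reassoc_of% h]
  pre_unit {F} p := fun e m => by
    have h := congrArg F.map (M.actLE_unit e m)
    have h2 := p.sE.μₗ_naturality_right e (λₗ[C] m).hom
    simp only [Functor.map_comp] at h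
    change e ⊴ₗ F.map (λₗ[C] m).hom ≫ p.sE.μₗ e m =
      (p.sE.μₗ e (𝟙_ C ⊙ₗ m) ≫ F.map ((M.actLE (𝟙_ C)).μₗ e m)) ≫ F.map (λₗ[C] (e ⊙ₗ m)).hom
    rw [h2, h, Category.assoc]
  mid c c' F p := fun e m => by
    change e ⊴ₗ 𝟙 _ ≫ (M'.actLE c).μₗ e (F.obj (c' ⊙ₗ m)) ≫
        c ⊴ₗ (p.sE.μₗ e (c' ⊙ₗ m) ≫ F.map ((M.actLE c').μₗ e m)) =
      (((M'.actLE c).μₗ e (F.obj (c' ⊙ₗ m)) ≫ c ⊴ₗ p.sE.μₗ e (c' ⊙ₗ m)) ≫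
        c ⊴ₗ F.map ((M.actLE c').μₗ e m)) ≫ 𝟙 _
    simp only [MonoidalLeftAction.actionHomRight_comp, MonoidalLeftAction.actionHomRight_id,
      Category.assoc, Category.comp_id, Category.id_comp]
  v e _ p := vIso_left p.sE e

/-- The structure of a 1-morphism of right `D`-modules over `E` on `c ⊙ F(-)`. -/
@[reducible]
def postR (M M' : BMod k E C D) (c : C) {F : M.carrier ⥤ M'.carrier} (p : RStr M M' F) :
    RStr M M' (F ⋙ actL M'.carrier c) :=
  have h : ∀ (e : E) (m : M.carrier),
      (rightLinearComp p.tD (M'.actLD c)).μᵣ m (T D e) ≫ (F ⋙ actL M'.carrier c).map (M.uD e m).hom =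
        (M'.uD e (c ⊙ₗ F.obj m)).hom ≫ (leftLinearComp p.sE (M'.actLE c)).μₗ e m := fun e m => by
    have h1 := congrArg (c ⊴ₗ ·) (p.uD_comp e m)
    have h2 := M'.actLE_uD c e (F.obj m)
    simp only [MonoidalLeftAction.actionHomRight_comp] at h1
    change ((M'.mid c (F.obj m) (T D e)).hom ≫ c ⊴ₗ p.tD.μᵣ m (T D e)) ≫
        c ⊴ₗ F.map (M.uD e m).hom =
      (M'.uD e (c ⊙ₗ F.obj m)).hom ≫ (M'.actLE c).μₗ e (F.obj m) ≫ c ⊴ₗ p.sE.μₗ e m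
    rw [Category.assoc, h1, reassoc_of% h2]
  { postE M M' c p.toEStr with
    tD := rightLinearComp p.tD (M'.actLD c)
    bimodule := bimodule_of_uD _ _ h
    uD_comp := h }

/-- The structure of a 1-morphism of right `D`-modules over `E` on `F(c ⊙ -)`. -/
@[reducible]
def preR (M M' : BMod k E C D) (c : C) {F : M.carrier ⥤ M'.carrier} (p : RStr M M' F) :
    RStr M M' (actL M.carrier c ⋙ F) :=
  have h : ∀ (e : E) (m : M.carrier),
      (rightLinearComp (M.actLD c) p.tD).μᵣ m (T D e) ≫ (actL M.carrier c ⋙ F).map (M.uD e m).hom =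
        (M'.uD e (F.obj (c ⊙ₗ m))).hom ≫ (leftLinearComp (M.actLE c) p.sE).μₗ e m := fun e m => by
    have h1 := p.uD_comp e (c ⊙ₗ m)
    have h2 := congrArg F.map (M.actLE_uD c e m)
    simp only [Functor.map_comp] at h2
    change (p.tD.μᵣ (c ⊙ₗ m) (T D e) ≫ F.map (M.mid c m (T D e)).hom) ≫
        F.map (c ⊴ₗ (M.uD e m).hom) =
      (M'.uD e (F.obj (c ⊙ₗ m))).hom ≫ p.sE.μₗ e (c ⊙ₗ m) ≫ F.map ((M.actLE c).μₗ e m)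
    rw [Category.assoc, ← h2, reassoc_of% h1]
  { preE M M' c p.toEStr with
    tD := rightLinearComp (M.actLD c) p.tD
    bimodule := bimodule_of_uD _ _ h
    uD_comp := h }

/-- `Fun_{D^rev}(M, M')` satisfies the conditions for being a bimodule. -/
@[reducible]
def closedR (M M' : BMod k E C D) : Closed M M' (rightFunSystem M M') where
  additive p := p.additive
  linear p := p.linear
  sE p := p.sE
  hom_le h := h.1
  hom_inv f h := ⟨leftNat_inv k f h.1, rightNat_inv k f h.2⟩
  post c _ p := postR M M' c p
  pre c _ p := preR M M' c p
  sE_post c _ p e m := rfl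
  sE_pre c _ p e m := rfl
  post_map c _ _ _ _ _ h :=
    ⟨leftNat_whiskerRight k (M'.actLE c) h.1, rightNat_whiskerRight k (M'.actLD c) h.2⟩
  pre_map c _ _ _ _ _ h :=
    ⟨leftNat_whiskerLeft k (M.actLE c) h.1, rightNat_whiskerLeft k (M.actLD c) h.2⟩
  post_hom f _ p := ⟨leftNat_whiskerLeft k p.sE (M'.actLE_natural f),
    rightNat_whiskerLeft k p.tD (M'.actLD_natural f)⟩
  pre_hom f _ p := ⟨leftNat_whiskerRight k p.sE (M.actLE_natural f),
    rightNat_whiskerRight k p.tD (M.actLD_natural f)⟩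
  post_assoc c c' F p := ⟨(closedE M M').post_assoc c c' p.toEStr, fun m d => by
    have h := M'.mid_tensor_left c c' (F.obj m) d
    change (αₗ c c' (F.obj m)).hom ⊵ᵣ d ≫ (M'.mid c (c' ⊙ₗ F.obj m) d).hom ≫
        c ⊴ₗ ((M'.mid c' (F.obj m) d).hom ≫ c' ⊴ₗ p.tD.μᵣ m d) =
      ((M'.mid (c ⊗ c') (F.obj m) d).hom ≫ (c ⊗ c') ⊴ₗ p.tD.μᵣ m d) ≫
        (αₗ c c' (F.obj (m ⊙ᵣ d))).hom
    simp only [MonoidalLeftAction.actionHomRight_comp, MonoidalLeftAction.tensor_actionHomRight,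
      Category.assoc, Iso.inv_hom_id, Category.comp_id]
    rw [reassoc_of% h]⟩
  pre_assoc c c' F p := ⟨(closedE M M').pre_assoc c c' p.toEStr, fun m d => by
    have h1 := congrArg F.map (M.mid_tensor_left c c' m d)
    have h2 := p.tD.μᵣ_naturality_left (αₗ c c' m).hom d
    simp only [Functor.map_comp] at h1
    change F.map (αₗ c c' m).hom ⊵ᵣ d ≫ (p.tD.μᵣ (c ⊙ₗ c' ⊙ₗ m) d ≫
        F.map (M.mid c (c' ⊙ₗ m) d).hom) ≫ F.map (c ⊴ₗ (M.mid c' m d).hom) =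
      (p.tD.μᵣ ((c ⊗ c') ⊙ₗ m) d ≫ F.map (M.mid (c ⊗ c') m d).hom) ≫
        F.map (αₗ c c' (m ⊙ᵣ d)).hom
    simp only [Category.assoc]
    rw [reassoc_of% h2, h1]⟩
  post_unit {F} p := ⟨(closedE M M').post_unit p.toEStr, fun m d => by
    have h := M'.mid_unit_left (F.obj m) d
    change (λₗ[C] (F.obj m)).hom ⊵ᵣ d ≫ p.tD.μᵣ m d =
      ((M'.mid (𝟙_ C) (F.obj m) d).hom ≫ 𝟙_ C ⊴ₗ p.tD.μᵣ m d) ≫ (λₗ[C] (F.obj (m ⊙ᵣ d))).hom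
    simp only [MonoidalLeftAction.unit_actionHomRight, Category.assoc, Iso.inv_hom_id,
      Category.comp_id]
    rw [reassoc_of% h]⟩
  pre_unit {F} p := ⟨(closedE M M').pre_unit p.toEStr, fun m d => by
    have h := congrArg F.map (M.mid_unit_left m d)
    have h2 := p.tD.μᵣ_naturality_left (λₗ[C] m).hom d
    simp only [Functor.map_comp] at h
    change F.map (λₗ[C] m).hom ⊵ᵣ d ≫ p.tD.μᵣ m d =
      (p.tD.μᵣ (𝟙_ C ⊙ₗ m) d ≫ F.map (M.mid (𝟙_ C) m d).hom) ≫ F.map (λₗ[C] (m ⊙ᵣ d)).hom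
    rw [h2, ← h, Category.assoc]⟩
  mid c c' F p := ⟨(closedE M M').mid c c' p.toEStr, fun m d => by
    change 𝟙 _ ⊵ᵣ d ≫ (M'.mid c (F.obj (c' ⊙ₗ m)) d).hom ≫
        c ⊴ₗ (p.tD.μᵣ (c' ⊙ₗ m) d ≫ F.map (M.mid c' m d).hom) =
      (((M'.mid c (F.obj (c' ⊙ₗ m)) d).hom ≫ c ⊴ₗ p.tD.μᵣ (c' ⊙ₗ m) d) ≫
        c ⊴ₗ F.map (M.mid c' m d).hom) ≫ 𝟙 _
    simp only [MonoidalLeftAction.actionHomRight_comp, MonoidalRightAction.id_actionHomLeft,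
      Category.assoc, Category.comp_id, Category.id_comp]⟩
  v e _ p := ⟨vIso_left p.sE e, vIso_right p.sE p.tD p.uD_comp e⟩

variable [CentralStructure.IsLinear k E C]

/-- `Fun_E(M, M')` as a `C`-`C` bimodule over `E`, with `c ⊙ F ⊙ c' = c ⊙ F(c' ⊙ -)` and
`v_e : T(e) ⊙ F(-) ≅ e ⊙ F(-) ≅ F(e ⊙ -) ≅ F(T(e) ⊙ -)`. -/
abbrev eFunBMod (M M' : BMod k E C D) : BMod k E C C := (closedE M M').toBMod

/-- `Fun_{D^rev}(M, M')` as a `C`-`C` bimodule over `E`, with `c ⊙ F ⊙ c' = c ⊙ F(c' ⊙ -)` and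
`v_e : T(e) ⊙ F(-) ≅ e ⊙ F(-) ≅ F(e ⊙ -) ≅ F(T(e) ⊙ -)`. -/
abbrev rightFunBMod (M M' : BMod k E C D) : BMod k E C C := (closedR M M').toBMod


end Instances

end BMod

end OverSymm

end

noncomputable section

namespace OverSymm

universe v u vE uE vC uC vD uD vM uM

open MonoidalLeftAction (actionHomRight_comp actionHomRight_comp_assoc actionHomRight_hom_inv
  actionHomRight_hom_inv_assoc tensor_actionHomRight action_exchange actionUnitIso_hom_naturality)
open MonoidalRightAction (comp_actionHomLeft comp_actionHomLeft_assoc hom_inv_actionHomLeft_assoc)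

/-! ### Half braidings relative to `E`, and bimodule functors evaluated at the unit -/

section RelativeCenter

variable {E : Type uE} [Category.{vE} E] [MonoidalCategory E] [SymmetricCategory E]
  {C : Type uC} [Category.{vC} C] [MonoidalCategory C] [CentralStructure E C]
  {N : Type uM} [Category.{vM} N]
  {leftAct : MonoidalLeftAction C N} {rightAct : MonoidalRightAction C N}

/-! Both equivalences factor through a relative centre, `RelCenter`.

Let `N` be a `C`-`C` bimodule with isomorphisms `v_e : T(e) ⊙ n ≅ n ⊙ T(e)`. A bimodule functor `G :
C ⥤ N` over `E` is determined by `n = G(𝟙)` and the composites `n ⊙ c ≅ G(c) ≅ c ⊙ n` of its right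
and left module constraints at the unit. These composites form a half braiding on `n`: the tensor
axiom comes from the bimodule axiom `left_r`. The condition over `E`, taken at the unit, where
`z_{e,𝟙}` is just a unit constraint, says that the half braiding at `T(e)` is inverse to `v_e`. So
`G ↦ G(𝟙)` is a functor `evalUnit` to the relative centre. It is faithful because `f_c` is the
conjugate of `c ⊴ₗ f_𝟙` (`left_app`). It is full because this formula always defines a
transformation of left module functors (`extend_l`), which respects the right action exactly when
`f_𝟙` commutes with the half braidings (`right_extend`, `extend_r`). It is essentially surjective
because `c ↦ c ⊙ n` is a left module functor for free, and the half braiding supplies its right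
module structure (`rightIso`).

Now let `N` consist of functors `F : M ⥤ M'`, with `c ⊙ F ⊙ c' = c ⊙ F(c' ⊙ -)`. A half braiding on
`F` is a family `F(c ⊙ m) ≅ c ⊙ F(m)`, the inverse of a left `C`-module structure: the hexagon and
unit axioms are the module functor axioms, and the condition at `T(e)` is compatibility with `uC`
(`leftLinear_uC`). In `Fun_{D^rev}` each component of the half braiding must be right `D`-linear,
which is the bimodule axiom for `C` and `D`. It must also be `E`-linear, but that is automatic
(`lineator_mem_leftNat`): up to `uC`, the `E`-structure of `c ⊙ -` is the half braiding `z_{e,c}`,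
and the `C`-module constraint of `F` is natural with respect to `z_{e,c}`.

If `D = E`, a right `E`-module structure compatible with `uD` is the left one transported along
`uD`, and its compatibility with the `C`-action follows (`bimodule_T`). So the relative centre of
`Fun_E(M, M')` already carries all the data of a 1-morphism. -/

/-- An object of the centre of a central `C`-`C` bimodule relative to `E`: an object `n` with a
half braiding `n ⊙ c ≅ c ⊙ n` which for `c = T(e)` is inverse to `v_e`. -/
structure RelCenter (B : CentralBimodule E C C N) where
  obj : N
  braiding (c : C) : obj ⊙ᵣ c ≅ c ⊙ₗ obj
  braiding_natural {c c' : C} (f : c ⟶ c') :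
    obj ⊴ᵣ f ≫ (braiding c').hom = (braiding c).hom ≫ f ⊵ₗ obj
  braiding_tensor (c c' : C) :
    (braiding (c ⊗ c')).hom ≫ (αₗ c c' obj).hom = (αᵣ obj c c').hom ≫
      (braiding c).hom ⊵ᵣ c' ≫ (B.mid c obj c').hom ≫ c ⊴ₗ (braiding c').hom
  braiding_unit : (braiding (𝟙_ C)).hom ≫ (λₗ obj).hom = (ρᵣ obj).hom
  braiding_central (e : E) : (B.v e obj).hom ≫ (braiding (T C e)).hom = 𝟙 _

namespace RelCenter

variable {B : CentralBimodule E C C N}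

/-- A morphism of the relative centre: a morphism compatible with the half braidings. -/
@[ext]
structure Hom (X Y : RelCenter B) where
  hom : X.obj ⟶ Y.obj
  comm (c : C) : hom ⊵ᵣ c ≫ (Y.braiding c).hom = (X.braiding c).hom ≫ c ⊴ₗ hom

instance : Category (RelCenter B) where
  Hom := Hom
  id X := ⟨𝟙 _, fun c => by simp⟩
  comp f g := ⟨f.hom ≫ g.hom, fun c => by
    rw [comp_actionHomLeft, Category.assoc, g.comm, reassoc_of% f.comm c, actionHomRight_comp]⟩

@[ext]
lemma hom_ext {X Y : RelCenter B} {f g : X ⟶ Y} (h : f.hom = g.hom) : f = g := Hom.ext h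

/-- An isomorphism of the relative centre from an isomorphism of the underlying objects. -/
@[simps]
def isoMk {X Y : RelCenter B} (f : X.obj ≅ Y.obj)
    (h : ∀ c, f.hom ⊵ᵣ c ≫ (Y.braiding c).hom = (X.braiding c).hom ≫ c ⊴ₗ f.hom) : X ≅ Y where
  hom := ⟨f.hom, h⟩
  inv := ⟨f.inv, fun c => by
    rw [← cancel_epi (f.hom ⊵ᵣ c), hom_inv_actionHomLeft_assoc, reassoc_of% h c,
      actionHomRight_hom_inv, Category.comp_id]⟩
  hom_inv_id := hom_ext f.hom_inv_id
  inv_hom_id := hom_ext f.inv_hom_id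

end RelCenter

/-- The structure of a `C`-`C` bimodule functor over `E` on a functor `G : C ⥤ N`, where the action
of `E` is given by `T`. -/
structure RegularStr (B : CentralBimodule E C C N) (G : C ⥤ N) where
  l (c x : C) : c ⊙ₗ G.obj x ≅ G.obj (c ⊗ x)
  r (x d : C) : G.obj x ⊙ᵣ d ≅ G.obj (x ⊗ d)
  l_natural_left {c c' : C} (f : c ⟶ c') (x : C) :
    f ⊵ₗ G.obj x ≫ (l c' x).hom = (l c x).hom ≫ G.map (f ▷ x)
  l_natural (c : C) {x x' : C} (f : x ⟶ x') :
    c ⊴ₗ G.map f ≫ (l c x').hom = (l c x).hom ≫ G.map (c ◁ f)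
  l_tensor (c c' x : C) : (l (c ⊗ c') x).hom ≫ G.map (α_ c c' x).hom =
    (αₗ c c' (G.obj x)).hom ≫ c ⊴ₗ (l c' x).hom ≫ (l c (c' ⊗ x)).hom
  l_unit (x : C) : (λₗ (G.obj x)).hom = (l (𝟙_ C) x).hom ≫ G.map (λ_ x).hom
  r_natural_right (x : C) {d d' : C} (f : d ⟶ d') :
    G.obj x ⊴ᵣ f ≫ (r x d').hom = (r x d).hom ≫ G.map (x ◁ f)
  r_natural {x x' : C} (f : x ⟶ x') (d : C) :
    G.map f ⊵ᵣ d ≫ (r x' d).hom = (r x d).hom ≫ G.map (f ▷ d)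
  r_tensor (x d d' : C) : (r x (d ⊗ d')).hom ≫ G.map (α_ x d d').inv =
    (αᵣ (G.obj x) d d').hom ≫ (r x d).hom ⊵ᵣ d' ≫ (r (x ⊗ d) d').hom
  r_unit (x : C) : (ρᵣ (G.obj x)).hom = (r x (𝟙_ C)).hom ≫ G.map (ρ_ x).hom
  bimodule (c x d : C) : (l c x).hom ⊵ᵣ d ≫ (r (c ⊗ x) d).hom ≫ G.map (α_ c x d).hom =
    (B.mid c (G.obj x) d).hom ≫ c ⊴ₗ (r x d).hom ≫ (l c (x ⊗ d)).hom
  central (e : E) (x : C) : (B.v e (G.obj x)).hom ≫ (r x (T C e)).hom =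
    (l (T C e) x).hom ≫ G.map (z C e x).hom

namespace RegularStr

variable {B : CentralBimodule E C C N} {G G' : C ⥤ N} (R : RegularStr B G) (R' : RegularStr B G')

/-- `c ⊙ G(𝟙) ≅ G(c)` -/
def left (c : C) : c ⊙ₗ G.obj (𝟙_ C) ≅ G.obj c := R.l c (𝟙_ C) ≪≫ G.mapIso (ρ_ c)

/-- `G(𝟙) ⊙ c ≅ G(c)` -/
def right (c : C) : G.obj (𝟙_ C) ⊙ᵣ c ≅ G.obj c := R.r (𝟙_ C) c ≪≫ G.mapIso (λ_ c)

lemma left_natural {c c' : C} (f : c ⟶ c') :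
    f ⊵ₗ G.obj (𝟙_ C) ≫ (R.left c').hom = (R.left c).hom ≫ G.map f := by
  simp only [left, Iso.trans_hom, Functor.mapIso_hom, Category.assoc,
    reassoc_of% R.l_natural_left f (𝟙_ C), ← G.map_comp, rightUnitor_naturality]

lemma right_natural {c c' : C} (f : c ⟶ c') :
    G.obj (𝟙_ C) ⊴ᵣ f ≫ (R.right c').hom = (R.right c).hom ≫ G.map f := by
  simp only [right, Iso.trans_hom, Functor.mapIso_hom, Category.assoc,
    reassoc_of% R.r_natural_right (𝟙_ C) f, ← G.map_comp, leftUnitor_naturality]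

/-- Associativity of the left structure with third argument `𝟙`: up to the associator, the right
unitor of `c ⊗ c'` is `c ◁ ρ_{c'}`. -/
lemma left_tensor (c c' : C) : (R.left (c ⊗ c')).hom =
    (αₗ c c' _).hom ≫ c ⊴ₗ (R.left c').hom ≫ (R.l c c').hom := by
  have h := R.l_tensor c c' (𝟙_ C)
  have h2 := R.l_natural c (ρ_ c').hom
  simp only [left, Iso.trans_hom, Functor.mapIso_hom, actionHomRight_comp, Category.assoc]
  rw [h2, ← reassoc_of% h, ← G.map_comp]
  simp

lemma right_tensor (c c' : C) : (R.right (c ⊗ c')).hom =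
    (αᵣ _ c c').hom ≫ (R.right c).hom ⊵ᵣ c' ≫ (R.r c c').hom := by
  have h := R.r_tensor (𝟙_ C) c c'
  have h2 := R.r_natural (λ_ c).hom c'
  simp only [right, Iso.trans_hom, Functor.mapIso_hom, comp_actionHomLeft, Category.assoc]
  rw [h2, ← reassoc_of% h, ← G.map_comp]
  simp

lemma left_unit : (R.left (𝟙_ C)).hom = (λₗ _).hom := by
  rw [R.l_unit, left, Iso.trans_hom, Functor.mapIso_hom, unitors_equal]

lemma right_unit : (R.right (𝟙_ C)).hom = (ρᵣ _).hom := by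
  rw [R.r_unit, right, Iso.trans_hom, Functor.mapIso_hom, unitors_equal]

/-- The bimodule axiom with middle argument `𝟙`, simplified by the triangle identity. The two ways
of building `G(c ⊗ d)` from `(c ⊙ G(𝟙)) ⊙ d` agree; the hexagon of the half braiding and `extend_r`
both rest on this. -/
lemma left_r (c d : C) : (R.left c).hom ⊵ᵣ d ≫ (R.r c d).hom =
    (B.mid c _ d).hom ≫ c ⊴ₗ (R.right d).hom ≫ (R.l c d).hom := by
  have h := R.bimodule c (𝟙_ C) d
  have h2 := R.r_natural (ρ_ c).hom d
  have h3 := R.l_natural c (λ_ d).hom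
  simp only [left, right, Iso.trans_hom, Functor.mapIso_hom, comp_actionHomLeft,
    actionHomRight_comp, Category.assoc]
  rw [h2, h3, ← reassoc_of% h, ← G.map_comp]
  simp

/-- The object `G(𝟙)` of the relative centre. -/
@[reducible]
def toRelCenter : RelCenter B where
  obj := G.obj (𝟙_ C)
  braiding c := R.right c ≪≫ (R.left c).symm
  braiding_natural {c c'} f := by
    simp only [Iso.trans_hom, Iso.symm_hom, reassoc_of% R.right_natural f, Category.assoc,
      Iso.cancel_iso_hom_left]
    rw [Iso.eq_inv_comp, ← reassoc_of% R.left_natural f, Iso.hom_inv_id, Category.comp_id]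
  braiding_tensor c c' := by
    -- After the associator these two factors make up `left (c ⊗ c')`, by `left_tensor`. So both
    -- sides become maps into `G(c ⊗ c')`: the left one is `right (c ⊗ c')`, and `left_r` brings the
    -- right one to the form given by `right_tensor`.
    rw [← cancel_mono (c ⊴ₗ (R.left c').hom), ← cancel_mono (R.l c c').hom]
    simp only [Iso.trans_hom, Iso.symm_hom, Category.assoc, ← R.left_tensor, Iso.inv_hom_id,
      Category.comp_id, ← actionHomRight_comp_assoc]
    rw [← R.left_r, ← comp_actionHomLeft_assoc]
    simp only [Category.assoc, Iso.inv_hom_id, Category.comp_id, R.right_tensor]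
  braiding_unit := by
    rw [← R.left_unit, Iso.trans_hom, Iso.symm_hom, Category.assoc, Iso.inv_hom_id,
      Category.comp_id, R.right_unit]
  braiding_central e := by
    have h := R.central e (𝟙_ C)
    -- The claim is that `v_e` followed by `right` equals `left` at `T(e)`. This is `central` at `x
    -- = 𝟙`, where `z_unit` turns the half braiding into `ρ ≫ λ⁻¹` and so exchanges the two unitors.
    rw [Iso.trans_hom, Iso.symm_hom, ← Category.assoc, Iso.comp_inv_eq, Category.id_comp, right,
      left, Iso.trans_hom, Iso.trans_hom, Functor.mapIso_hom, Functor.mapIso_hom, reassoc_of% h,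
      ← G.map_comp, z_unit, Category.assoc, Iso.inv_hom_id, Category.comp_id]

/-- A transformation which is compatible with the bimodule structures is determined by its value
at the unit. -/
lemma left_app {f : G ⟶ G'}
    (hl : ∀ c x, c ⊴ₗ f.app x ≫ (R'.l c x).hom = (R.l c x).hom ≫ f.app (c ⊗ x)) (c : C) :
    (R.left c).hom ≫ f.app c = c ⊴ₗ f.app (𝟙_ C) ≫ (R'.left c).hom := by
  have h := f.naturality (ρ_ c).hom
  simp only [left, Iso.trans_hom, Functor.mapIso_hom, Category.assoc, h,
    reassoc_of% hl c (𝟙_ C)]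

lemma right_app {f : G ⟶ G'}
    (hr : ∀ x d, f.app x ⊵ᵣ d ≫ (R'.r x d).hom = (R.r x d).hom ≫ f.app (x ⊗ d)) (c : C) :
    (R.right c).hom ≫ f.app c = f.app (𝟙_ C) ⊵ᵣ c ≫ (R'.right c).hom := by
  have h := f.naturality (λ_ c).hom
  simp only [right, Iso.trans_hom, Functor.mapIso_hom, Category.assoc, h,
    reassoc_of% hr (𝟙_ C) c]

/-- The morphism of the relative centre given by a bimodule natural transformation. -/
@[simps]
def toRelCenterHom {f : G ⟶ G'}
    (hl : ∀ c x, c ⊴ₗ f.app x ≫ (R'.l c x).hom = (R.l c x).hom ≫ f.app (c ⊗ x))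
    (hr : ∀ x d, f.app x ⊵ᵣ d ≫ (R'.r x d).hom = (R.r x d).hom ≫ f.app (x ⊗ d)) :
    R.toRelCenter ⟶ R'.toRelCenter where
  hom := f.app (𝟙_ C)
  comm c := by
    have h1 := left_app R R' hl c
    have h2 := right_app R R' hr c
    simp only [Iso.trans_hom, Iso.symm_hom, Category.assoc]
    -- Transporting `f.app 𝟙` along `right` gives `f.app c`, and transporting it along `left` gives
    -- the same `f.app c`; hence it commutes with the composite of the two.
    rw [← reassoc_of% h2, Iso.cancel_iso_hom_left, Iso.eq_inv_comp, reassoc_of% h1,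
      Iso.hom_inv_id, Category.comp_id]

/-- The transformation with a given value at the unit. -/
@[simps]
def extend (g : G.obj (𝟙_ C) ⟶ G'.obj (𝟙_ C)) : G ⟶ G' where
  app c := (R.left c).inv ≫ c ⊴ₗ g ≫ (R'.left c).hom
  naturality {c c'} f := by
    have h := R.left_natural f
    have h' := R'.left_natural f
    have h2 := action_exchange f g
    simp only [Category.assoc]
    rw [← h', ← cancel_epi (R.left c).hom, ← reassoc_of% h, Iso.hom_inv_id_assoc,
      Iso.hom_inv_id_assoc, reassoc_of% h2]

/-- By `left_tensor` on both functors, both sides reduce to `c ⊗ x` acting on `g`. Only the left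
structures enter, so `g` is arbitrary here; its compatibility with the half braidings matters only
for the right action. -/
lemma extend_l (g : G.obj (𝟙_ C) ⟶ G'.obj (𝟙_ C)) (c x : C) :
    c ⊴ₗ (extend R R' g).app x ≫ (R'.l c x).hom =
      (R.l c x).hom ≫ (extend R R' g).app (c ⊗ x) := by
  have h := R.left_tensor c x
  rw [← cancel_epi (c ⊴ₗ (R.left x).hom), ← cancel_epi (αₗ c x _).hom]
  simp only [extend_app]
  rw [← reassoc_of% h, Iso.hom_inv_id_assoc, R'.left_tensor, ← actionHomRight_comp_assoc,
    Iso.hom_inv_id_assoc, tensor_actionHomRight]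
  simp only [Category.assoc, Iso.inv_hom_id_assoc, actionHomRight_comp]

variable {R R'}

/-- This is the condition `comm` on `g` with the half braidings unfolded: extending `g` along
`right` gives the same transformation as extending it along `left`. -/
lemma right_extend (g : R.toRelCenter ⟶ R'.toRelCenter) (d : C) :
    (R.right d).hom ≫ (extend R R' g.hom).app d = g.hom ⊵ᵣ d ≫ (R'.right d).hom := by
  have h := g.comm d
  simp only [Iso.trans_hom, Iso.symm_hom, Category.assoc] at h
  rw [extend_app, ← reassoc_of% h, Iso.inv_hom_id, Category.comp_id]

/-- Since `G(x) ≅ x ⊙ G(𝟙)`, the bimodule axiom `left_r` moves the right action of `d` onto `G(𝟙)`.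
There the claim is `right_extend`, and the outer action of `x` is handled by `extend_l` and
naturality of `mid`. -/
lemma extend_r (g : R.toRelCenter ⟶ R'.toRelCenter) (x d : C) :
    (extend R R' g.hom).app x ⊵ᵣ d ≫ (R'.r x d).hom =
      (R.r x d).hom ≫ (extend R R' g.hom).app (x ⊗ d) := by
  have h1 := R.left_r x d
  have h2 := R'.left_r x d
  have h3 := B.mid_natural x g.hom d
  have h4 := right_extend g d
  rw [← cancel_epi ((R.left x).hom ⊵ᵣ d), reassoc_of% h1, ← extend_l,
    ← actionHomRight_comp_assoc, h4, extend_app]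
  simp only [comp_actionHomLeft, actionHomRight_comp, Category.assoc,
    hom_inv_actionHomLeft_assoc, h2, reassoc_of% h3]

variable (R R')

/-- At `𝟙` both identifications are unit constraints of the action (`left_unit`), whose naturality
gives back `g`. -/
lemma extend_unit (g : G.obj (𝟙_ C) ⟶ G'.obj (𝟙_ C)) : (extend R R' g).app (𝟙_ C) = g := by
  rw [extend_app, Iso.inv_comp_eq, left_unit, left_unit, actionUnitIso_hom_naturality]

end RegularStr

end RelativeCenter

/-! ### The bimodule functor `c ↦ c ⊙ n` attached to a half braiding on `n` -/

section FreeFunctor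

variable {E : Type uE} [Category.{vE} E] [MonoidalCategory E] [SymmetricCategory E]
  {C : Type uC} [Category.{vC} C] [MonoidalCategory C] [CentralStructure E C]
  {N : Type uM} [Category.{vM} N] [MonoidalLeftAction C N] [MonoidalRightAction C N]

/-- The functor `c ↦ c ⊙ n`. -/
@[simps]
abbrev actOn (C : Type uC) [Category.{vC} C] [MonoidalCategory C] [MonoidalLeftAction C N]
    (n : N) : C ⥤ N where
  obj c := c ⊙ₗ n
  map f := f ⊵ₗ n

namespace RelCenter

variable {B : CentralBimodule E C C N} (X : RelCenter B)

/-- `(x ⊙ n) ⊙ d ≅ (x ⊗ d) ⊙ n` -/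
def rightIso (x d : C) : (x ⊙ₗ X.obj) ⊙ᵣ d ≅ (x ⊗ d) ⊙ₗ X.obj :=
  B.mid x X.obj d ≪≫ lIso x (X.braiding d) ≪≫ (αₗ x d X.obj).symm

lemma rightIso_hom (x d : C) : (X.rightIso x d).hom =
    (B.mid x X.obj d).hom ≫ x ⊴ₗ (X.braiding d).hom ≫ (αₗ x d X.obj).inv := rfl

lemma rightIso_hom_assoc (x d : C) : (X.rightIso x d).hom ≫ (αₗ x d X.obj).hom =
    (B.mid x X.obj d).hom ≫ x ⊴ₗ (X.braiding d).hom := by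
  simp [rightIso_hom]

lemma rightIso_natural_right (x : C) {d d' : C} (f : d ⟶ d') :
    (x ⊙ₗ X.obj) ⊴ᵣ f ≫ (X.rightIso x d').hom = (X.rightIso x d).hom ≫ (x ◁ f) ⊵ₗ X.obj := by
  have h := B.mid_natural_right x X.obj f
  have h2 := congrArg (x ⊴ₗ ·) (X.braiding_natural f)
  simp only [actionHomRight_comp] at h2
  simp only [rightIso_hom, reassoc_of% h, reassoc_of% h2,
    MonoidalLeftAction.whiskerLeft_actionHomLeft, Category.assoc, Iso.inv_hom_id_assoc]

lemma rightIso_natural {x x' : C} (f : x ⟶ x') (d : C) :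
    (f ⊵ₗ X.obj) ⊵ᵣ d ≫ (X.rightIso x' d).hom = (X.rightIso x d).hom ≫ (f ▷ d) ⊵ₗ X.obj := by
  have h := B.mid_natural_left f X.obj d
  have h2 := action_exchange f (X.braiding d).hom
  simp only [rightIso_hom, reassoc_of% h, ← reassoc_of% h2,
    MonoidalLeftAction.whiskerRight_actionHomLeft, Category.assoc, Iso.inv_hom_id_assoc]

/-- The half braiding only moves `d` past `n`, so acting further on the left by `c` affects the
constraint `mid` alone, where `mid_tensor_left` applies. With the associators inverted this is the
bimodule axiom of `c ↦ c ⊙ n`. -/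
lemma rightIso_bimodule (c x d : C) :
    (αₗ c x X.obj).hom ⊵ᵣ d ≫ (B.mid c (x ⊙ₗ X.obj) d).hom ≫ c ⊴ₗ (X.rightIso x d).hom =
      (X.rightIso (c ⊗ x) d).hom ≫ (α_ c x d).hom ⊵ₗ X.obj ≫ (αₗ c (x ⊗ d) X.obj).hom := by
  have h := B.mid_tensor_left c x X.obj d
  rw [assoc_action, reassoc_of% X.rightIso_hom_assoc (c ⊗ x) d, tensor_actionHomRight]
  simp only [Category.assoc, Iso.inv_hom_id_assoc, reassoc_of% h, rightIso_hom,
    actionHomRight_comp]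

/-- The image under `x ⊙ -` of the hexagon for the half braiding, with the bimodule constraints
collected by `mid_tensor_right`. -/
lemma rightIso_tensor (x d d' : C) :
    (X.rightIso x (d ⊗ d')).hom ≫ (α_ x d d').inv ⊵ₗ X.obj =
      (αᵣ (x ⊙ₗ X.obj) d d').hom ≫ (X.rightIso x d).hom ⊵ᵣ d' ≫ (X.rightIso (x ⊗ d) d').hom := by
  have h1 := X.rightIso_bimodule x d d'
  have h2 := B.mid_tensor_right x X.obj d d'
  have h3 := B.mid_natural x (X.braiding d).hom d'
  have h4 := congrArg (x ⊴ₗ ·) (X.braiding_tensor d d')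
  simp only [actionHomRight_comp] at h4
  have h5 : (X.rightIso x d).hom ⊵ᵣ d' ≫ (αₗ x d X.obj).hom ⊵ᵣ d' =
      (B.mid x X.obj d).hom ⊵ᵣ d' ≫ (x ⊴ₗ (X.braiding d).hom) ⊵ᵣ d' := by
    rw [← comp_actionHomLeft, rightIso_hom_assoc, comp_actionHomLeft]
  have h6 : (α_ x d d').inv ⊵ₗ X.obj ≫ (α_ x d d').hom ⊵ₗ X.obj = 𝟙 _ := by
    rw [← MonoidalLeftAction.comp_actionHomLeft, Iso.inv_hom_id,
      MonoidalLeftAction.id_actionHomLeft]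
  -- With these factors appended, `rightIso_bimodule` replaces `rightIso (x ⊗ d) d'` by `x` acting
  -- on `rightIso d d'`, so that everything after the `mid`'s lies under `x ⊴ₗ -` and the hexagon
  -- can be used there.
  rw [← cancel_mono ((α_ x d d').hom ⊵ₗ X.obj), ← cancel_mono (αₗ x (d ⊗ d') X.obj).hom]
  simp only [Category.assoc, ← h1]
  rw [reassoc_of% h6, reassoc_of% h5, rightIso_hom_assoc, reassoc_of% h3, ← reassoc_of% h2,
    rightIso_hom, actionHomRight_comp, actionHomRight_comp, ← reassoc_of% h4,
    actionHomRight_hom_inv, Category.comp_id]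

lemma rightIso_unit (x : C) :
    (X.rightIso x (𝟙_ C)).hom ≫ (ρ_ x).hom ⊵ₗ X.obj = (ρᵣ (x ⊙ₗ X.obj)).hom := by
  have h := X.rightIso_hom_assoc x (𝟙_ C)
  rw [MonoidalLeftAction.rightUnitor_actionHom, reassoc_of% h, ← actionHomRight_comp,
    X.braiding_unit, B.mid_unit_right]

/-- The axiom `v_left` splits `v_e` on `x ⊙ n` into `z_{e,x}` and `v_e` on `n`; the latter cancels
against the half braiding at `T(e)`. -/
lemma rightIso_central (e : E) (x : C) :
    (B.v e (x ⊙ₗ X.obj)).hom ≫ (X.rightIso x (T C e)).hom =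
      (αₗ (T C e) x X.obj).inv ≫ (z C e x).hom ⊵ₗ X.obj := by
  have h := B.v_left e x X.obj
  rw [rightIso_hom, Iso.eq_inv_comp, ← reassoc_of% h, ← actionHomRight_comp_assoc,
    X.braiding_central]
  simp

/-- The bimodule functor `c ↦ c ⊙ n`. -/
@[reducible]
def regularStr : RegularStr B (actOn C X.obj) where
  l c x := (αₗ c x X.obj).symm
  r x d := X.rightIso x d
  l_natural_left f x := by simp
  l_natural c _ _ f := by simp
  l_tensor c c' x := by
    have h := MonoidalLeftAction.associator_actionHom c c' x X.obj
    rw [Iso.symm_hom, Iso.symm_hom, Iso.symm_hom, Iso.inv_comp_eq, ← reassoc_of% h]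
    simp
  l_unit x := by simp
  r_natural_right x _ _ f := X.rightIso_natural_right x f
  r_natural f d := X.rightIso_natural f d
  r_tensor x d d' := X.rightIso_tensor x d d'
  r_unit x := (X.rightIso_unit x).symm
  bimodule c x d := by
    have h := X.rightIso_bimodule c x d
    rw [← cancel_epi ((αₗ c x X.obj).hom ⊵ᵣ d), Iso.symm_hom, Iso.symm_hom, reassoc_of% h]
    simp
  central e x := X.rightIso_central e x

/-- Together with `right_regularStr` this shows that the half braiding on `𝟙 ⊙ n` obtained from `c ↦
c ⊙ n` corresponds to the original one under `𝟙 ⊙ n ≅ n`. -/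
lemma left_regularStr (c : C) : (X.regularStr.left c).hom = c ⊴ₗ (λₗ X.obj).hom := by
  change (αₗ c (𝟙_ C) X.obj).inv ≫ (ρ_ c).hom ⊵ₗ X.obj = _
  rw [MonoidalLeftAction.rightUnitor_actionHom, Iso.inv_hom_id_assoc]

lemma right_regularStr (c : C) :
    (X.regularStr.right c).hom = (λₗ X.obj).hom ⊵ᵣ c ≫ (X.braiding c).hom := by
  have h := X.rightIso_hom_assoc (𝟙_ C) c
  change (X.rightIso (𝟙_ C) c).hom ≫ (λ_ c).hom ⊵ₗ X.obj = _
  rw [MonoidalLeftAction.leftUnitor_actionHom, reassoc_of% h, ← actionUnitIso_hom_naturality,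
    ← B.mid_unit_left, Category.assoc]

/-- An object of the relative centre is recovered from the bimodule functor which it defines. -/
def regularStrIso : X.regularStr.toRelCenter ≅ X :=
  isoMk (λₗ X.obj) fun c => by
    rw [← X.right_regularStr, ← X.left_regularStr, Iso.trans_hom, Iso.symm_hom, Category.assoc,
      Iso.inv_hom_id, Category.comp_id]

end RelCenter

end FreeFunctor

/-! ### Evaluation at the unit is an equivalence onto the relative centre -/

section RegularFunctors

variable {k : Type*} [Field k]
  {E : Type uE} [Category.{vE} E] [Preadditive E] [Linear k E]
  [MonoidalCategory E] [SymmetricCategory E]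
  {C : Type uC} [Category.{vC} C] [Preadditive C] [Linear k C]
  [MonoidalCategory C] [MonoidalPreadditive C] [MonoidalLinear k C]
  [CentralStructure E C] [CentralStructure.IsLinear k E C]
  {N : Type uM} [Category.{vM} N] [Preadditive N] [Linear k N]
  [MonoidalLeftAction C N] [MonoidalRightAction C N]
  [LinearLeftAction k C N] [LinearRightAction k C N]

/-- A left `C`-module functor is a left `E`-module functor for the restricted actions. -/
@[reducible]
def restrictLinear {M : Type u} [Category.{v} M] [MonoidalLeftAction C M]
    {F : M ⥤ N} (p : F.LeftLinear C) :
    letI := restrictAction E C M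
    letI := restrictAction E C N
    F.LeftLinear E :=
  letI := restrictAction E C M
  letI := restrictAction E C N
  leftLinearMk (fun e m => Functor.LeftLinear.μₗIso F (T C e) m)
    (fun f m => p.μₗ_naturality_left (Tmap C f) m)
    (fun e _ _ f => p.μₗ_naturality_right (T C e) f)
    (fun e e' m => by
      have h := p.μₗ_associativity (T C e) (T C e') m
      have h2 := p.μₗ_naturality_left (TμIso C e e').inv m
      -- The associator of the restricted action is that of `C` preceded by the inverse of `T(e) ⊗
      -- T(e') ≅ T(e ⊗ e')`, so naturality in this inverse reduces the claim to associativity over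
      -- `C`.
      change p.μₗ (T C (e ⊗ e')) m ≫ F.map ((TμIso C e e').inv ⊵ₗ m ≫
        (αₗ (T C e) (T C e') m).hom) = ((TμIso C e e').inv ⊵ₗ F.obj m ≫
          (αₗ (T C e) (T C e') (F.obj m)).hom) ≫ T C e ⊴ₗ p.μₗ (T C e') m ≫
            p.μₗ (T C e) (T C e' ⊙ₗ m)
      rw [F.map_comp, ← reassoc_of% h2, h, Category.assoc])
    (fun m => by
      have h := p.μₗ_unitality m
      have h2 := p.μₗ_naturality_left (TεIso (E := E) C).inv m
      change (TεIso (E := E) C).inv ⊵ₗ F.obj m ≫ (λₗ (F.obj m)).hom =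
        p.μₗ (T C (𝟙_ E)) m ≫ F.map ((TεIso (E := E) C).inv ⊵ₗ m ≫ (λₗ m).hom)
      rw [F.map_comp, ← reassoc_of% h2, h])

variable (B : CentralBimodule E C C N)

variable {B} in
/-- The structure of a bimodule functor on a 1-morphism from the regular bimodule. -/
@[reducible]
def RegularStr.ofStr {G : C ⥤ N} (p : BMod.Str (regular k E C) (B.toBMod k) G) :
    RegularStr B G where
  l c x := @Functor.LeftLinear.μₗIso _ _ _ _ G C _ _ _ _ p.sC c x
  r x d := @Functor.RightLinear.μᵣIso _ _ _ _ G C _ _ _ _ p.tD x d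
  l_natural_left f x := p.sC.μₗ_naturality_left f x
  l_natural c _ _ f := p.sC.μₗ_naturality_right c f
  l_tensor c c' x := p.sC.μₗ_associativity c c' x
  l_unit x := p.sC.μₗ_unitality x
  r_natural_right x _ _ f := p.tD.μᵣ_naturality_right x f
  r_natural f d := p.tD.μᵣ_naturality_left f d
  r_tensor x d d' := p.tD.μᵣ_associativity x d d'
  r_unit x := p.tD.μᵣ_unitality x
  bimodule c x d := p.bimodule c x d
  central e x := by
    -- In both bimodules `uC` is the identity, so the `E`-structure is the `C`-structure at `T(e)`;
    -- `uD` is `z⁻¹` on the source and `v⁻¹` on the target. Eliminating the `E`-structure between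
    -- the two conditions leaves a relation between the left and right structures.
    have h1 : p.sC.μₗ (T C e) x ≫ G.map (𝟙 _) = 𝟙 _ ≫ p.sE.μₗ e x := p.uC_comp e x
    have h2 : p.tD.μᵣ x (T C e) ≫ G.map (z C e x).inv = (B.v e (G.obj x)).inv ≫ p.sE.μₗ e x :=
      p.uD_comp e x
    rw [G.map_id, Category.comp_id, Category.id_comp] at h1
    change (B.v e (G.obj x)).hom ≫ p.tD.μᵣ x (T C e) = p.sC.μₗ (T C e) x ≫ G.map (z C e x).hom
    rw [h1, ← Iso.eq_inv_comp, ← reassoc_of% h2, ← G.map_comp, Iso.inv_hom_id, G.map_id,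
      Category.comp_id]

/-- The functor `G ↦ G(𝟙)` from bimodule functors on the regular bimodule to the relative
centre. -/
@[simps]
def evalUnit : BMod.Fun (regular k E C) (B.toBMod k) ⥤ RelCenter B where
  obj Y := (RegularStr.ofStr Y.str).toRelCenter
  map f := RegularStr.toRelCenterHom _ _ (fun c x => f.mem.1 c x) (fun x d => f.mem.2 x d)
  map_id _ := rfl
  map_comp _ _ := rfl

/-- By `left_app` the component at `c` is the conjugate under `left c` of `c` acting on the
component at `𝟙`. -/
instance : (evalUnit (k := k) B).Faithful where
  map_injective {Y Y'} f g h := FunctorSystem.hom_ext fun c => by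
    have h1 := RegularStr.left_app (.ofStr Y.str) (.ofStr Y'.str) (fun c x => f.mem.1 c x) c
    have h2 := RegularStr.left_app (.ofStr Y.str) (.ofStr Y'.str) (fun c x => g.mem.1 c x) c
    have h3 : f.natTrans.app (𝟙_ C) = g.natTrans.app (𝟙_ C) := congrArg RelCenter.Hom.hom h
    rw [← cancel_epi ((RegularStr.ofStr Y.str).left c).hom]
    exact h1.trans ((congrArg (fun t => c ⊴ₗ t ≫ ((RegularStr.ofStr Y'.str).left c).hom) h3).trans
      h2.symm)

instance : (evalUnit (k := k) B).Full where
  map_surjective {Y Y'} g :=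
    ⟨⟨RegularStr.extend (.ofStr Y.str) (.ofStr Y'.str) g.hom,
      fun c x => RegularStr.extend_l _ _ g.hom c x, fun x d => RegularStr.extend_r g x d⟩,
      RelCenter.hom_ext (RegularStr.extend_unit _ _ g.hom)⟩

variable {B}

/-- The 1-morphism `c ↦ c ⊙ n` from the regular bimodule. -/
def RelCenter.toFun (X : RelCenter B) : BMod.Fun (regular k E C) (B.toBMod k) where
  functor := actOn C X.obj
  str :=
    letI p : (actOn C X.obj).LeftLinear C := leftLinearMk X.regularStr.l
      X.regularStr.l_natural_left X.regularStr.l_natural X.regularStr.l_tensor X.regularStr.l_unit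
    { additive := ⟨fun {_ _ f g} => LinearLeftAction.left_add (k := k) f g X.obj⟩
      linear := ⟨fun f r => LinearLeftAction.left_smul r f X.obj⟩
      sC := p
      tD := rightLinearMk X.regularStr.r X.regularStr.r_natural_right X.regularStr.r_natural
        X.regularStr.r_tensor X.regularStr.r_unit
      -- No other choice is possible: `uC` is the identity on both sides, so `uC_comp` forces the
      -- `E`-structure to be the `C`-structure at `T(e)`.
      sE := restrictLinear p
      bimodule := X.regularStr.bimodule
      uC_comp e x := by
        change p.μₗ (T C e) x ≫ (actOn C X.obj).map (𝟙 _) = 𝟙 _ ≫ p.μₗ (T C e) x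
        simp
      uD_comp e x := by
        have h := X.regularStr.central e x
        change (X.regularStr.r x (T C e)).hom ≫ (actOn C X.obj).map (z C e x).inv =
          (B.v e (x ⊙ₗ X.obj)).inv ≫ (X.regularStr.l (T C e) x).hom
        rw [Iso.eq_inv_comp, reassoc_of% h]
        simp }

variable (B)

instance : (evalUnit (k := k) B).EssSurj where
  mem_essImage X := ⟨X.toFun, ⟨X.regularStrIso⟩⟩

instance evalUnit_isEquivalence : (evalUnit (k := k) B).IsEquivalence where

end RegularFunctors

namespace BMod

variable {k : Type*} [Field k]
  {E : Type uE} [Category.{vE} E] [Preadditive E] [Linear k E]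
  [MonoidalCategory E] [SymmetricCategory E]
  {C : Type uC} [Category.{vC} C] [Preadditive C] [Linear k C]
  [MonoidalCategory C] [CentralStructure E C]
  {D : Type uD} [Category.{vD} D] [Preadditive D] [Linear k D]
  [MonoidalCategory D] [CentralStructure E D]
  {M M' : BMod k E C D}

/-! ### How `C`-, `D`- and `E`-module structures on one functor determine each other -/

section CompatibleStructures

variable {F G : M.carrier ⥤ M'.carrier}

/-- The natural isomorphism `c ⊙ F(-) ≅ F(c ⊙ -)` of a left `C`-module functor. -/
def lineator (q : F.LeftLinear C) (c : C) :
    F ⋙ actL M'.carrier c ≅ actL M.carrier c ⋙ F :=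
  NatIso.ofComponents (fun m => Functor.LeftLinear.μₗIso F c m)
    (fun f => q.μₗ_naturality_right c f)

/-- If the left `E`-module structure is the restriction of the left `C`-module structure, then
`c ⊙ F(-) ≅ F(c ⊙ -)` is an isomorphism of left `E`-module functors. -/
lemma lineator_mem_leftNat (p : F.LeftLinear E) (q : F.LeftLinear C)
    (h : ∀ (e : E) (m : M.carrier),
      q.μₗ (T C e) m ≫ F.map (M.uC e m).hom = (M'.uC e (F.obj m)).hom ≫ p.μₗ e m) (c : C) :
    (lineator q c).hom ∈ leftNat k (leftLinearComp p (M'.actLE c))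
      (leftLinearComp (M.actLE c) p) := fun e m => by
  have h1 := M'.uC_natural e (q.μₗ c m)
  have h2 := congrArg F.map (M.actLE_uC c e m)
  have h3 := M'.actLE_uC c e (F.obj m)
  have h4 := q.μₗ_associativity (T C e) c m
  have h5 := q.μₗ_associativity c (T C e) m
  have h6 := q.μₗ_naturality_left (z C e c).hom m
  have h7 := q.μₗ_naturality_right c (M.uC e m).hom
  have h8 := congrArg (c ⊴ₗ ·) (h e m)
  simp only [actionHomRight_comp] at h8
  simp only [Functor.map_comp] at h2
  change e ⊴ₗ q.μₗ c m ≫ p.μₗ e (c ⊙ₗ m) ≫ F.map ((M.actLE c).μₗ e m) =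
    ((M'.actLE c).μₗ e (F.obj m) ≫ c ⊴ₗ p.μₗ e m) ≫ q.μₗ c (e ⊙ₗ m)
  -- Composing with `uC` replaces the action of `e` by that of `T(e)` and the `E`-structure of `c ⊙
  -- -` by `z_{e,c}` (`actLE_uC`). What remains compares the structure of `F` at `T(e) ⊗ c` and at
  -- `c ⊗ T(e)`, which is naturality in `z_{e,c}`.
  rw [← cancel_epi (M'.uC e (c ⊙ₗ F.obj m)).hom, ← reassoc_of% h1, ← reassoc_of% h, h2,
    Category.assoc, reassoc_of% h3, ← reassoc_of% h8, h7,
    ← cancel_epi (αₗ (T C e) c (F.obj m)).hom, ← reassoc_of% h4, Iso.hom_inv_id_assoc,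
    ← reassoc_of% h5, reassoc_of% h6, ← F.map_comp_assoc, Iso.hom_inv_id, F.map_id,
    Category.id_comp]

/-- Since `uC` is invertible and natural, the `E`-structures are the `C`-structures at `T(e)`. This
is why 2-morphisms need only respect the actions of `C` and `D`. -/
lemma leftNat_of_uC {p : F.LeftLinear E} {q : F.LeftLinear C} {p' : G.LeftLinear E}
    {q' : G.LeftLinear C}
    (h : ∀ (e : E) (m : M.carrier),
      q.μₗ (T C e) m ≫ F.map (M.uC e m).hom = (M'.uC e (F.obj m)).hom ≫ p.μₗ e m)
    (h' : ∀ (e : E) (m : M.carrier),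
      q'.μₗ (T C e) m ≫ G.map (M.uC e m).hom = (M'.uC e (G.obj m)).hom ≫ p'.μₗ e m)
    {f : F ⟶ G} (hf : f ∈ leftNat k q q') : f ∈ leftNat k p p' := fun e m => by
  have h1 := M'.uC_natural e (f.app m)
  have h2 := hf (T C e) m
  have h3 := f.naturality (M.uC e m).hom
  rw [← cancel_epi (M'.uC e (F.obj m)).hom, ← reassoc_of% h1, ← h', reassoc_of% h2, ← h3,
    reassoc_of% h]

/-- The right action of `T(e)` is the left action of `e` transported along `uD`. If `D = E`, the
objects `T(e) = e` are all the objects acting on the right, so right linearity then follows entirely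
from `E`-linearity. -/
lemma rightNat_of_uD {p : F.LeftLinear E} {q : F.RightLinear D} {p' : G.LeftLinear E}
    {q' : G.RightLinear D}
    (h : ∀ (e : E) (m : M.carrier),
      q.μᵣ m (T D e) ≫ F.map (M.uD e m).hom = (M'.uD e (F.obj m)).hom ≫ p.μₗ e m)
    (h' : ∀ (e : E) (m : M.carrier),
      q'.μᵣ m (T D e) ≫ G.map (M.uD e m).hom = (M'.uD e (G.obj m)).hom ≫ p'.μₗ e m)
    {f : F ⟶ G} (hf : f ∈ leftNat k p p') (e : E) (m : M.carrier) :
    f.app m ⊵ᵣ T D e ≫ q'.μᵣ m (T D e) = q.μᵣ m (T D e) ≫ f.app (m ⊙ᵣ T D e) := by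
  have h1 := M'.uD_natural e (f.app m)
  have h2 := hf e m
  have h3 := f.naturality (M.uD e m).hom
  rw [← cancel_mono (G.map (M.uD e m).hom), Category.assoc, Category.assoc, h',
    reassoc_of% h1, h2, ← h3, reassoc_of% h]

/-- Compatibility with `uD` implies the compatibility between the left `C`-module structure and
the right action of the objects `T(e)`. -/
lemma bimodule_T (p : F.LeftLinear E) (q : F.LeftLinear C) (r : F.RightLinear D)
    (h : ∀ (e : E) (m : M.carrier),
      q.μₗ (T C e) m ≫ F.map (M.uC e m).hom = (M'.uC e (F.obj m)).hom ≫ p.μₗ e m)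
    (h' : ∀ (e : E) (m : M.carrier),
      r.μᵣ m (T D e) ≫ F.map (M.uD e m).hom = (M'.uD e (F.obj m)).hom ≫ p.μₗ e m)
    (c : C) (m : M.carrier) (e : E) :
    q.μₗ c m ⊵ᵣ T D e ≫ r.μᵣ (c ⊙ₗ m) (T D e) ≫ F.map (M.mid c m (T D e)).hom =
      (M'.mid c (F.obj m) (T D e)).hom ≫ c ⊴ₗ r.μᵣ m (T D e) ≫ q.μₗ c (m ⊙ᵣ T D e) := by
  have h1 := M'.uD_natural e (q.μₗ c m)
  -- The claim is this `E`-linearity transported along `uD`: by `actLE_uD` the `E`-structure of `c ⊙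
  -- -` becomes the bimodule constraint `mid`.
  have h2 : e ⊴ₗ q.μₗ c m ≫ p.μₗ e (c ⊙ₗ m) ≫ F.map ((M.actLE c).μₗ e m) =
      ((M'.actLE c).μₗ e (F.obj m) ≫ c ⊴ₗ p.μₗ e m) ≫ q.μₗ c (e ⊙ₗ m) :=
    lineator_mem_leftNat p q h c e m
  have h3 := congrArg F.map (M.actLE_uD c e m)
  have h4 := M'.actLE_uD c e (F.obj m)
  have h5 := q.μₗ_naturality_right c (M.uD e m).hom
  have h6 := congrArg (c ⊴ₗ ·) (h' e m)
  simp only [actionHomRight_comp] at h6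
  simp only [Functor.map_comp] at h3
  rw [← cancel_mono (F.map (c ⊴ₗ (M.uD e m).hom))]
  simp only [Category.assoc] at h2 ⊢
  rw [← h3, reassoc_of% h', reassoc_of% h1, h2, reassoc_of% h4, ← h5, reassoc_of% h6]

end CompatibleStructures

/-! ### Half braidings on structured functors as left `C`-module structures -/

namespace Closed

variable {S : FunctorSystem k M.carrier M'.carrier} (K : Closed M M' S)

/-- The relative centre of the category of structured functors. -/
abbrev RelCenter :=
  letI := K.leftAction
  letI := K.rightAction
  OverSymm.RelCenter K.central

variable {K} (X Y : K.RelCenter)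

/-- The half braiding `F(c ⊙ m) ≅ c ⊙ F(m)`. -/
def braidingApp (c : C) (m : M.carrier) :
    X.obj.functor.obj (c ⊙ₗ m) ≅ c ⊙ₗ X.obj.functor.obj m where
  hom := (X.braiding c).hom.natTrans.app m
  inv := (X.braiding c).inv.natTrans.app m
  hom_inv_id := congrArg (fun f => f.natTrans.app m) (X.braiding c).hom_inv_id
  inv_hom_id := congrArg (fun f => f.natTrans.app m) (X.braiding c).inv_hom_id

lemma braidingApp_natural (c : C) {m m' : M.carrier} (f : m ⟶ m') :
    X.obj.functor.map (c ⊴ₗ f) ≫ (braidingApp X c m').hom =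
      (braidingApp X c m).hom ≫ c ⊴ₗ X.obj.functor.map f :=
  (X.braiding c).hom.natTrans.naturality f

lemma braidingApp_natural_left {c c' : C} (f : c ⟶ c') (m : M.carrier) :
    X.obj.functor.map (f ⊵ₗ m) ≫ (braidingApp X c' m).hom =
      (braidingApp X c m).hom ≫ f ⊵ₗ X.obj.functor.obj m :=
  congrArg (fun f => f.natTrans.app m) (X.braiding_natural f)

/-- The hexagon evaluated at `m`. The constraint `(c ⊙ F) ⊙ c' ≅ c ⊙ (F ⊙ c')` of functor categories
is the identity and drops out. -/
lemma braidingApp_tensor (c c' : C) (m : M.carrier) :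
    (braidingApp X (c ⊗ c') m).hom ≫ (αₗ c c' (X.obj.functor.obj m)).hom =
      X.obj.functor.map (αₗ c c' m).hom ≫ (braidingApp X c (c' ⊙ₗ m)).hom ≫
        c ⊴ₗ (braidingApp X c' m).hom :=
  (congrArg (fun f => f.natTrans.app m) (X.braiding_tensor c c')).trans
    (congrArg (fun t => X.obj.functor.map (αₗ c c' m).hom ≫
      (braidingApp X c (c' ⊙ₗ m)).hom ≫ t) (Category.id_comp _))

lemma braidingApp_unit (m : M.carrier) :
    (braidingApp X (𝟙_ C) m).hom ≫ (λₗ (X.obj.functor.obj m)).hom =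
      X.obj.functor.map (λₗ m).hom :=
  congrArg (fun f => f.natTrans.app m) X.braiding_unit

/-- The left `C`-module structure given by the half braiding. -/
@[reducible]
def leftLinear : X.obj.functor.LeftLinear C :=
  -- As `C` acts on the right by precomposition, the half braiding goes from `F(c ⊙ m)` to `c ⊙
  -- F(m)`; a module structure is its inverse.
  leftLinearMk (fun c m => (braidingApp X c m).symm)
    (fun f m => by
      have h := braidingApp_natural_left X f m
      rw [Iso.symm_hom, Iso.symm_hom, Iso.comp_inv_eq, Category.assoc, h, Iso.inv_hom_id_assoc])
    (fun c _ _ f => by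
      have h := braidingApp_natural X c f
      rw [Iso.symm_hom, Iso.symm_hom, Iso.comp_inv_eq, Category.assoc, h, Iso.inv_hom_id_assoc])
    (fun c c' m => by
      have h := braidingApp_tensor X c c' m
      rw [Iso.symm_hom, Iso.symm_hom, Iso.symm_hom, Iso.inv_comp_eq, reassoc_of% h,
        actionHomRight_hom_inv_assoc, Iso.hom_inv_id, Category.comp_id])
    (fun m => by
      have h := braidingApp_unit X m
      rw [Iso.symm_hom, Iso.eq_inv_comp, h])

/-- On functors `v_e` is the composite `T(e) ⊙ F(m) ≅ e ⊙ F(m) ≅ F(e ⊙ m) ≅ F(T(e) ⊙ m)`. Being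
inverse to the half braiding, it is the new `C`-structure at `T(e)`; cancelling its last factor
leaves compatibility with `uC`. -/
lemma leftLinear_uC (e : E) (m : M.carrier) :
    (leftLinear X).μₗ (T C e) m ≫ X.obj.functor.map (M.uC e m).hom =
      (M'.uC e (X.obj.functor.obj m)).hom ≫ (K.sE X.obj.str).μₗ e m := by
  have h : ((M'.uC e (X.obj.functor.obj m)).hom ≫ (K.sE X.obj.str).μₗ e m ≫
      X.obj.functor.map (M.uC e m).inv) ≫ (braidingApp X (T C e) m).hom = 𝟙 _ :=
    congrArg (fun f => f.natTrans.app m) (X.braiding_central e)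
  change (braidingApp X (T C e) m).inv ≫ _ = _
  rw [← Iso.eq_comp_inv, Category.id_comp] at h
  rw [← h]
  simp only [Category.assoc, ← Functor.map_comp, Iso.inv_hom_id,
    CategoryTheory.Functor.map_id, Category.comp_id]

variable {X Y}

lemma hom_mem_leftNat (f : X ⟶ Y) : f.hom.natTrans ∈ leftNat k (leftLinear X) (leftLinear Y) :=
  fun c m => by
  have h : f.hom.natTrans.app (c ⊙ₗ m) ≫ (braidingApp Y c m).hom =
      (braidingApp X c m).hom ≫ c ⊴ₗ f.hom.natTrans.app m :=
    congrArg (fun f => f.natTrans.app m) (f.comm c)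
  change c ⊴ₗ f.hom.natTrans.app m ≫ (braidingApp Y c m).inv =
    (braidingApp X c m).inv ≫ f.hom.natTrans.app (c ⊙ₗ m)
  rw [Iso.eq_inv_comp, ← reassoc_of% h, Iso.hom_inv_id, Category.comp_id]

/-- A morphism of the relative centre from a structured transformation of left `C`-module
functors. -/
@[simps]
def homMk (f : X.obj ⟶ Y.obj) (hf : f.natTrans ∈ leftNat k (leftLinear X) (leftLinear Y)) :
    X ⟶ Y where
  hom := f
  comm c := FunctorSystem.hom_ext fun m => by
    have h : c ⊴ₗ f.natTrans.app m ≫ (braidingApp Y c m).inv =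
      (braidingApp X c m).inv ≫ f.natTrans.app (c ⊙ₗ m) := hf c m
    change f.natTrans.app (c ⊙ₗ m) ≫ (braidingApp Y c m).hom =
      (braidingApp X c m).hom ≫ c ⊴ₗ f.natTrans.app m
    rw [← Iso.eq_comp_inv, Category.assoc, h, Iso.hom_inv_id_assoc]

variable (K)

/-- The object of the relative centre given by a structured left `C`-module functor. -/
@[reducible]
def ofLeftLinear {F : M.carrier ⥤ M'.carrier} (p : S.Str F) (q : F.LeftLinear C)
    (h : ∀ c, (lineator q c).hom ∈ S.hom (K.post c p) (K.pre c p))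
    (h' : ∀ (e : E) (m : M.carrier),
      q.μₗ (T C e) m ≫ F.map (M.uC e m).hom =
        (M'.uC e (F.obj m)).hom ≫ (K.sE p).μₗ e m) : K.RelCenter :=
  letI := K.leftAction
  letI := K.rightAction
  { obj := ⟨F, p⟩
    braiding := fun c => (FunctorSystem.isoMk (S := S) (X := ⟨_, K.post c p⟩)
      (Y := ⟨_, K.pre c p⟩) (lineator q c) (h c) (K.hom_inv _ (h c))).symm
    -- The half braiding is `δₗ`, the inverse of the module constraint, so its axioms are the oplax
    -- module functor axioms evaluated at `m`.
    braiding_natural := fun f => FunctorSystem.hom_ext fun m => q.δₗ_naturality_left f m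
    braiding_tensor := fun c c' => FunctorSystem.hom_ext fun m =>
      (q.δₗ_associativity c c' m).trans
        (congrArg (fun t => F.map (αₗ c c' m).hom ≫ q.δₗ c (c' ⊙ₗ m) ≫ t)
          (Category.id_comp _).symm)
    braiding_unit := FunctorSystem.hom_ext fun m => δₗ_unitality_hom F m
    braiding_central := fun e => FunctorSystem.hom_ext fun m => by
      change ((M'.uC e (F.obj m)).hom ≫ (K.sE p).μₗ e m ≫ F.map (M.uC e m).inv) ≫
        q.δₗ (T C e) m = 𝟙 _
      rw [← reassoc_of% h', ← F.map_comp, Iso.hom_inv_id, F.map_id, Category.comp_id,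
        q.μₗ_comp_δₗ] }

end Closed

end BMod

namespace BMod

section

variable {k : Type*} [Field k]
  {E : Type uE} [Category.{vE} E] [Preadditive E] [Linear k E]
  [MonoidalCategory E] [SymmetricCategory E]
  {C : Type uC} [Category.{vC} C] [Preadditive C] [Linear k C]
  [MonoidalCategory C] [CentralStructure E C]
  {D : Type uD} [Category.{vD} D] [Preadditive D] [Linear k D]
  [MonoidalCategory D] [CentralStructure E D]

/-! ### Evaluation at the unit for categories of structured functors -/

section EvalUnit

variable [MonoidalPreadditive C] [MonoidalLinear k C] [CentralStructure.IsLinear k E C]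
  {M M' : BMod k E C D} {S : FunctorSystem k M.carrier M'.carrier}

/-- The functor from bimodule functors on the regular bimodule to the relative centre of the
category of structured functors. -/
abbrev Closed.evalUnit (K : Closed M M' S) : Fun (regular k E C) K.toBMod ⥤ K.RelCenter :=
  letI := K.leftAction
  letI := K.rightAction
  have := K.leftAction_linear
  have := K.rightAction_linear
  OverSymm.evalUnit (k := k) K.central

instance (K : Closed M M' S) : K.evalUnit.IsEquivalence :=
  let := K.leftAction
  let := K.rightAction
  have := K.leftAction_linear
  have := K.rightAction_linear
  evalUnit_isEquivalence K.central

end EvalUnit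

/-! ### The relative centre of `Fun_{D^rev}(M, M')` -/

section RightFunctors

variable (M M' : BMod k E C D)

open Closed

/-- The functor from the relative centre of `Fun_{D^rev}(M, M')` to `Fun(M, M')` which regards the
half braiding as a left `C`-module structure. -/
@[simps]
def relCenterRightFun : (closedR M M').RelCenter ⥤ Fun M M' where
  obj X := ⟨X.obj.functor,
    { additive := X.obj.str.additive
      linear := X.obj.str.linear
      sC := leftLinear X
      tD := X.obj.str.tD
      sE := X.obj.str.sE
      -- The bimodule axiom says that each `c ⊙ F(-) ≅ F(c ⊙ -)` is right `D`-linear, which is part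
      -- of being a morphism of `Fun_{D^rev}`.
      bimodule := fun c m d => ((X.braiding c).inv.mem.2 m d).trans (Category.assoc _ _ _)
      uC_comp := leftLinear_uC X
      uD_comp := X.obj.str.uD_comp }⟩
  map f := ⟨f.hom.natTrans, hom_mem_leftNat f, f.hom.mem.2⟩
  map_id _ := rfl
  map_comp _ _ := rfl

instance : (relCenterRightFun M M').Faithful where
  map_injective h := RelCenter.hom_ext (FunctorSystem.Hom.ext (congrArg (fun f => f.natTrans) h))

instance : (relCenterRightFun M M').Full where
  map_surjective {X Y} f :=
    -- A 2-morphism respects `C` and `D` by definition; respecting `E`, as required in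
    -- `Fun_{D^rev}`, follows from `C` through `uC`.
    ⟨homMk ⟨f.natTrans, leftNat_of_uC (leftLinear_uC X) (leftLinear_uC Y) f.mem.1, f.mem.2⟩
      f.mem.1, rfl⟩

variable {M M'} in
/-- The object of the relative centre of `Fun_{D^rev}(M, M')` given by a 1-morphism. -/
def Fun.toRelCenterRight (Y : Fun M M') : (closedR M M').RelCenter :=
  (closedR M M').ofLeftLinear (F := Y.functor)
    { additive := Y.str.additive
      linear := Y.str.linear
      sE := Y.str.sE
      tD := Y.str.tD
      bimodule := bimodule_of_uD _ _ Y.str.uD_comp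
      uD_comp := Y.str.uD_comp }
    Y.str.sC
    -- The constraint must be a morphism of `Fun_{D^rev}`: `E`-linearity comes from compatibility
    -- with `uC`, right `D`-linearity is the bimodule axiom.
    (fun c => ⟨lineator_mem_leftNat _ _ Y.str.uC_comp c,
      fun m d => (Y.str.bimodule c m d).trans (Category.assoc _ _ _).symm⟩)
    Y.str.uC_comp

/-- Inverting the module constraint twice returns it on the nose, so the identity transformation is
already the required isomorphism. -/
instance : (relCenterRightFun M M').EssSurj where
  mem_essImage Y := ⟨Y.toRelCenterRight,
    ⟨FunctorSystem.isoMk (Iso.refl _) ⟨leftNat_id k Y.str.sC, rightNat_id k Y.str.tD⟩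
      ⟨leftNat_id k Y.str.sC, rightNat_id k Y.str.tD⟩⟩⟩

instance : (relCenterRightFun M M').IsEquivalence where

end RightFunctors

/-! ### The case `D = E`: the relative centre of `Fun_E(M, M')` -/

section ModuleFunctors

variable (M M' : BMod k E C E)

open Closed

/-- The isomorphism `m ⊙ e ≅ e ⊙ m` given by `uD` if `D = E`. -/
def uSelf (e : E) (m : M.carrier) : m ⊙ᵣ e ≅ e ⊙ₗ m := M.uD e m

lemma uSelf_natural_left {e e' : E} (f : e ⟶ e') (m : M.carrier) :
    m ⊴ᵣ f ≫ (M.uSelf e' m).hom = (M.uSelf e m).hom ≫ f ⊵ₗ m :=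
  M.uD_natural_left f m

lemma uSelf_natural (e : E) {m m' : M.carrier} (f : m ⟶ m') :
    f ⊵ᵣ e ≫ (M.uSelf e m').hom = (M.uSelf e m).hom ≫ e ⊴ₗ f :=
  M.uD_natural e f

/-- The monoidal constraint of `E ⥤ Z(E)` has identity components, so the factor `Tμ` in `uD_tensor`
acts as the identity. -/
lemma uSelf_tensor (e e' : E) (m : M.carrier) :
    (M.uSelf (e ⊗ e') m).hom ≫ (β_ e e').hom ⊵ₗ m ≫ (αₗ e' e m).hom =
      (αᵣ m e e').hom ≫ (M.uSelf e m).hom ⊵ᵣ e' ≫ (M.uSelf e' (e ⊙ₗ m)).hom := by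
  have h : m ⊴ᵣ 𝟙 (e ⊗ e') ≫ (M.uSelf (e ⊗ e') m).hom ≫ (β_ e e').hom ⊵ₗ m ≫
      (αₗ e' e m).hom = _ := M.uD_tensor e e' m
  rw [MonoidalRightAction.actionHomRight_id, Category.id_comp] at h
  exact h

lemma uSelf_unit (m : M.carrier) :
    (M.uSelf (𝟙_ E) m).hom ≫ (λₗ m).hom = (ρᵣ m).hom := by
  have h : m ⊴ᵣ 𝟙 (𝟙_ E) ≫ (M.uSelf (𝟙_ E) m).hom ≫ (λₗ m).hom = _ := M.uD_unit m
  rw [MonoidalRightAction.actionHomRight_id, Category.id_comp] at h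
  exact h

variable {M M'}

/-- The right `E`-module structure on a left `E`-module functor. -/
@[reducible]
def rightLinearOfLeft {F : M.carrier ⥤ M'.carrier} (p : F.LeftLinear E) : F.RightLinear E :=
  rightLinearMk (fun m e => M'.uSelf e (F.obj m) ≪≫ Functor.LeftLinear.μₗIso F e m ≪≫
      F.mapIso (M.uSelf e m).symm)
    (fun m {e e'} f => by
      have h := M'.uSelf_natural_left f (F.obj m)
      have h2 := p.μₗ_naturality_left f m
      have h3 := congrArg F.map (M.uSelf_natural_left f m)
      simp only [Functor.map_comp] at h3
      rw [← cancel_mono (F.map (M.uSelf e' m).hom)]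
      simp only [Iso.trans_hom, Functor.mapIso_hom, Iso.symm_hom, Category.assoc, h3]
      rw [← F.map_comp, Iso.inv_hom_id, F.map_id, Category.comp_id,
        ← F.map_comp_assoc, Iso.inv_hom_id, F.map_id, Category.id_comp, reassoc_of% h, h2])
    (fun {m m'} f e => by
      have h := M'.uSelf_natural e (F.map f)
      have h2 := p.μₗ_naturality_right e f
      have h3 := congrArg F.map (M.uSelf_natural e f)
      simp only [Functor.map_comp] at h3
      rw [← cancel_mono (F.map (M.uSelf e m').hom)]
      simp only [Iso.trans_hom, Functor.mapIso_hom, Iso.symm_hom, Category.assoc, h3]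
      rw [← F.map_comp, Iso.inv_hom_id, F.map_id, Category.comp_id,
        ← F.map_comp_assoc, Iso.inv_hom_id, F.map_id, Category.id_comp, reassoc_of% h, h2])
    (fun m e e' => by
      -- Passing from right to left actions reverses the order of `e` and `e'`. So left
      -- associativity is needed at `(e', e)`, and the symmetry is absorbed by naturality of `p.μₗ`
      -- in `β_ e e'`.
      have h1 := congrArg F.map (M.uSelf_tensor e e' m)
      have h2 := M'.uSelf_tensor e e' (F.obj m)
      have h3 := p.μₗ_naturality_left (β_ e e').hom m
      have h4 := p.μₗ_associativity e' e m
      have h5 := congrArg F.map (M.uSelf_natural e' (M.uSelf e m).hom)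
      have h6 := p.μₗ_naturality_right e' (M.uSelf e m).hom
      have h7 := M'.uSelf_natural e' (F.map (M.uSelf e m).hom)
      have h8 := M'.uSelf_natural e' (p.μₗ e m)
      simp only [Functor.map_comp] at h1 h5
      -- Composing with the images of these isomorphisms removes the inverses of `uSelf` and leads
      -- both sides to `F(e' ⊙ e ⊙ m)`.
      rw [← cancel_mono (F.map ((M.uSelf e m).hom ⊵ᵣ e')),
        ← cancel_mono (F.map (M.uSelf e' (e ⊙ₗ m)).hom)]
      simp only [Iso.trans_hom, Functor.mapIso_hom, Iso.symm_hom, Category.assoc]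
      rw [← h1, ← F.map_comp_assoc, Iso.inv_hom_id, F.map_id, Category.id_comp, ← reassoc_of% h3,
        h4, reassoc_of% h2, h5, ← F.map_comp_assoc (M.uSelf e' (m ⊙ᵣ e)).inv, Iso.inv_hom_id,
        F.map_id, Category.id_comp, ← h6, ← reassoc_of% h7, ← comp_actionHomLeft_assoc]
      simp only [Category.assoc]
      rw [← F.map_comp, Iso.inv_hom_id, F.map_id, Category.comp_id, comp_actionHomLeft,
        Category.assoc, reassoc_of% h8])
    (fun m => by
      have h := M'.uSelf_unit (F.obj m)
      have h2 := p.μₗ_unitality m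
      have h3 := congrArg F.map (M.uSelf_unit m)
      simp only [Functor.map_comp] at h3
      simp only [Iso.trans_hom, Functor.mapIso_hom, Iso.symm_hom, Category.assoc]
      rw [← h3, ← h, h2, ← F.map_comp_assoc (M.uSelf (𝟙_ E) m).inv, Iso.inv_hom_id, F.map_id,
        Category.id_comp])

/-- As `F` sends `uD` to an isomorphism, this relation characterises the right structure among all
right `E`-structures on `F`. -/
lemma rightLinearOfLeft_uD {F : M.carrier ⥤ M'.carrier} (p : F.LeftLinear E) (e : E)
    (m : M.carrier) :
    (rightLinearOfLeft p).μᵣ m (T E e) ≫ F.map (M.uD e m).hom =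
      (M'.uD e (F.obj m)).hom ≫ p.μₗ e m := by
  change ((M'.uSelf e (F.obj m)).hom ≫ p.μₗ e m ≫ F.map (M.uSelf e m).inv) ≫
    F.map (M.uSelf e m).hom = (M'.uSelf e (F.obj m)).hom ≫ p.μₗ e m
  simp only [Category.assoc]
  rw [← F.map_comp, Iso.inv_hom_id, F.map_id, Category.comp_id]

variable (M M')

/-- The functor from the relative centre of `Fun_E(M, M')` to `Fun(M, M')` which regards the
half braiding as a left `C`-module structure. -/
@[simps]
def relCenterEFun : (closedE M M').RelCenter ⥤ Fun M M' where
  obj X := ⟨X.obj.functor,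
    { additive := X.obj.str.additive
      linear := X.obj.str.linear
      sC := leftLinear X
      tD := rightLinearOfLeft X.obj.str.sE
      sE := X.obj.str.sE
      -- Over itself `E` has `T(e) = e`, so `bimodule_T`, which treats only objects of the form
      -- `T(e)`, covers the whole right action.
      bimodule := bimodule_T _ _ _ (leftLinear_uC X) (rightLinearOfLeft_uD X.obj.str.sE)
      uC_comp := leftLinear_uC X
      uD_comp := rightLinearOfLeft_uD X.obj.str.sE }⟩
  map {X Y} f := ⟨f.hom.natTrans, hom_mem_leftNat f, fun m e =>
    rightNat_of_uD (rightLinearOfLeft_uD X.obj.str.sE) (rightLinearOfLeft_uD Y.obj.str.sE)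
      f.hom.mem e m⟩
  map_id _ := rfl
  map_comp _ _ := rfl

instance : (relCenterEFun M M').Faithful where
  map_injective h := RelCenter.hom_ext (FunctorSystem.Hom.ext (congrArg (fun f => f.natTrans) h))

instance : (relCenterEFun M M').Full where
  map_surjective {X Y} f :=
    ⟨homMk ⟨f.natTrans, leftNat_of_uC (leftLinear_uC X) (leftLinear_uC Y) f.mem.1⟩
      f.mem.1, rfl⟩

variable {M M'} in
/-- The object of the relative centre of `Fun_E(M, M')` given by a 1-morphism. -/
def Fun.toRelCenterE (Y : Fun M M') : (closedE M M').RelCenter :=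
  (closedE M M').ofLeftLinear (F := Y.functor)
    { additive := Y.str.additive
      linear := Y.str.linear
      sE := Y.str.sE }
    Y.str.sC (lineator_mem_leftNat _ _ Y.str.uC_comp) Y.str.uC_comp

instance : (relCenterEFun M M').EssSurj where
  mem_essImage Y := ⟨Y.toRelCenterE,
    ⟨FunctorSystem.isoMk (Iso.refl _)
      -- The right structure rebuilt from `sE` is not literally the given one. Both are compatible
      -- with `uD` over the same `E`-structure, so the identity transformation is right linear in
      -- either direction.
      ⟨leftNat_id k Y.str.sC, fun m e => rightNat_of_uD (rightLinearOfLeft_uD Y.str.sE)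
        Y.str.uD_comp (leftNat_id k Y.str.sE) e m⟩
      ⟨leftNat_id k Y.str.sC, fun m e => rightNat_of_uD Y.str.uD_comp
        (rightLinearOfLeft_uD Y.str.sE) (leftNat_id k Y.str.sE) e m⟩⟩⟩

instance : (relCenterEFun M M').IsEquivalence where

end ModuleFunctors

end

end BMod

end OverSymm

end

theorem mainTheorem9 {k : Type*} [Field k] [IsAlgClosed k] [CharZero k]
    {E : Type*} [Category* E] [Preadditive E] [Linear k E]
    [MonoidalCategory E] [SymmetricCategory E] [OverSymm.IsFusion k E]
    {C : Type*} [Category* C] [Preadditive C] [Linear k C]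
    [MonoidalCategory C] [OverSymm.IsMultifusion k C]
    [OverSymm.CentralStructure E C] [OverSymm.CentralStructure.IsLinear k E C] :
    (∀ {D : Type*} [Category* D] [Preadditive D] [Linear k D]
      [MonoidalCategory D] [OverSymm.IsMultifusion k D]
      [OverSymm.CentralStructure E D] [OverSymm.CentralStructure.IsLinear k E D]
      (M M' : OverSymm.BMod k E C D)
      (hM : OverSymm.IsFiniteSemisimple k M.carrier)
      (hM' : OverSymm.IsFiniteSemisimple k M'.carrier),
      ∃ Φ : OverSymm.BMod.Fun (OverSymm.regular k E C) (M.rightFunBMod M') ≌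
          OverSymm.BMod.Fun M M',
        Φ.functor.Additive ∧ Φ.functor.Linear k) ∧
    (∀ (M M' : OverSymm.BMod k E C E)
      (hM : OverSymm.IsFiniteSemisimple k M.carrier)
      (hM' : OverSymm.IsFiniteSemisimple k M'.carrier),
      ∃ Φ : OverSymm.BMod.Fun (OverSymm.regular k E C) (M.eFunBMod M') ≌
          OverSymm.BMod.Fun M M',
        Φ.functor.Additive ∧ Φ.functor.Linear k) := by
  -- The composite sends a transformation to its component at `𝟙`, keeping the underlying
  -- transformation of functors `M ⥤ M'`. Sums and scalar multiples are formed componentwise, so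
  -- additivity and `k`-linearity hold by definition.
  exact ⟨fun M M' _ _ => ⟨((M.closedR M').evalUnit ⋙ M.relCenterRightFun M').asEquivalence,
      ⟨rfl⟩, ⟨fun _ _ => rfl⟩⟩,
    fun M M' _ _ => ⟨((M.closedE M').evalUnit ⋙ M.relCenterEFun M').asEquivalence,
      ⟨rfl⟩, ⟨fun _ _ => rfl⟩⟩⟩
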